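/- Let $d\ge 2$, let $\sigma$ be the normalized surface measure on the unit sphere of $\mathbb{R}^d$, $A_tf(x)=\int f(x-ty)\,d\sigma(y)$, and for $E\subset[1,2]$ let $M_Ef(x)=\sup_{t\in E}|A_tf(x)|$. Call $M_E$ of strong type $(p,q)$ if it is bounded from $L^p(\mathbb{R}^d)$ to $L^q(\mathbb{R}^d)$, and of restricted weak type $(p,q)$ if it is bounded from the Lorentz space $L^{p,1}(\mathbb{R}^d)$ to $L^{q,\infty}(\mathbb{R}^d)$; this includes that, for every $f$ in the domain space, for almost every $x$ the integrals $A_tf(x)$, $t\in E$, all converge absolutely, and that $M_Ef$ is (Lebesgue) measurable. For $\delta>0$ let $N(E,\delta)$ be the minimal number of compact intervals of length $\delta$ needed to cover $E$. Put $$Q_1=(0,0),\quad Q_2(\beta)=\Big(\tfrac{d-1}{d-1+\beta},\tfrac{d-1}{d-1+\beta}\Big),\quad Q_3(\beta)=\Big(\tfrac{d-\beta}{d-\beta+1},\tfrac{1}{d-\beta+1}\Big),\quad Q_4(\gamma)=\Big(\tfrac{d(d-1)}{d^2+2\gamma-1},\tfrac{d-1}{d^2+2\gamma-1}\Big),$$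 and let $\mathcal{Q}(\beta,\gamma)$ be the closed convex hull of $Q_1,Q_2(\beta),Q_3(\beta),Q_4(\gamma)$. **Theorem.** Let $d\ge 3$ and $0\le\beta\le\gamma\le 1$, or $d=2$ and $0\le\beta\le\gamma<1/2$. Let $E\subset[1,2]$, and consider the conditions $$\text{(a)}\ \sup_{0<\delta<1}\delta^\beta N(E,\delta)<\infty,\qquad \text{(b)}\ \sup_{0<\delta<1}\ \sup_{\delta\le|I|\le 1}\Big(\frac{\delta}{|I|}\Big)^{\gamma}N(E\cap I,\delta)<\infty,$$ where in (b) the inner supremum is over all intervals $I$ of length $|I|\in[\delta,1]$. (i) Suppose (a). If $(\frac1p,\frac1q)$ is $Q_2(\beta)$ or $Q_3(\beta)$, then $M_E$ is of restricted weak type $(p,q)$. If in addition $\beta<1$, then $M_E$ is of strong type $(p,q)$ whenever $(\frac1p,\frac1q)$ belongs to the open line segment connecting $Q_2(\beta)$ and $Q_3(\beta)$. (ii) Suppose (b). If $(\frac1p,\frac1q)=Q_4(\gamma)$, then $M_E$ is of restricted weak type $(p,q)$. (iii) Suppose $\beta<1$ and both (a) and (b). Then $M_E$ is of strong type $(p,q)$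 for all $p,q\in[1,\infty]$ with $(\frac1p,\frac1q)\in\mathcal{Q}(\beta,\gamma)\setminus\{Q_2(\beta),Q_3(\beta),Q_4(\gamma)\}$. -/

import Mathlib

open MeasureTheory
open scoped NNReal ENNReal

noncomputable section

namespace SphericalMax

/-- The normalized surface measure on the unit sphere of `ℝ^d`. -/
def sphereMeasure (d : ℕ) : Measure (Metric.sphere (0 : EuclideanSpace ℝ (Fin d)) 1) :=
  ((volume : Measure (EuclideanSpace ℝ (Fin d))).toSphere Set.univ)⁻¹ •
    (volume : Measure (EuclideanSpace ℝ (Fin d))).toSphere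

/-- The spherical mean `A_t f(x) = ∫ f(x - t y) dσ(y)`. -/
def sphericalMean {d : ℕ} (t : ℝ) (f : EuclideanSpace ℝ (Fin d) → ℂ)
    (x : EuclideanSpace ℝ (Fin d)) : ℂ :=
  ∫ y, f (x - t • (y : EuclideanSpace ℝ (Fin d))) ∂(sphereMeasure d)

/-- The maximal function `M_E f(x) = sup_{t ∈ E} |A_t f(x)|`, with values in `[0, ∞]`. -/
def maximalFunction {d : ℕ} (E : Set ℝ) (f : EuclideanSpace ℝ (Fin d) → ℂ)
    (x : EuclideanSpace ℝ (Fin d)) : ℝ≥0∞ :=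
  ⨆ t ∈ E, ‖sphericalMean t f x‖ₑ

/-- `M_E f` is well defined as a measurable function: for almost every `x`, all the integrals
`A_t f(x)`, `t ∈ E`, converge absolutely, and `M_E f` is measurable up to a null set. -/
def MaximalWellDefined {d : ℕ} (E : Set ℝ) (f : EuclideanSpace ℝ (Fin d) → ℂ) : Prop :=
  (∀ᵐ x : EuclideanSpace ℝ (Fin d), ∀ t ∈ E,
    Integrable (fun y : Metric.sphere (0 : EuclideanSpace ℝ (Fin d)) 1 =>
      f (x - t • (y : EuclideanSpace ℝ (Fin d)))) (sphereMeasure d)) ∧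
  AEMeasurable (maximalFunction E f) volume

/-- The Lorentz quasi-norm of `L^{p,1}`, for `0 < p < ∞`, through the distribution function:
`p ∫_0^∞ |{|f| > s}|^{1/p} ds = ∫_0^∞ r^{1/p} f^*(r) dr / r`. -/
def lorentzOneNorm {d : ℕ} (p : ℝ) (f : EuclideanSpace ℝ (Fin d) → ℂ) : ℝ≥0∞ :=
  ENNReal.ofReal p *
    ∫⁻ s in Set.Ioi (0 : ℝ), (volume {x | s < ‖f x‖}) ^ (1 / p)

/-- The quasi-norm of `L^{q,∞}` (weak `L^q`), for `0 < q < ∞`: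
`sup_{s > 0} s |{g > s}|^{1/q}`. -/
def weakNorm {d : ℕ} (q : ℝ) (g : EuclideanSpace ℝ (Fin d) → ℝ≥0∞) : ℝ≥0∞ :=
  ⨆ s : ℝ≥0, (s : ℝ≥0∞) * (volume {x | (s : ℝ≥0∞) < g x}) ^ (1 / q)

/-- `M_E` is of strong type `(p, q)`: it is bounded from `L^p(ℝ^d)` to `L^q(ℝ^d)`. -/
def StrongType (d : ℕ) (E : Set ℝ) (p q : ℝ≥0∞) : Prop :=
  ∃ C : ℝ≥0, ∀ f : EuclideanSpace ℝ (Fin d) → ℂ, MemLp f p volume →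
    MaximalWellDefined E f ∧
    eLpNorm (maximalFunction E f) q volume ≤ C * eLpNorm f p volume

/-- `M_E` is of restricted weak type `(p, q)`, for `0 < p, q < ∞`: it is bounded from
`L^{p,1}(ℝ^d)` to `L^{q,∞}(ℝ^d)`. -/
def RestrictedWeakType (d : ℕ) (E : Set ℝ) (p q : ℝ) : Prop :=
  ∃ C : ℝ≥0, ∀ f : EuclideanSpace ℝ (Fin d) → ℂ,
    AEStronglyMeasurable f volume → lorentzOneNorm p f < ∞ →
    MaximalWellDefined E f ∧
    weakNorm q (maximalFunction E f) ≤ C * lorentzOneNorm p f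

/-- `N(E, δ)`: the minimal number of compact intervals of length `δ` needed to cover `E`
(used only for bounded `E` and `δ > 0`, when finite covers exist). -/
def coveringNumber (E : Set ℝ) (δ : ℝ) : ℕ :=
  sInf {n : ℕ | ∃ T : Finset ℝ, T.card = n ∧ E ⊆ ⋃ a ∈ T, Set.Icc a (a + δ)}

/-- `sup_{0 < δ < 1} δ^β N(E, δ) < ∞`. -/
def MinkowskiBound (E : Set ℝ) (β : ℝ) : Prop :=
  ∃ C : ℝ, ∀ δ ∈ Set.Ioo (0 : ℝ) 1, δ ^ β * (coveringNumber E δ : ℝ) ≤ C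

/-- `sup_{0 < δ < 1} sup_{δ ≤ |I| ≤ 1} (δ / |I|)^γ N(E ∩ I, δ) < ∞`. By monotonicity of `N` in
the set, it is the same to take all intervals `I` or, as here, the compact ones
`I = [a, a + ℓ]`. -/
def AssouadBound (E : Set ℝ) (γ : ℝ) : Prop :=
  ∃ C : ℝ, ∀ δ ∈ Set.Ioo (0 : ℝ) 1, ∀ ℓ ∈ Set.Icc δ 1, ∀ a : ℝ,
    (δ / ℓ) ^ γ * (coveringNumber (E ∩ Set.Icc a (a + ℓ)) δ : ℝ) ≤ C

def Q₁ : ℝ × ℝ := (0, 0)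

def Q₂ (d : ℕ) (β : ℝ) : ℝ × ℝ :=
  (((d : ℝ) - 1) / (d - 1 + β), ((d : ℝ) - 1) / (d - 1 + β))

def Q₃ (d : ℕ) (β : ℝ) : ℝ × ℝ :=
  (((d : ℝ) - β) / (d - β + 1), 1 / ((d : ℝ) - β + 1))

def Q₄ (d : ℕ) (γ : ℝ) : ℝ × ℝ :=
  ((d : ℝ) * (d - 1) / ((d : ℝ) ^ 2 + 2 * γ - 1), ((d : ℝ) - 1) / ((d : ℝ) ^ 2 + 2 * γ - 1))

/-- The closed convex hull of the four points (the convex hull of a finite set is closed). -/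
def Q (d : ℕ) (β γ : ℝ) : Set (ℝ × ℝ) :=
  convexHull ℝ {Q₁, Q₂ d β, Q₃ d β, Q₄ d γ}

end SphericalMax

end

noncomputable section

namespace SphericalMax

open Metric Set
open scoped Pointwise

/-! ### The sphere measure -/

/-! Cut `f` into Littlewood–Paley pieces, the `j`th with frequencies of size `2^j`. The means `A_t`
of this piece barely change while `t` stays in an interval ("cell") of length `2^(-j)`. At this
frequency `E` therefore acts like at most about `2^(βj)` radii under (a), and under (b) at most
about `2^(γm)` of them lie within distance `2^(m-j)` of each other. For `|f| ≤ 1`, with the maximal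
function integrated over a test set `G`, this gives four bounds for the `j`th piece: - `L¹ → L¹`
with constant `2^(βj)` (`pieceRestricted_one_zero`): one cell at a time, the kernel is an integrable
bump averaged over a sphere; - `L¹ → L^∞` with constant `2^j` (`pieceRestricted_one_one`): the size
of that kernel; - `L² → L²` with constant `2^(-j(d-1-β)/2)` (`pieceRestricted_half_half`):
Plancherel, the decay `|ξ|^(-(d-1)/2)` of the Fourier transform of `σ`, and the fundamental theorem
of calculus in `t`; - an `L²` improving bound into `L^q`, `q = 2(d-1+2γ)/(d-1)`, which decays in `j`
when `2γ < (d-1)²` (`pieceRestricted_of_assouadBound`).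

The decay of the Fourier transform comes from an energy estimate for its Bessel equation
(`exists_sphereCos_decay`). The fourth bound is a `TT*` argument: linearize the supremum by disjoint
sets `P t`, expand the square of the `L²` norm of the adjoint over pairs of cells, bound each pair
both by the one-cell `L²` estimate and by the pointwise kernel bound `2^j (1 + 2^j|s-t|)^(-(d-1)/2)`
(`exists_pairMultiplier_le`), and count the pairs at distance `2^m` by (b).

A bound that grows geometrically in `j` is then combined with one that decays. The sum over `j` of
the smaller of the two is at most a constant times their weighted geometric mean
(`exists_tsum_min_le`), so nothing is lost and a restricted estimate holds at the exact balancing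
exponent (Bourgain's interpolation, `PieceRestricted.schwartzRestricted`). The first and third
bounds meet at `Q₂`, the second and third at `Q₃`, the second and fourth at `Q₄`.

The estimates, proved for Schwartz functions and finitely many radii, pass to open sets and all of
`E` by monotone convergence and lower semicontinuity. General sets and functions are reached through
measurable majorants built from open supersets and dyadic level sets; summing over the levels gives
the bounds from `L^{p,1}` to `L^{q,∞}`. The same estimates show that errors of approximation by
continuous functions have small maximal function, whence absolute convergence and measurability.
Strong type bounds follow by a discrete real interpolation along segments of finite positive slope
on which `p ≤ q`; every remaining point of the quadrilateral other than the origin lies inside such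
a segment, and the origin is the trivial `L^∞` bound. -/

instance isProbabilityMeasure_sphereMeasure (d : ℕ) [NeZero d] :
    IsProbabilityMeasure (sphereMeasure d) := by
  refine ⟨?_⟩
  have h0 : (volume : Measure (EuclideanSpace ℝ (Fin d))).toSphere univ ≠ 0 := by
    rw [Ne, Measure.measure_univ_eq_zero]
    exact Measure.toSphere_ne_zero _
  rw [sphereMeasure, Measure.smul_apply, smul_eq_mul,
    ENNReal.inv_mul_cancel h0 (measure_ne_top _ _)]

/-- The action of a linear isometry on the unit sphere. -/
def sphereMap {d : ℕ} (L : EuclideanSpace ℝ (Fin d) ≃ₗᵢ[ℝ] EuclideanSpace ℝ (Fin d))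
    (y : sphere (0 : EuclideanSpace ℝ (Fin d)) 1) : sphere (0 : EuclideanSpace ℝ (Fin d)) 1 :=
  ⟨L y, by simp⟩

lemma measurePreserving_sphereMap {d : ℕ}
    (L : EuclideanSpace ℝ (Fin d) ≃ₗᵢ[ℝ] EuclideanSpace ℝ (Fin d)) :
    MeasurePreserving (sphereMap L) (sphereMeasure d) (sphereMeasure d) := by
  have hc : Continuous (sphereMap L) :=
    (L.continuous.comp continuous_subtype_val).subtype_mk _
  suffices h : MeasurePreserving (sphereMap L)
      ((volume : Measure (EuclideanSpace ℝ (Fin d))).toSphere)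
      ((volume : Measure (EuclideanSpace ℝ (Fin d))).toSphere) from h.smul_measure _
  refine ⟨hc.measurable, ?_⟩
  ext s hs
  rw [Measure.map_apply hc.measurable hs, Measure.toSphere_apply' _ hs,
    Measure.toSphere_apply' _ (hc.measurable hs)]
  congr 1
  -- The surface measure of `s` is a dimensional constant times the volume of the cone `(0,1) • s`,
  -- and a linear isometry carries cones to cones.
  have key : Ioo (0 : ℝ) 1 • (Subtype.val '' (sphereMap L ⁻¹' s) : Set (EuclideanSpace ℝ (Fin d)))
      = L ⁻¹' (Ioo (0 : ℝ) 1 • (Subtype.val '' s)) := by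
    ext x
    simp only [mem_smul, mem_image, mem_preimage]
    constructor
    · rintro ⟨r, hr, _, ⟨y, hy, rfl⟩, rfl⟩
      exact ⟨r, hr, _, ⟨_, hy, rfl⟩, by simp [sphereMap]⟩
    · rintro ⟨r, hr, _, ⟨y, hy, rfl⟩, h⟩
      refine ⟨r, hr, _, ⟨sphereMap L.symm y, ?_, rfl⟩, ?_⟩
      · have : sphereMap L (sphereMap L.symm y) = y := by ext1; simp [sphereMap]
        rwa [this]
      · apply L.injective
        simp [sphereMap, h]
  rw [key]
  exact (L.measurePreserving).measure_preimage_equiv (f := L.toMeasurableEquiv) _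

/-- Part of integration in polar coordinates: averages over spheres of radii in `[a, b]`
are dominated by the full integral. -/
lemma exists_lintegral_polar_le (d : ℕ) [NeZero d] {a : ℝ} (ha : 0 < a) (b : ℝ) :
    ∃ C : ℝ≥0, ∀ g : EuclideanSpace ℝ (Fin d) → ℝ≥0∞, Measurable g →
      ∫⁻ s in Icc a b, ∫⁻ y, g (s • (y : EuclideanSpace ℝ (Fin d))) ∂(sphereMeasure d)
        ≤ C * ∫⁻ x, g x := by
  set μ : Measure (EuclideanSpace ℝ (Fin d)) := volume
  set n := Module.finrank ℝ (EuclideanSpace ℝ (Fin d)) - 1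
  have h0 : μ.toSphere univ ≠ 0 := by
    rw [Ne, Measure.measure_univ_eq_zero]
    exact Measure.toSphere_ne_zero _
  -- The first factor normalizes the sphere measure; the second bounds the radial density `s^(d-1)`
  -- from below on `[a, b]`.
  refine ⟨((μ.toSphere univ)⁻¹ * (ENNReal.ofReal (a ^ n))⁻¹).toNNReal, fun g hg => ?_⟩
  have hpow : ENNReal.ofReal (a ^ n) ≠ 0 := by simpa using pow_pos ha n
  rw [ENNReal.coe_toNNReal (ENNReal.mul_ne_top (ENNReal.inv_ne_top.2 h0)
    (ENNReal.inv_ne_top.2 hpow))]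
  have h1 : ∫⁻ x, g x ∂μ = ∫⁻ s : Ioi (0 : ℝ), ENNReal.ofReal (s.1 ^ n) *
      ∫⁻ y, g (s.1 • (y : EuclideanSpace ℝ (Fin d))) ∂μ.toSphere ∂(Measure.comap Subtype.val volume) := by
    have hres : ∫⁻ x, g x ∂μ = ∫⁻ x in ({0}ᶜ : Set (EuclideanSpace ℝ (Fin d))), g x ∂μ := by
      rw [restrict_compl_singleton]
    rw [hres, ← lintegral_subtype_comap (measurableSet_singleton _).compl g]
    have hmp := μ.measurePreserving_homeomorphUnitSphereProd
    have := hmp.symm (homeomorphUnitSphereProd (EuclideanSpace ℝ (Fin d))).toMeasurableEquiv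
    rw [← this.lintegral_comp (f := fun x => g x.1) (hg.comp measurable_subtype_coe)]
    have hmeas : Measurable fun p : sphere (0 : EuclideanSpace ℝ (Fin d)) 1 × Ioi (0 : ℝ) =>
        g (p.2.1 • (p.1 : EuclideanSpace ℝ (Fin d))) := by
      apply hg.comp
      fun_prop
    rw [lintegral_prod_symm _ (by exact hmeas.aemeasurable)]
    rw [Measure.volumeIoiPow, lintegral_withDensity_eq_lintegral_mul _ (by fun_prop)]
    · rfl
    · exact Measurable.lintegral_prod_left' hmeas
  have h2 : ∫⁻ x, g x ∂μ = ∫⁻ s in Ioi (0 : ℝ), ENNReal.ofReal (s ^ n) *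
      ∫⁻ y, g (s • (y : EuclideanSpace ℝ (Fin d))) ∂μ.toSphere := by
    rw [h1, lintegral_subtype_comap measurableSet_Ioi (fun s : ℝ => ENNReal.ofReal (s ^ n) *
      ∫⁻ y, g (s • (y : EuclideanSpace ℝ (Fin d))) ∂μ.toSphere)]
  rw [h2]
  have hmono : ∫⁻ s in Icc a b, ENNReal.ofReal (a ^ n) *
      ∫⁻ y, g (s • (y : EuclideanSpace ℝ (Fin d))) ∂μ.toSphere ≤
      ∫⁻ s in Ioi (0 : ℝ), ENNReal.ofReal (s ^ n) *
      ∫⁻ y, g (s • (y : EuclideanSpace ℝ (Fin d))) ∂μ.toSphere := by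
    refine le_trans ?_ (lintegral_mono_set (s := Icc a b) fun s hs => lt_of_lt_of_le ha hs.1)
    refine setLIntegral_mono' measurableSet_Icc fun s hs => ?_
    gcongr
    exact hs.1
  refine le_trans ?_ (mul_le_mul_right hmono _)
  rw [lintegral_const_mul' _ _ ENNReal.ofReal_ne_top, mul_assoc, ← mul_assoc _ (ENNReal.ofReal _),
    ENNReal.inv_mul_cancel hpow ENNReal.ofReal_ne_top, one_mul,
    ← lintegral_const_mul' _ _ (ENNReal.inv_ne_top.2 h0)]
  refine le_of_eq ?_
  congr 1
  ext s
  rw [sphereMeasure, lintegral_smul_measure, smul_eq_mul]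

end SphericalMax

end

set_option linter.unusedSectionVars false

noncomputable section

namespace SphericalMax

open Metric Set

/-! ### Decay of the Fourier transform of the sphere measure -/

section Oscillatory

variable {d : ℕ} [NeZero d]

lemma integrable_sphereMeasure_of_continuous {F : Type*} [NormedAddCommGroup F]
    {p : sphere (0 : EuclideanSpace ℝ (Fin d)) 1 → F} (hp : Continuous p) :
    Integrable p (sphereMeasure d) :=
  hp.integrable_of_hasCompactSupport (HasCompactSupport.of_compactSpace p)

/-- The free phase `c` serves twice: a shift by `π/2` turns the cosine into a sine, and `c y = r * y
0` permits differentiation in a direction transverse to the first axis. -/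
lemma hasDerivAt_integral_cos {p b c : sphere (0 : EuclideanSpace ℝ (Fin d)) 1 → ℝ}
    (hp : Continuous p) (hb : Continuous b) (hc : Continuous c) (s : ℝ) :
    HasDerivAt (fun s => ∫ y, p y * Real.cos (c y + s * b y) ∂(sphereMeasure d))
      (-∫ y, p y * b y * Real.sin (c y + s * b y) ∂(sphereMeasure d)) s := by
  have hpb : Continuous fun y => p y * b y := hp.mul hb
  have h := hasDerivAt_integral_of_dominated_loc_of_deriv_le (μ := sphereMeasure d)
    (F := fun s y => p y * Real.cos (c y + s * b y))
    (F' := fun s y => - (p y * b y * Real.sin (c y + s * b y)))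
    (bound := fun y => |p y * b y|) (x₀ := s) (s := univ) Filter.univ_mem ?_ ?_ ?_ ?_ ?_ ?_
  · rw [← integral_neg]
    exact h.2
  · exact .of_forall fun x => (by fun_prop : Continuous _).aestronglyMeasurable
  · exact integrable_sphereMeasure_of_continuous (by fun_prop)
  · exact (by fun_prop : Continuous _).aestronglyMeasurable
  · refine .of_forall fun y x _ => ?_
    rw [norm_neg, norm_mul, Real.norm_eq_abs]
    exact mul_le_of_le_one_right (abs_nonneg _) (Real.abs_sin_le_one _)
  · exact integrable_sphereMeasure_of_continuous (by fun_prop)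
  · refine .of_forall fun y x _ => ?_
    have h1 : HasDerivAt (fun s => c y + s * b y) (b y) x := by
      simpa using ((hasDerivAt_id x).mul_const (b y)).const_add (c y)
    exact (h1.cos.const_mul (p y)).congr_deriv (by ring)

lemma hasDerivAt_integral_sin {p b c : sphere (0 : EuclideanSpace ℝ (Fin d)) 1 → ℝ}
    (hp : Continuous p) (hb : Continuous b) (hc : Continuous c) (s : ℝ) :
    HasDerivAt (fun s => ∫ y, p y * Real.sin (c y + s * b y) ∂(sphereMeasure d))
      (∫ y, p y * b y * Real.cos (c y + s * b y) ∂(sphereMeasure d)) s := by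
  have h := hasDerivAt_integral_cos hp hb (c := fun y => c y - Real.pi / 2)
    (hc.sub continuous_const) s
  convert h using 1
  · ext s
    congr 1; ext y
    rw [sub_add_eq_add_sub, Real.cos_sub_pi_div_two]
  · rw [← integral_neg]
    congr 1; ext y
    rw [sub_add_eq_add_sub, Real.sin_sub_pi_div_two]
    ring

end Oscillatory

variable (d : ℕ) [NeZero d]

/-- The profile `u` of the Fourier transform of the sphere measure,
`∫ cos ⟪ξ, y⟫ dσ(y) = u(‖ξ‖)`. -/
def sphereCos (r : ℝ) : ℝ :=
  ∫ y, Real.cos (r * (y : EuclideanSpace ℝ (Fin d)) 0) ∂(sphereMeasure d)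

/-- Minus the derivative of `sphereCos`. -/
def sphereSin (r : ℝ) : ℝ :=
  ∫ y, (y : EuclideanSpace ℝ (Fin d)) 0 * Real.sin (r * (y : EuclideanSpace ℝ (Fin d)) 0)
    ∂(sphereMeasure d)

/-- Minus the second derivative of `sphereCos`. -/
def sphereSqCos (r : ℝ) : ℝ :=
  ∫ y, (y : EuclideanSpace ℝ (Fin d)) 0 ^ 2 * Real.cos (r * (y : EuclideanSpace ℝ (Fin d)) 0)
    ∂(sphereMeasure d)

variable {d}

lemma continuous_sphere_coord (k : Fin d) :
    Continuous fun y : sphere (0 : EuclideanSpace ℝ (Fin d)) 1 =>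
      (y : EuclideanSpace ℝ (Fin d)) k := by fun_prop

lemma hasDerivAt_sphereCos (r : ℝ) : HasDerivAt (sphereCos d) (-sphereSin d r) r := by
  have h := hasDerivAt_integral_cos (d := d) (p := fun _ => 1) (c := fun _ => 0)
    continuous_const (continuous_sphere_coord 0) continuous_const r
  simp only [one_mul, zero_add] at h
  exact h

lemma hasDerivAt_sphereSin (r : ℝ) : HasDerivAt (sphereSin d) (sphereSqCos d r) r := by
  have h := hasDerivAt_integral_sin (d := d) (c := fun _ => 0)
    (continuous_sphere_coord 0) (continuous_sphere_coord 0) continuous_const r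
  simp only [zero_add, ← sq] at h
  exact h

lemma continuous_sphereCos : Continuous (sphereCos d) :=
  continuous_iff_continuousAt.2 fun r => (hasDerivAt_sphereCos r).continuousAt

lemma continuous_sphereSin : Continuous (sphereSin d) :=
  continuous_iff_continuousAt.2 fun r => (hasDerivAt_sphereSin r).continuousAt

lemma abs_sphereCoord_le_one (y : sphere (0 : EuclideanSpace ℝ (Fin d)) 1) (k : Fin d) :
    |(y : EuclideanSpace ℝ (Fin d)) k| ≤ 1 := by
  have := PiLp.norm_apply_le (y : EuclideanSpace ℝ (Fin d)) k
  simpa using this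

lemma abs_sphereCos_le_one (r : ℝ) : |sphereCos d r| ≤ 1 := by
  have := norm_integral_le_of_norm_le_const (μ := sphereMeasure d) (C := 1)
    (f := fun y => Real.cos (r * (y : EuclideanSpace ℝ (Fin d)) 0))
    (.of_forall fun y => Real.abs_cos_le_one _)
  simpa [sphereCos] using this

lemma abs_sphereSin_le_one (r : ℝ) : |sphereSin d r| ≤ 1 := by
  have := norm_integral_le_of_norm_le_const (μ := sphereMeasure d) (C := 1)
    (f := fun y => (y : EuclideanSpace ℝ (Fin d)) 0 *
      Real.sin (r * (y : EuclideanSpace ℝ (Fin d)) 0))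
    (.of_forall fun y => by
      rw [norm_mul]
      exact mul_le_one₀ (abs_sphereCoord_le_one y 0) (norm_nonneg _) (Real.abs_sin_le_one _))
  simpa [sphereSin] using this

/-- Vectors of the same norm are exchanged by a linear isometry. -/
lemma exists_isometry_apply_eq {v w : EuclideanSpace ℝ (Fin d)} (h : ‖v‖ = ‖w‖) :
    ∃ L : EuclideanSpace ℝ (Fin d) ≃ₗᵢ[ℝ] EuclideanSpace ℝ (Fin d), L v = w :=
  ⟨_, Submodule.reflection_sub h⟩

lemma integral_comp_sphereMap {F : Type*} [NormedAddCommGroup F] [NormedSpace ℝ F]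
    (L : EuclideanSpace ℝ (Fin d) ≃ₗᵢ[ℝ] EuclideanSpace ℝ (Fin d))
    {g : sphere (0 : EuclideanSpace ℝ (Fin d)) 1 → F} (hg : Continuous g) :
    ∫ y, g (sphereMap L y) ∂(sphereMeasure d) = ∫ y, g y ∂(sphereMeasure d) := by
  have hmp := measurePreserving_sphereMap L
  rw [← hmp.map_eq, integral_map hmp.measurable.aemeasurable hg.aestronglyMeasurable, hmp.map_eq]

lemma integral_cos_inner (ξ : EuclideanSpace ℝ (Fin d)) :
    ∫ y, Real.cos (inner ℝ ξ (y : EuclideanSpace ℝ (Fin d))) ∂(sphereMeasure d)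
      = sphereCos d ‖ξ‖ := by
  obtain ⟨L, hL⟩ := exists_isometry_apply_eq (d := d) (v := ‖ξ‖ • EuclideanSpace.single 0 1)
    (w := ξ) (by simp [norm_smul])
  rw [← integral_comp_sphereMap L (by fun_prop), sphereCos]
  congr 1; ext y
  simp only [sphereMap]
  rw [← hL, L.inner_map_map, inner_smul_left, EuclideanSpace.inner_single_left]
  simp [norm_smul]

/-- By rotation invariance, `∫ cos (r y₀ + s y_k) dσ` is the profile at `√(r² + s²)`. Two
derivatives in `s` at `s = 0` bring down `y_k²` on one side and are computed by the chain rule on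
the other. -/
lemma integral_sq_coord_mul_cos {k : Fin d} (hk : k ≠ 0) {r : ℝ} (hr : 0 < r) :
    ∫ y, (y : EuclideanSpace ℝ (Fin d)) k ^ 2 *
      Real.cos (r * (y : EuclideanSpace ℝ (Fin d)) 0) ∂(sphereMeasure d) = sphereSin d r / r := by
  have hpos : ∀ s : ℝ, 0 < r ^ 2 + s ^ 2 := fun s => by positivity
  have hρ : ∀ s : ℝ, HasDerivAt (fun s => √(r ^ 2 + s ^ 2)) (s / √(r ^ 2 + s ^ 2)) s := fun s => by
    have h1 : HasDerivAt (fun s : ℝ => r ^ 2 + s ^ 2) (2 * s) s := by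
      simpa using (hasDerivAt_pow 2 s).const_add (r ^ 2)
    convert h1.sqrt (hpos s).ne' using 1
    ring
  have hW : ∀ s : ℝ, ∫ y, 1 * Real.cos (r * (y : EuclideanSpace ℝ (Fin d)) 0 +
      s * (y : EuclideanSpace ℝ (Fin d)) k) ∂(sphereMeasure d)
      = sphereCos d (√(r ^ 2 + s ^ 2)) := fun s => by
    have hn : ‖(r • EuclideanSpace.single 0 1 + s • EuclideanSpace.single k 1 :
        EuclideanSpace ℝ (Fin d))‖ = √(r ^ 2 + s ^ 2) := by
      rw [← Real.sqrt_sq (norm_nonneg _), @norm_add_sq_real]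
      congr 1
      rw [norm_smul, norm_smul, inner_smul_left, inner_smul_right, EuclideanSpace.inner_single_left]
      simp [hk.symm]
    rw [← hn, ← integral_cos_inner]
    congr 1; ext y
    rw [inner_add_left, inner_smul_left, inner_smul_left, EuclideanSpace.inner_single_left,
      EuclideanSpace.inner_single_left]
    simp
  have hV : ∀ s : ℝ, ∫ y, (y : EuclideanSpace ℝ (Fin d)) k *
      Real.sin (r * (y : EuclideanSpace ℝ (Fin d)) 0 + s * (y : EuclideanSpace ℝ (Fin d)) k)
        ∂(sphereMeasure d) = s * (sphereSin d (√(r ^ 2 + s ^ 2)) / √(r ^ 2 + s ^ 2)) := fun s => by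
    have h1 := hasDerivAt_integral_cos (d := d) (p := fun _ => 1)
      (c := fun y => r * (y : EuclideanSpace ℝ (Fin d)) 0)
      continuous_const (continuous_sphere_coord k) (by fun_prop) s
    simp only [hW] at h1
    have h2 := (hasDerivAt_sphereCos (d := d) (√(r ^ 2 + s ^ 2))).comp s (hρ s)
    have h3 := h1.unique h2
    simp only [one_mul] at h3
    rw [← neg_inj, h3]
    ring
  have h1 := hasDerivAt_integral_sin (d := d)
    (c := fun y => r * (y : EuclideanSpace ℝ (Fin d)) 0)
    (continuous_sphere_coord k) (continuous_sphere_coord k) (by fun_prop) 0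
  -- The derivative at `s = 0` of the same function is now known in two ways: under the integral
  -- sign, and from the closed form `s * (S ρ / ρ)` with `ρ = √(r² + s²)`, where only the derivative
  -- of the factor `s` survives.
  simp only [hV] at h1
  have h2 := (hasDerivAt_id (0 : ℝ)).mul
    (((hasDerivAt_sphereSin (d := d) (√(r ^ 2 + 0 ^ 2))).comp (0 : ℝ) (hρ 0)).div (hρ 0)
      (Real.sqrt_ne_zero'.2 (hpos 0)))
  have h3 := h1.unique h2
  simp only [zero_mul, add_zero, id, one_mul, Function.comp, Pi.div_apply] at h3
  have hsq : √(r ^ 2 + 0 ^ 2) = r := by simp [Real.sqrt_sq hr.le]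
  rw [hsq] at h3
  rw [← h3]
  congr 1; ext y
  ring

/-- The Bessel equation for the profile of the Fourier transform of the sphere measure. -/
lemma sphereCos_ode {r : ℝ} (hr : 0 < r) :
    sphereSqCos d r = sphereCos d r - (d - 1) * sphereSin d r / r := by
  -- The squared coordinates sum to one on the sphere. The term `k = 0` is `sphereSqCos`, and the
  -- other `d - 1` terms are all equal to `sphereSin d r / r`.
  have hsum : ∑ k : Fin d, ∫ y, (y : EuclideanSpace ℝ (Fin d)) k ^ 2 *
      Real.cos (r * (y : EuclideanSpace ℝ (Fin d)) 0) ∂(sphereMeasure d) = sphereCos d r := by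
    rw [← integral_finsetSum _ fun k _ => integrable_sphereMeasure_of_continuous (by fun_prop),
      sphereCos]
    congr 1; ext y
    rw [← Finset.sum_mul, ← EuclideanSpace.real_norm_sq_eq]
    simp
  rw [Fintype.sum_eq_add_sum_compl 0, Finset.sum_congr (g := fun _ => sphereSin d r / r) rfl
    fun k hk => integral_sq_coord_mul_cos (by simpa using hk) hr, Finset.sum_const, Finset.card_compl,
    Finset.card_singleton, Fintype.card_fin, nsmul_eq_mul,
    Nat.cast_sub (NeZero.one_le), Nat.cast_one] at hsum
  change sphereSqCos d r + _ = _ at hsum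
  rw [← hsum]
  ring

/-- With `a = (d-1)/2`, the function `w = r^a u` satisfies `w'' + (1 - c/r²) w = 0`, `c = a(a-1)`, a
perturbation of the harmonic oscillator. Its energy `En = w² + w'² = r^(d-1) (u² + v²)` obeys `|En'|
≤ |c| En / r²`. Since `1/r²` is integrable at infinity, the energy stays bounded; no stationary
phase is needed. -/
lemma exists_sphereCos_decay (d : ℕ) [NeZero d] :
    ∃ C : ℝ, 1 ≤ C ∧ ∀ r : ℝ, 0 ≤ r →
      (1 + r) ^ (d - 1) * sphereCos d r ^ 2 ≤ C ∧ (1 + r) ^ (d - 1) * sphereSin d r ^ 2 ≤ C := by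
  obtain ⟨n, hn⟩ : ∃ n : ℕ, d = n + 1 := ⟨d - 1, (Nat.succ_pred (NeZero.ne d)).symm⟩
  have hn' : d - 1 = n := by omega
  have hdn : (d : ℝ) - 1 = n := by rw [hn]; push_cast; ring
  rw [hn']
  set a : ℝ := n / 2 with ha
  have ha0 : 0 ≤ a := by positivity
  set c : ℝ := a * (a - 1) with hc
  set u := sphereCos d
  set S := sphereSin d
  set v : ℝ → ℝ := fun r => -S r + a * u r / r with hv
  set En : ℝ → ℝ := fun r => r ^ n * (u r ^ 2 + v r ^ 2) with hEn
  set Φ : ℝ → ℝ := fun r => En r * Real.exp (|c| / r) with hΦ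
  have hv' : ∀ r : ℝ, 0 < r →
      HasDerivAt v (-(u r - n * S r / r) + (a * (-S r) * r - a * u r * 1) / r ^ 2) r :=
    fun r hr => by
      have h1 := (hasDerivAt_sphereSin (d := d) r).neg
      rw [sphereCos_ode hr, hdn] at h1
      exact h1.add (((hasDerivAt_sphereCos (d := d) r).const_mul a).div (hasDerivAt_id r) hr.ne')
  have hEn' : ∀ r : ℝ, 0 < r → HasDerivAt En (r ^ n * (2 * (c / r ^ 2) * (u r * v r))) r :=
    fun r hr => by
      have h1 := (hasDerivAt_pow n r).mul
        (((hasDerivAt_sphereCos (d := d) r).pow 2).add ((hv' r hr).pow 2))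
      refine h1.congr_deriv ?_
      have hpow : (n : ℝ) * r ^ (n - 1) = n * r ^ n / r := by
        rcases Nat.eq_zero_or_pos n with h | h
        · simp [h]
        · rw [eq_div_iff hr.ne', mul_assoc, ← pow_succ, Nat.sub_add_cancel h]
      simp only [hpow, Pi.add_apply, Pi.pow_apply]
      have hna : (n : ℝ) = 2 * a := by rw [ha]; ring
      simp only [hv, hc, hna]
      change _ * (u r ^ 2 + _) + _ * (_ * u r ^ (2 - 1) * -S r + _) = _
      have h21 : 2 - 1 = 1 := rfl
      simp only [h21, pow_one, Nat.cast_ofNat, mul_one]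
      field_simp
      ring
  have hΦ' : ∀ r : ℝ, 0 < r → HasDerivAt Φ (r ^ n * (2 * (c / r ^ 2) * (u r * v r)) *
      Real.exp (|c| / r) + En r * (Real.exp (|c| / r) * (-|c| / r ^ 2))) r := fun r hr => by
    refine (hEn' r hr).mul ?_
    have h1 : HasDerivAt (fun r : ℝ => |c| / r) (-|c| / r ^ 2) r := by
      exact ((hasDerivAt_const r |c|).div (hasDerivAt_id r) hr.ne').congr_deriv (by simp)
    exact h1.exp
  -- The integrating factor `exp (|c|/r)` absorbs the error term: its logarithmic derivative is
  -- exactly `-|c|/r²`. It is at least one, so `Φ 1` bounds the energy from `r = 1` on.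
  have hanti : AntitoneOn Φ (Ici 1) := by
    refine antitoneOn_of_deriv_nonpos (convex_Ici 1) ?_ ?_ ?_
    · exact fun r hr => (hΦ' r (by linarith [mem_Ici.1 hr])).continuousAt.continuousWithinAt
    · intro r hr
      rw [interior_Ici, mem_Ioi] at hr
      exact (hΦ' r (by linarith)).differentiableAt.differentiableWithinAt
    · intro r hr
      rw [interior_Ici, mem_Ioi] at hr
      have hr0 : 0 < r := by linarith
      rw [(hΦ' r hr0).deriv]
      have key : 2 * c * (u r * v r) ≤ |c| * (u r ^ 2 + v r ^ 2) := by
        have h1 : c * (2 * (u r * v r)) ≤ |c| * |2 * (u r * v r)| := by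
          rw [← abs_mul]; exact le_abs_self _
        have h2 : |2 * (u r * v r)| ≤ u r ^ 2 + v r ^ 2 := by
          rw [abs_le]; constructor <;> nlinarith [sq_nonneg (u r - v r), sq_nonneg (u r + v r)]
        nlinarith [abs_nonneg c]
      have : r ^ n * (2 * (c / r ^ 2) * (u r * v r)) * Real.exp (|c| / r) +
          En r * (Real.exp (|c| / r) * (-|c| / r ^ 2)) =
          r ^ n * Real.exp (|c| / r) / r ^ 2 *
            (2 * c * (u r * v r) - |c| * (u r ^ 2 + v r ^ 2)) := by
        simp only [hEn]; field_simp; ring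
      rw [this]
      exact mul_nonpos_of_nonneg_of_nonpos (by positivity) (by linarith)
  set K : ℝ := Φ 1 with hK
  have hK0 : 0 ≤ K := by simp only [hK, hΦ, hEn]; positivity
  have hbound : ∀ r : ℝ, 1 ≤ r → r ^ n * (u r ^ 2 + v r ^ 2) ≤ K := fun r hr => by
    have h1 : Φ r ≤ K := hanti (mem_Ici.2 le_rfl) (mem_Ici.2 hr) hr
    have h2 : 1 ≤ Real.exp (|c| / r) := Real.one_le_exp (by positivity)
    have h3 : 0 ≤ En r := by simp only [hEn]; positivity
    calc En r ≤ En r * Real.exp (|c| / r) := le_mul_of_one_le_right h3 h2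
      _ ≤ K := h1
  -- The summand `1` covers `r ≤ 1`, where both functions are at most one in absolute value. The
  -- rest covers `r ≥ 1`, through `1 + r ≤ 2r` and `S = a u / r - v`.
  refine ⟨2 ^ n * (1 + 2 * (1 + a ^ 2) * K), ?_, fun r hr => ?_⟩
  · have : (1 : ℝ) ≤ 2 ^ n := one_le_pow₀ (by norm_num)
    nlinarith [mul_nonneg (by positivity : (0 : ℝ) ≤ 2 * (1 + a ^ 2)) hK0]
  · have h2n : (0 : ℝ) < 2 ^ n := by positivity
    have haK : 0 ≤ a ^ 2 * K := by positivity
    rcases le_total r 1 with h1 | h1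
    · have hp : (1 + r) ^ n ≤ 2 ^ n := by gcongr; linarith
      have hu : u r ^ 2 ≤ 1 := by rw [sq_le_one_iff_abs_le_one]; exact abs_sphereCos_le_one r
      have hS : S r ^ 2 ≤ 1 := by rw [sq_le_one_iff_abs_le_one]; exact abs_sphereSin_le_one r
      constructor
      · calc (1 + r) ^ n * u r ^ 2 ≤ 2 ^ n * 1 := by gcongr
          _ ≤ _ := by gcongr; nlinarith
      · calc (1 + r) ^ n * S r ^ 2 ≤ 2 ^ n * 1 := by gcongr
          _ ≤ _ := by gcongr; nlinarith
    · have hp : (1 + r) ^ n ≤ 2 ^ n * r ^ n := by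
        rw [← mul_pow]; gcongr; linarith
      have hb := hbound r h1
      have hrn : 0 < r ^ n := by positivity
      have hu : r ^ n * u r ^ 2 ≤ K := by nlinarith [mul_nonneg hrn.le (sq_nonneg (v r))]
      have hS : S r ^ 2 ≤ 2 * (v r ^ 2 + a ^ 2 * u r ^ 2) := by
        have h3 : S r = a * u r / r - v r := by simp only [hv]; ring
        have h4 : (a * u r / r) ^ 2 ≤ a ^ 2 * u r ^ 2 := by
          rw [div_pow, mul_pow]
          exact div_le_self (by positivity) (one_le_pow₀ h1)
        rw [h3]
        nlinarith [sq_nonneg (a * u r / r + v r)]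
      constructor
      · calc (1 + r) ^ n * u r ^ 2 ≤ 2 ^ n * r ^ n * u r ^ 2 := by gcongr
          _ = 2 ^ n * (r ^ n * u r ^ 2) := by ring
          _ ≤ _ := by gcongr; nlinarith
      · calc (1 + r) ^ n * S r ^ 2 ≤ 2 ^ n * r ^ n * (2 * (v r ^ 2 + a ^ 2 * u r ^ 2)) := by gcongr
          _ = 2 ^ n * (2 * (r ^ n * v r ^ 2) + 2 * a ^ 2 * (r ^ n * u r ^ 2)) := by ring
          _ ≤ _ := by
            refine mul_le_mul_of_nonneg_left ?_ h2n.le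
            have : r ^ n * v r ^ 2 ≤ K := by nlinarith [mul_nonneg hrn.le (sq_nonneg (u r))]
            have := mul_le_mul_of_nonneg_left hu (by positivity : 0 ≤ 2 * a ^ 2)
            nlinarith

end SphericalMax

end

set_option linter.unusedSectionVars false

noncomputable section

namespace SphericalMax

open Metric Set
open scoped FourierTransform SchwartzMap

/-! ### Spherical means as Fourier multipliers -/

section Plancherel

variable {V : Type*} [NormedAddCommGroup V] [InnerProductSpace ℝ V] [FiniteDimensional ℝ V]
  [MeasurableSpace V] [BorelSpace V]

/-- Plancherel holds for the abstract Fourier transform on `L²`. For integrable `h` the Fourier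
integral agrees with it almost everywhere, since both pair with a test function `φ` to give the
integral of `h` against the Fourier transform of `φ`. -/
lemma eLpNorm_fourier_eq {h : V → ℂ} (h1 : Integrable h) (h2 : MemLp h 2) :
    eLpNorm (𝓕 h) 2 volume = eLpNorm h 2 volume := by
  set H : Lp ℂ 2 (volume : Measure V) := h2.toLp h
  set K : Lp ℂ 2 (volume : Measure V) := 𝓕 H
  have hcont : Continuous (𝓕 h) :=
    VectorFourier.fourierIntegral_continuous Real.continuous_fourierChar
      (innerSL ℝ).continuous₂ h1
  have hae : ∀ᵐ x, (𝓕 h) x = K x := by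
    refine ae_eq_of_integral_contDiff_smul_eq hcont.locallyIntegrable
      ((Lp.memLp K).locallyIntegrable (by norm_num)) fun g hg hgs => ?_
    have hg' : HasCompactSupport (fun x => (g x : ℂ)) := hgs.comp_left Complex.ofReal_zero
    set φ : 𝓢(V, ℂ) := hg'.toSchwartzMap (Complex.ofRealCLM.contDiff.comp hg)
    have hφ : ∀ x, φ x = (g x : ℂ) := fun x => rfl
    have e1 : ∫ x, (𝓕 (φ : V → ℂ)) x • h x = ∫ x, φ x • (𝓕 h) x := by
      simpa using! (VectorFourier.integral_fourierIntegral_smul_eq_flip (L := innerₗ V)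
        (μ := volume) (ν := volume) Real.continuous_fourierChar continuous_inner φ.integrable h1)
    have e2 := DFunLike.congr_fun (Lp.fourier_toTemperedDistribution_eq H) φ
    rw [Lp.toTemperedDistribution_apply, TemperedDistribution.fourier_apply,
      Lp.toTemperedDistribution_apply] at e2
    calc ∫ x, g x • (𝓕 h) x = ∫ x, φ x • (𝓕 h) x := by
          simp only [hφ]; rfl
      _ = ∫ x, (𝓕 (φ : V → ℂ)) x • h x := e1.symm
      _ = ∫ x, (𝓕 φ : 𝓢(V, ℂ)) x • H x := by
          refine integral_congr_ae ?_
          filter_upwards [h2.coeFn_toLp] with x hx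
          rw [hx]; rfl
      _ = ∫ x, φ x • K x := e2
      _ = ∫ x, g x • K x := by
          simp only [hφ]; rfl
  rw [eLpNorm_congr_ae hae, ← eLpNorm_congr_ae h2.coeFn_toLp]
  have := Lp.norm_fourier_eq H
  rw [Lp.norm_def, Lp.norm_def] at this
  exact (ENNReal.toReal_eq_toReal_iff' (Lp.eLpNorm_ne_top _) (Lp.eLpNorm_ne_top _)).1 this

lemma lintegral_enorm_sq_fourierInv {h : V → ℂ} (h1 : Integrable h) (h2 : MemLp h 2) :
    ∫⁻ x, ‖(𝓕⁻ h) x‖ₑ ^ 2 = ∫⁻ x, ‖h x‖ₑ ^ 2 := by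
  have hp := eLpNorm_fourier_eq h1 h2
  simp only [eLpNorm_eq_lintegral_rpow_enorm_toReal (p := 2) (by norm_num) (by norm_num)] at hp
  have := ENNReal.rpow_left_injective (x := 1 / (2 : ℝ≥0∞).toReal) (by norm_num) hp
  simp only [ENNReal.toReal_ofNat, ENNReal.rpow_ofNat] at this
  rw [← this]
  have hneg := (Measure.measurePreserving_neg (volume : Measure V)).lintegral_comp_emb
    (MeasurableEquiv.neg V).measurableEmbedding (fun x => ‖(𝓕 h) x‖ₑ ^ 2)
  rw [← hneg]
  simp only [Real.fourierInv_eq_fourier_neg]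

lemma continuous_fourierInv {h : V → ℂ} (h1 : Integrable h) : Continuous (𝓕⁻ h) := by
  have hcont : Continuous (𝓕 h) :=
    VectorFourier.fourierIntegral_continuous Real.continuous_fourierChar
      (innerSL ℝ).continuous₂ h1
  have : 𝓕⁻ h = fun x => 𝓕 h (-x) := funext fun x => Real.fourierInv_eq_fourier_neg h x
  rw [this]
  exact hcont.comp continuous_neg

end Plancherel

variable {d : ℕ} [NeZero d]

lemma integral_cexp_inner (ξ : EuclideanSpace ℝ (Fin d)) :
    ∫ y, Complex.exp ((inner ℝ ξ (y : EuclideanSpace ℝ (Fin d)) : ℝ) * Complex.I)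
      ∂(sphereMeasure d) = sphereCos d ‖ξ‖ := by
  have hs : ∫ y, Real.sin (inner ℝ ξ (y : EuclideanSpace ℝ (Fin d))) ∂(sphereMeasure d) = 0 := by
    have h := integral_comp_sphereMap (d := d) (LinearIsometryEquiv.neg ℝ)
      (g := fun y => Real.sin (inner ℝ ξ (y : EuclideanSpace ℝ (Fin d)))) (by fun_prop)
    simp only [sphereMap, LinearIsometryEquiv.coe_neg, inner_neg_right, Real.sin_neg,
      integral_neg] at h
    linarith
  simp only [Complex.exp_mul_I, ← Complex.ofReal_cos, ← Complex.ofReal_sin]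
  rw [integral_add, integral_mul_const, integral_complex_ofReal, integral_complex_ofReal, hs,
    integral_cos_inner]
  · simp
  · exact integrable_sphereMeasure_of_continuous (by fun_prop)
  · exact integrable_sphereMeasure_of_continuous (by fun_prop)

lemma integrable_mul_sphereCos {m : EuclideanSpace ℝ (Fin d) → ℂ} (hm : Integrable m) (t : ℝ) :
    Integrable fun ξ => m ξ * (sphereCos d (2 * Real.pi * t * ‖ξ‖) : ℂ) := by
  refine hm.mul_bdd (c := 1) ?_ (.of_forall fun ξ => ?_)
  · have := continuous_sphereCos (d := d)
    exact Continuous.aestronglyMeasurable (by fun_prop)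
  · rw [Complex.norm_real]
    exact abs_sphereCos_le_one _

/-- Fubini: averaging the character `exp (2πi⟨ξ, x - t y⟩)` over the sphere multiplies it by the
Fourier transform of `σ`, which is real and radial. -/
lemma sphericalMean_fourierInv {m : EuclideanSpace ℝ (Fin d) → ℂ} (hm : Integrable m) {t : ℝ}
    (ht : 0 ≤ t) (x : EuclideanSpace ℝ (Fin d)) :
    sphericalMean t (𝓕⁻ m) x
      = 𝓕⁻ (fun ξ => m ξ * (sphereCos d (2 * Real.pi * t * ‖ξ‖) : ℂ)) x := by
  simp only [sphericalMean, Real.fourierInv_eq']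
  rw [integral_integral_swap]
  · congr 1; ext ξ
    have h1 : ∀ y : sphere (0 : EuclideanSpace ℝ (Fin d)) 1,
        Complex.exp (↑(2 * Real.pi * inner ℝ ξ (x - t • (y : EuclideanSpace ℝ (Fin d)))) *
          Complex.I) • m ξ = (Complex.exp (↑(2 * Real.pi * inner ℝ ξ x) * Complex.I) * m ξ) *
        Complex.exp ((inner ℝ ((-(2 * Real.pi * t)) • ξ) (y : EuclideanSpace ℝ (Fin d)) : ℝ) *
          Complex.I) := fun y => by
      rw [smul_eq_mul, mul_right_comm (Complex.exp _) (m ξ), ← Complex.exp_add, inner_sub_right, inner_smul_right,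
        inner_smul_left]
      congr 2
      simp only [map_neg, map_mul, conj_trivial]
      push_cast
      ring
    simp only [h1]
    rw [integral_const_mul, integral_cexp_inner, norm_smul, norm_neg, Real.norm_eq_abs,
      abs_of_nonneg (by positivity : 0 ≤ 2 * Real.pi * t), smul_eq_mul]
    ring
  · have h2 : Integrable (fun p : sphere (0 : EuclideanSpace ℝ (Fin d)) 1 ×
        EuclideanSpace ℝ (Fin d) => m p.2) ((sphereMeasure d).prod volume) := hm.comp_snd _
    have hexp : Continuous fun p : sphere (0 : EuclideanSpace ℝ (Fin d)) 1 ×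
        EuclideanSpace ℝ (Fin d) => Complex.exp (↑(2 * Real.pi * inner ℝ p.2
          (x - t • (p.1 : EuclideanSpace ℝ (Fin d)))) * Complex.I) := by fun_prop
    refine h2.mono (hexp.aestronglyMeasurable.smul h2.aestronglyMeasurable) (.of_forall fun p => ?_)
    simp only [Function.uncurry]
    rw [norm_smul, Complex.norm_exp_ofReal_mul_I, one_mul]

lemma hasDerivAt_fourierInv_mul_sphereCos {m : EuclideanSpace ℝ (Fin d) → ℂ} (hm : Integrable m)
    (hm' : Integrable fun ξ => (2 * Real.pi * ‖ξ‖ : ℝ) * m ξ) (x : EuclideanSpace ℝ (Fin d))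
    (t : ℝ) :
    HasDerivAt (fun t => 𝓕⁻ (fun ξ => m ξ * (sphereCos d (2 * Real.pi * t * ‖ξ‖) : ℂ)) x)
      (𝓕⁻ (fun ξ => (2 * Real.pi * ‖ξ‖ : ℝ) * m ξ *
        ((-sphereSin d (2 * Real.pi * t * ‖ξ‖) : ℝ) : ℂ)) x) t := by
  simp only [Real.fourierInv_eq']
  have hc := continuous_sphereCos (d := d)
  have hs := continuous_sphereSin (d := d)
  have hexp : Continuous fun ξ : EuclideanSpace ℝ (Fin d) =>
    Complex.exp (↑(2 * Real.pi * inner ℝ ξ x) * Complex.I) := by fun_prop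
  refine (hasDerivAt_integral_of_dominated_loc_of_deriv_le (μ := volume) (s := univ)
    (F := fun t ξ => Complex.exp (↑(2 * Real.pi * inner ℝ ξ x) * Complex.I) •
      (m ξ * (sphereCos d (2 * Real.pi * t * ‖ξ‖) : ℂ)))
    (F' := fun t ξ => Complex.exp (↑(2 * Real.pi * inner ℝ ξ x) * Complex.I) •
      ((2 * Real.pi * ‖ξ‖ : ℝ) * m ξ * ((-sphereSin d (2 * Real.pi * t * ‖ξ‖) : ℝ) : ℂ)))
    (bound := fun ξ => ‖(2 * Real.pi * ‖ξ‖ : ℝ) * m ξ‖)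
    Filter.univ_mem ?_ ?_ ?_ ?_ ?_ ?_).2
  · exact .of_forall fun s => hexp.aestronglyMeasurable.smul
      (integrable_mul_sphereCos hm s).aestronglyMeasurable
  · refine (integrable_mul_sphereCos hm t).bdd_mul (c := 1) hexp.aestronglyMeasurable ?_
    exact .of_forall fun ξ => (Complex.norm_exp_ofReal_mul_I _).le
  · refine hexp.aestronglyMeasurable.smul (hm'.aestronglyMeasurable.mul ?_)
    exact Continuous.aestronglyMeasurable (by fun_prop)
  · refine .of_forall fun ξ s _ => ?_
    rw [norm_smul, Complex.norm_exp_ofReal_mul_I, one_mul, norm_mul]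
    refine mul_le_of_le_one_right (norm_nonneg _) ?_
    rw [Complex.norm_real, norm_neg]
    exact abs_sphereSin_le_one _
  · exact hm'.norm
  · refine .of_forall fun ξ s _ => ?_
    have h1 : HasDerivAt (fun s : ℝ => 2 * Real.pi * s * ‖ξ‖) (2 * Real.pi * ‖ξ‖) s := by
      have := ((hasDerivAt_id s).const_mul (2 * Real.pi)).mul_const ‖ξ‖
      simpa using! this
    have h2 := ((hasDerivAt_sphereCos (d := d) _).comp s h1).ofReal_comp
    refine ((h2.const_mul (m ξ)).const_smul
      (Complex.exp (↑(2 * Real.pi * inner ℝ ξ x) * Complex.I))).congr_deriv ?_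
    congr 1
    push_cast
    ring

end SphericalMax

end

set_option linter.unusedSectionVars false

noncomputable section

namespace SphericalMax

open Metric Set
open scoped FourierTransform SchwartzMap ContDiff

/-! ### Littlewood–Paley pieces -/

section Cutoff

variable {d : ℕ}

/-- A smooth radial cutoff, equal to `1` on the unit ball and to `0` outside the ball of
radius `2`. -/
def cutoff (ξ : EuclideanSpace ℝ (Fin d)) : ℝ := Real.smoothTransition (2 - ‖ξ‖ ^ 2)

lemma contDiff_cutoff : ContDiff ℝ ∞ (cutoff (d := d)) :=
  Real.smoothTransition.contDiff.comp (contDiff_const.sub (contDiff_norm_sq ℝ))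

lemma cutoff_nonneg (ξ : EuclideanSpace ℝ (Fin d)) : 0 ≤ cutoff ξ :=
  Real.smoothTransition.nonneg _

lemma cutoff_le_one (ξ : EuclideanSpace ℝ (Fin d)) : cutoff ξ ≤ 1 :=
  Real.smoothTransition.le_one _

lemma cutoff_eq_one {ξ : EuclideanSpace ℝ (Fin d)} (h : ‖ξ‖ ≤ 1) : cutoff ξ = 1 :=
  Real.smoothTransition.one_of_one_le (by nlinarith [norm_nonneg ξ])

lemma cutoff_eq_zero {ξ : EuclideanSpace ℝ (Fin d)} (h : 2 ≤ ‖ξ‖) : cutoff ξ = 0 :=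
  Real.smoothTransition.zero_of_nonpos (by nlinarith [norm_nonneg ξ])

/-- The profile of the `j`th frequency band. -/
def bandProfile (j : ℕ) (ξ : EuclideanSpace ℝ (Fin d)) : ℝ :=
  if j = 0 then cutoff ξ else cutoff ξ - cutoff ((2 : ℝ) • ξ)

/-- The cutoff to frequencies of size about `2 ^ j`. -/
def band (j : ℕ) (ξ : EuclideanSpace ℝ (Fin d)) : ℝ := bandProfile j (((2 : ℝ) ^ j)⁻¹ • ξ)

lemma contDiff_bandProfile (j : ℕ) : ContDiff ℝ ∞ (bandProfile (d := d) j) := by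
  unfold bandProfile
  split_ifs
  · exact contDiff_cutoff
  · exact contDiff_cutoff.sub (contDiff_cutoff.comp (contDiff_const_smul _))

lemma continuous_band (j : ℕ) : Continuous (band (d := d) j) :=
  (contDiff_bandProfile j).continuous.comp (continuous_const_smul _)

lemma bandProfile_eq_zero {j : ℕ} {ξ : EuclideanSpace ℝ (Fin d)} (h : 2 ≤ ‖ξ‖) :
    bandProfile j ξ = 0 := by
  have h2 : 2 ≤ ‖(2 : ℝ) • ξ‖ := by rw [norm_smul]; norm_num; linarith
  simp [bandProfile, cutoff_eq_zero h, cutoff_eq_zero h2]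

lemma hasCompactSupport_bandProfile (j : ℕ) : HasCompactSupport (bandProfile (d := d) j) := by
  refine HasCompactSupport.of_support_subset_isCompact (isCompact_closedBall 0 2) fun ξ hξ => ?_
  rw [mem_closedBall_zero_iff]
  by_contra h
  exact hξ (bandProfile_eq_zero (by linarith))

lemma abs_band_le_one (j : ℕ) (ξ : EuclideanSpace ℝ (Fin d)) : |band j ξ| ≤ 1 := by
  unfold band bandProfile
  have h1 := cutoff_nonneg (((2 : ℝ) ^ j)⁻¹ • ξ)
  have h2 := cutoff_le_one (((2 : ℝ) ^ j)⁻¹ • ξ)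
  have h3 := cutoff_nonneg ((2 : ℝ) • ((2 : ℝ) ^ j)⁻¹ • ξ)
  have h4 := cutoff_le_one ((2 : ℝ) • ((2 : ℝ) ^ j)⁻¹ • ξ)
  split_ifs <;> rw [abs_le] <;> constructor <;> linarith

lemma norm_le_of_band_ne_zero {j : ℕ} {ξ : EuclideanSpace ℝ (Fin d)} (h : band j ξ ≠ 0) :
    ‖ξ‖ ≤ 2 * 2 ^ j := by
  by_contra! h'
  refine h (bandProfile_eq_zero ?_)
  rw [norm_smul, norm_inv, norm_pow, Real.norm_ofNat, inv_mul_eq_div, le_div_iff₀ (by positivity)]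
  exact h'.le

lemma le_norm_of_band_ne_zero {j : ℕ} {ξ : EuclideanSpace ℝ (Fin d)} (h : band j ξ ≠ 0) :
    (2 : ℝ) ^ j ≤ 2 * (1 + ‖ξ‖) := by
  by_contra! h'
  have hξ := norm_nonneg ξ
  rcases Nat.eq_zero_or_pos j with rfl | hj
  · norm_num at h'; linarith
  · refine h ?_
    have e : ‖((2 : ℝ) ^ j)⁻¹ • ξ‖ = ‖ξ‖ / 2 ^ j := by
      rw [norm_smul, norm_inv, norm_pow, Real.norm_ofNat, inv_mul_eq_div]
    have h1 : ‖(2 : ℝ) • ((2 : ℝ) ^ j)⁻¹ • ξ‖ ≤ 1 := by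
      rw [norm_smul, e, Real.norm_ofNat, ← mul_div_assoc, div_le_one (by positivity)]
      linarith
    have h2 : ‖((2 : ℝ) ^ j)⁻¹ • ξ‖ ≤ 1 := by
      rw [norm_smul, Real.norm_ofNat] at h1
      linarith [norm_nonneg (((2 : ℝ) ^ j)⁻¹ • ξ)]
    simp [band, bandProfile, hj.ne', cutoff_eq_one h1, cutoff_eq_one h2]

lemma band_congr_norm (j : ℕ) {ξ η : EuclideanSpace ℝ (Fin d)} (h : ‖ξ‖ = ‖η‖) :
    band j ξ = band j η := by
  simp [band, bandProfile, cutoff, norm_smul, h]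

/-- The differences of dilated cutoffs telescope. Hence the partial sums stay between zero and one,
which supplies the domination when the pieces are summed. -/
lemma sum_band (n : ℕ) (ξ : EuclideanSpace ℝ (Fin d)) :
    ∑ j ∈ Finset.range (n + 1), band j ξ = cutoff (((2 : ℝ) ^ n)⁻¹ • ξ) := by
  induction n with
  | zero => simp [band, bandProfile]
  | succ n ih =>
    rw [Finset.sum_range_succ, ih]
    simp only [band, bandProfile, Nat.add_eq_zero_iff, one_ne_zero, and_false, if_false, smul_smul]
    have : (2 : ℝ) * (2 ^ (n + 1))⁻¹ = (2 ^ n)⁻¹ := by rw [pow_succ]; field_simp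
    rw [this]; ring

lemma tendsto_sum_band (ξ : EuclideanSpace ℝ (Fin d)) :
    Filter.Tendsto (fun n => ∑ j ∈ Finset.range n, band j ξ) Filter.atTop (nhds 1) := by
  obtain ⟨N, hN⟩ := pow_unbounded_of_one_lt ‖ξ‖ (one_lt_two : (1 : ℝ) < 2)
  refine tendsto_const_nhds.congr' ?_
  filter_upwards [Filter.eventually_ge_atTop (N + 1)] with n hn
  obtain ⟨k, rfl⟩ : ∃ k, n = k + 1 := ⟨n - 1, by omega⟩
  rw [sum_band, cutoff_eq_one]
  rw [norm_smul, norm_inv, norm_pow, Real.norm_ofNat, inv_mul_eq_div, div_le_one (by positivity)]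
  exact hN.le.trans (pow_le_pow_right₀ (by norm_num) (by omega))

lemma integrable_band (j : ℕ) : Integrable fun ξ : EuclideanSpace ℝ (Fin d) => (band j ξ : ℂ) := by
  refine Continuous.integrable_of_hasCompactSupport
    (Complex.continuous_ofReal.comp (continuous_band j)) ?_
  refine HasCompactSupport.of_support_subset_isCompact (isCompact_closedBall 0 (2 * 2 ^ j))
    fun ξ hξ => ?_
  rw [mem_closedBall_zero_iff]
  exact norm_le_of_band_ne_zero (by simpa using hξ)

end Cutoff

/-! ### Kernels of the frequency bands and their spherical averages. -/

section Kernel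

variable {d : ℕ} [NeZero d]

/-- The basic `L¹`-normalized bump at scale `2 ^ (-j)`. -/
def weight (j : ℕ) (x : EuclideanSpace ℝ (Fin d)) : ℝ :=
  ((2 : ℝ) ^ j) ^ d * ((1 + 2 ^ j * ‖x‖) ^ (d + 1))⁻¹

lemma weight_nonneg (j : ℕ) (x : EuclideanSpace ℝ (Fin d)) : 0 ≤ weight j x := by
  unfold weight; positivity

lemma measurable_weight (j : ℕ) : Measurable (weight (d := d) j) := by
  unfold weight; fun_prop

lemma fourierInv_comp_inv_smul (P : EuclideanSpace ℝ (Fin d) → ℂ) (j : ℕ)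
    (x : EuclideanSpace ℝ (Fin d)) :
    𝓕⁻ (fun ξ => P (((2 : ℝ) ^ j)⁻¹ • ξ)) x = (((2 : ℝ) ^ j) ^ d : ℝ) • 𝓕⁻ P ((2 : ℝ) ^ j • x) := by
  simp only [Real.fourierInv_eq']
  have h := Measure.integral_comp_inv_smul (volume : Measure (EuclideanSpace ℝ (Fin d)))
    (fun ξ => Complex.exp (↑(2 * Real.pi * inner ℝ ξ ((2 : ℝ) ^ j • x)) * Complex.I) • P ξ)
    ((2 : ℝ) ^ j)
  rw [finrank_euclideanSpace_fin, abs_of_nonneg (by positivity)] at h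
  rw [← h]
  congr 1; ext ξ
  rw [inner_smul_left, inner_smul_right]
  congr 5
  simp only [conj_trivial]
  field_simp

/-- A smooth compactly supported profile has a Schwartz inverse Fourier transform; dilating the
profile only rescales it, so one constant serves every `j`. -/
lemma exists_fourierInv_dilate_le {P : EuclideanSpace ℝ (Fin d) → ℂ} (hP : ContDiff ℝ ∞ P)
    (hPs : HasCompactSupport P) (N : ℕ) :
    ∃ C : ℝ, 0 ≤ C ∧ ∀ (j : ℕ) (x : EuclideanSpace ℝ (Fin d)),
      ‖𝓕⁻ (fun ξ => P (((2 : ℝ) ^ j)⁻¹ • ξ)) x‖ ≤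
        C * (((2 : ℝ) ^ j) ^ d * ((1 + 2 ^ j * ‖x‖) ^ N)⁻¹) := by
  set φ : 𝓢(EuclideanSpace ℝ (Fin d), ℂ) := 𝓕⁻ (hPs.toSchwartzMap hP)
  have hφ : ∀ x, φ x = 𝓕⁻ P x := fun x => by
    simp only [φ, SchwartzMap.fourierInv_coe]; rfl
  have hdec := SchwartzMap.one_add_le_sup_seminorm_apply (𝕜 := ℝ) (m := (N, 0)) (k := N) (n := 0)
    le_rfl le_rfl φ
  set C := 2 ^ N * (Finset.Iic (N, 0)).sup (fun m => SchwartzMap.seminorm ℝ m.1 m.2) φ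
  have hC : ∀ x, (1 + ‖x‖) ^ N * ‖φ x‖ ≤ C := fun x => by simpa using hdec x
  refine ⟨C, ?_, fun j x => ?_⟩
  · exact le_trans (by positivity) (hC 0)
  · rw [fourierInv_comp_inv_smul, norm_smul, Real.norm_of_nonneg (by positivity), ← hφ]
    have h := hC ((2 : ℝ) ^ j • x)
    rw [norm_smul, norm_pow, Real.norm_ofNat] at h
    have h2 : ‖φ ((2 : ℝ) ^ j • x)‖ ≤ C * ((1 + 2 ^ j * ‖x‖) ^ N)⁻¹ := by
      rw [← div_eq_mul_inv, le_div_iff₀ (by positivity), mul_comm]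
      exact h
    calc _ ≤ ((2 : ℝ) ^ j) ^ d * (C * ((1 + 2 ^ j * ‖x‖) ^ N)⁻¹) := by gcongr
      _ = _ := by ring

/-- The convolution kernel of the `j`th frequency band, and of its square, is concentrated at
scale `2 ^ (-j)`. -/
lemma exists_fourierInv_band_pow_le (d k N : ℕ) [NeZero d] (hk : k ≠ 0) :
    ∃ C : ℝ, 0 ≤ C ∧ ∀ (j : ℕ) (x : EuclideanSpace ℝ (Fin d)),
      ‖𝓕⁻ (fun ξ => (band j ξ : ℂ) ^ k) x‖ ≤
        C * (((2 : ℝ) ^ j) ^ d * ((1 + 2 ^ j * ‖x‖) ^ N)⁻¹) := by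
  -- Only two profiles occur, one for `j = 0` and one shared by all `j ≥ 1`, so a maximum of two
  -- constants is uniform in `j`.
  have key : ∀ i : ℕ, ∃ C : ℝ, 0 ≤ C ∧ ∀ (j : ℕ) (x : EuclideanSpace ℝ (Fin d)),
      ‖𝓕⁻ (fun ξ => (bandProfile i (((2 : ℝ) ^ j)⁻¹ • ξ) : ℂ) ^ k) x‖ ≤
        C * (((2 : ℝ) ^ j) ^ d * ((1 + 2 ^ j * ‖x‖) ^ N)⁻¹) := fun i =>
    exists_fourierInv_dilate_le (P := fun ξ => (bandProfile i ξ : ℂ) ^ k)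
      ((Complex.ofRealCLM.contDiff.comp (contDiff_bandProfile i)).pow k)
      ((hasCompactSupport_bandProfile i).comp_left (g := fun r : ℝ => (r : ℂ) ^ k) (by simp [hk])) N
  obtain ⟨C₀, h₀, hC₀⟩ := key 0
  obtain ⟨C₁, h₁, hC₁⟩ := key 1
  refine ⟨max C₀ C₁, le_max_of_le_left h₀, fun j x => ?_⟩
  rcases Nat.eq_zero_or_pos j with rfl | hj
  · exact (hC₀ 0 x).trans (by gcongr; exact le_max_left _ _)
  · have : ∀ ξ : EuclideanSpace ℝ (Fin d), band j ξ = bandProfile 1 (((2 : ℝ) ^ j)⁻¹ • ξ) :=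
      fun ξ => by simp [band, bandProfile, hj.ne']
    simp only [this]
    exact (hC₁ j x).trans (by gcongr; exact le_max_right _ _)

lemma exists_lintegral_weight_le (d : ℕ) [NeZero d] :
    ∃ C : ℝ≥0, ∀ j : ℕ, ∫⁻ x : EuclideanSpace ℝ (Fin d), ENNReal.ofReal (weight j x) ≤ C := by
  have hint : Integrable fun x : EuclideanSpace ℝ (Fin d) => ((1 + ‖x‖) ^ (d + 1))⁻¹ := by
    have := integrable_one_add_norm (E := EuclideanSpace ℝ (Fin d)) (μ := volume) (r := d + 1)
      (by rw [finrank_euclideanSpace_fin]; linarith)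
    refine this.congr (.of_forall fun x => ?_)
    simp only
    rw [Real.rpow_neg (by positivity)]
    norm_cast
  refine ⟨(∫ x : EuclideanSpace ℝ (Fin d), ((1 + ‖x‖) ^ (d + 1))⁻¹).toNNReal, fun j => ?_⟩
  have e : weight (d := d) j = fun x =>
      ((2 : ℝ) ^ j) ^ d * (fun x => ((1 + ‖x‖) ^ (d + 1))⁻¹) ((2 : ℝ) ^ j • x) := by
    ext x
    simp [weight, norm_smul]
  have hi : Integrable (weight (d := d) j) := by
    rw [e]
    exact (hint.comp_smul (by positivity : (2 : ℝ) ^ j ≠ 0)).const_mul _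
  rw [← ofReal_integral_eq_lintegral_ofReal hi (.of_forall fun x => weight_nonneg j x), e,
    integral_const_mul, Measure.integral_comp_smul volume
      (fun x : EuclideanSpace ℝ (Fin d) => ((1 + ‖x‖) ^ (d + 1))⁻¹), finrank_euclideanSpace_fin,
    abs_of_nonneg (by positivity), smul_eq_mul, ← mul_assoc, mul_inv_cancel₀ (by positivity),
    one_mul]
  rfl

/-- The bump changes by at most a constant factor under translations of length `2^(-j)`, and on the
unit sphere `t • y` and `s • y` are that close. -/
lemma weight_sub_smul_le (j : ℕ) (x : EuclideanSpace ℝ (Fin d)) {s t : ℝ}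
    (h : |t - s| ≤ ((2 : ℝ) ^ j)⁻¹) (y : sphere (0 : EuclideanSpace ℝ (Fin d)) 1) :
    weight j (x - t • (y : EuclideanSpace ℝ (Fin d))) ≤
      2 ^ (d + 1) * weight j (x - s • (y : EuclideanSpace ℝ (Fin d))) := by
  unfold weight
  have h1 : ‖x - s • (y : EuclideanSpace ℝ (Fin d))‖ ≤
      ‖x - t • (y : EuclideanSpace ℝ (Fin d))‖ + |t - s| := by
    calc _ = ‖(x - t • (y : EuclideanSpace ℝ (Fin d))) + (t - s) • (y : EuclideanSpace ℝ (Fin d))‖ := by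
          congr 1; module
      _ ≤ _ := (norm_add_le _ _).trans (by simp [norm_smul])
  have h2 : 1 + 2 ^ j * ‖x - s • (y : EuclideanSpace ℝ (Fin d))‖ ≤
      2 * (1 + 2 ^ j * ‖x - t • (y : EuclideanSpace ℝ (Fin d))‖) := by
    have h3 : (2 : ℝ) ^ j * |t - s| ≤ 1 := by
      calc (2 : ℝ) ^ j * |t - s| ≤ 2 ^ j * (2 ^ j)⁻¹ := by gcongr
        _ = 1 := mul_inv_cancel₀ (by positivity)
    have h4 : (2 : ℝ) ^ j * ‖x - s • (y : EuclideanSpace ℝ (Fin d))‖ ≤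
      2 ^ j * (‖x - t • (y : EuclideanSpace ℝ (Fin d))‖ + |t - s|) := by gcongr
    have h5 : 0 ≤ (2 : ℝ) ^ j * ‖x - t • (y : EuclideanSpace ℝ (Fin d))‖ := by positivity
    linarith
  have h6 : ((1 + 2 ^ j * ‖x - t • (y : EuclideanSpace ℝ (Fin d))‖) ^ (d + 1))⁻¹ ≤
      2 ^ (d + 1) * ((1 + 2 ^ j * ‖x - s • (y : EuclideanSpace ℝ (Fin d))‖) ^ (d + 1))⁻¹ := by
    rw [← div_eq_mul_inv, inv_eq_one_div, div_le_div_iff₀ (by positivity) (by positivity), one_mul,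
      ← mul_pow]
    gcongr
  calc _ ≤ ((2 : ℝ) ^ j) ^ d * (2 ^ (d + 1) *
        ((1 + 2 ^ j * ‖x - s • (y : EuclideanSpace ℝ (Fin d))‖) ^ (d + 1))⁻¹) := by gcongr
    _ = _ := by ring

/-- The spherical mean of a nonnegative function. -/
def avg (t : ℝ) (g : EuclideanSpace ℝ (Fin d) → ℝ≥0∞) (x : EuclideanSpace ℝ (Fin d)) : ℝ≥0∞ :=
  ∫⁻ y, g (x - t • (y : EuclideanSpace ℝ (Fin d))) ∂(sphereMeasure d)

/-- The spherical mean of the bump at scale `2 ^ (-j)`. -/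
def avgWeight (j : ℕ) (t : ℝ) (x : EuclideanSpace ℝ (Fin d)) : ℝ≥0∞ :=
  avg t (fun z => ENNReal.ofReal (weight j z)) x

lemma measurable_avg {t : ℝ} {g : EuclideanSpace ℝ (Fin d) → ℝ≥0∞} (hg : Measurable g) :
    Measurable (avg t g) := by
  have : Measurable fun p : EuclideanSpace ℝ (Fin d) × sphere (0 : EuclideanSpace ℝ (Fin d)) 1 =>
      g (p.1 - t • (p.2 : EuclideanSpace ℝ (Fin d))) := hg.comp (by fun_prop)
  exact this.lintegral_prod_right'

lemma lintegral_avg {t : ℝ} {g : EuclideanSpace ℝ (Fin d) → ℝ≥0∞} (hg : Measurable g) :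
    ∫⁻ x, avg t g x = ∫⁻ x, g x := by
  unfold avg
  rw [lintegral_lintegral_swap]
  · simp only [lintegral_sub_right_eq_self]
    simp
  · exact (hg.comp (by fun_prop)).aemeasurable

lemma avgWeight_le_mul (j : ℕ) {s t : ℝ} (h : |t - s| ≤ ((2 : ℝ) ^ j)⁻¹)
    (x : EuclideanSpace ℝ (Fin d)) : avgWeight j t x ≤ 2 ^ (d + 1) * avgWeight j s x := by
  unfold avgWeight avg
  rw [← lintegral_const_mul' _ _ (by simp)]
  refine lintegral_mono fun y => ?_
  rw [show (2 : ℝ≥0∞) ^ (d + 1) = ENNReal.ofReal (2 ^ (d + 1)) by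
    rw [ENNReal.ofReal_pow (by norm_num)]; simp, ← ENNReal.ofReal_mul (by positivity)]
  exact ENNReal.ofReal_le_ofReal (weight_sub_smul_le j x h y)

/-- Up to a constant, the average at radius `t` is `2^j` times its integral over the radii in `[t, t
+ 2^(-j)]`, and polar coordinates bound that integral by the `L¹` norm of the bump. -/
lemma exists_avgWeight_le (d : ℕ) [NeZero d] :
    ∃ C : ℝ≥0, ∀ (j : ℕ) (t : ℝ), t ∈ Icc (1 : ℝ) 2 → ∀ x : EuclideanSpace ℝ (Fin d),
      avgWeight j t x ≤ C * 2 ^ j := by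
  obtain ⟨C₁, hC₁⟩ := exists_lintegral_polar_le d one_pos 3
  obtain ⟨C₂, hC₂⟩ := exists_lintegral_weight_le d
  refine ⟨2 ^ (d + 1) * (C₁ * C₂), fun j t ht x => ?_⟩
  have hδ : ((2 : ℝ) ^ j)⁻¹ ≤ 1 := inv_le_one_of_one_le₀ (one_le_pow₀ (by norm_num))
  have hδ0 : 0 < ((2 : ℝ) ^ j)⁻¹ := by positivity
  have h1 : ENNReal.ofReal ((2 : ℝ) ^ j)⁻¹ * avgWeight j t x ≤
      ∫⁻ s in Icc t (t + ((2 : ℝ) ^ j)⁻¹), 2 ^ (d + 1) * avgWeight j s x := by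
    calc ENNReal.ofReal ((2 : ℝ) ^ j)⁻¹ * avgWeight j t x
        = ∫⁻ s in Icc t (t + ((2 : ℝ) ^ j)⁻¹), avgWeight j t x := by
          rw [setLIntegral_const, Real.volume_Icc, mul_comm]; congr 2; ring
      _ ≤ _ := setLIntegral_mono' measurableSet_Icc fun s hs => avgWeight_le_mul j (by
          rw [abs_sub_comm, abs_of_nonneg (by linarith [hs.1])]; linarith [hs.2]) x
  -- The interval starting at `t ≤ 2` has length at most one, whence radii up to `3`.
  have h2 : ∫⁻ s in Icc t (t + ((2 : ℝ) ^ j)⁻¹), 2 ^ (d + 1) * avgWeight j s x ≤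
      2 ^ (d + 1) * ∫⁻ s in Icc (1 : ℝ) 3, avgWeight j s x := by
    rw [lintegral_const_mul' _ _ (by simp)]
    gcongr
    · exact ht.1
    · linarith [ht.2]
  have h3 : ∫⁻ s in Icc (1 : ℝ) 3, avgWeight j s x ≤ C₁ * C₂ := by
    calc _ ≤ C₁ * ∫⁻ z, ENNReal.ofReal (weight j (x - z)) :=
          hC₁ (fun z => ENNReal.ofReal (weight j (x - z)))
            ((measurable_weight j).comp (by fun_prop)).ennreal_ofReal
      _ = C₁ * ∫⁻ z, ENNReal.ofReal (weight j z) := by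
          rw [lintegral_sub_left_eq_self (fun z => ENNReal.ofReal (weight j z)) x]
      _ ≤ _ := by gcongr; exact hC₂ j
  have h4 := (h1.trans h2).trans (mul_le_mul_right h3 _)
  have e : ENNReal.ofReal ((2 : ℝ) ^ j)⁻¹ = (2 ^ j)⁻¹ := by
    rw [ENNReal.ofReal_inv_of_pos (by positivity), ENNReal.ofReal_pow (by norm_num)]; simp
  rw [e, ENNReal.inv_mul_le_iff (by simp) (by simp)] at h4
  rw [mul_comm]
  push_cast
  exact h4

end Kernel

end SphericalMax

end

set_option linter.unusedSectionVars false

noncomputable section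

namespace SphericalMax

open Metric Set
open scoped FourierTransform SchwartzMap ContDiff

/-! ### Frequency-localized pieces of Schwartz functions and their `L¹` bounds. -/

variable {d : ℕ} [NeZero d]

/-- The part of `f` with frequencies of size about `2 ^ j`. -/
def piece (j : ℕ) (f : 𝓢(EuclideanSpace ℝ (Fin d), ℂ)) : EuclideanSpace ℝ (Fin d) → ℂ :=
  𝓕⁻ (fun ξ => (band j ξ : ℂ) * 𝓕 (f : EuclideanSpace ℝ (Fin d) → ℂ) ξ)

lemma continuous_fourier_schwartz (f : 𝓢(EuclideanSpace ℝ (Fin d), ℂ)) :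
    Continuous (𝓕 (f : EuclideanSpace ℝ (Fin d) → ℂ)) := by
  rw [← SchwartzMap.fourier_coe]; exact (𝓕 f).continuous

lemma integrable_fourier_schwartz (f : 𝓢(EuclideanSpace ℝ (Fin d), ℂ)) :
    Integrable (𝓕 (f : EuclideanSpace ℝ (Fin d) → ℂ)) := by
  rw [← SchwartzMap.fourier_coe]; exact (𝓕 f).integrable

lemma integrable_band_mul_fourier (j : ℕ) (f : 𝓢(EuclideanSpace ℝ (Fin d), ℂ)) :
    Integrable fun ξ => (band j ξ : ℂ) * 𝓕 (f : EuclideanSpace ℝ (Fin d) → ℂ) ξ := by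
  refine (integrable_fourier_schwartz f).bdd_mul (c := 1)
    (Complex.continuous_ofReal.comp (continuous_band j)).aestronglyMeasurable
    (.of_forall fun ξ => ?_)
  rw [Complex.norm_real]
  exact abs_band_le_one j ξ

lemma continuous_piece (j : ℕ) (f : 𝓢(EuclideanSpace ℝ (Fin d), ℂ)) : Continuous (piece j f) :=
  continuous_fourierInv (integrable_band_mul_fourier j f)

lemma sum_piece_eq (n : ℕ) (f : 𝓢(EuclideanSpace ℝ (Fin d), ℂ))
    (x : EuclideanSpace ℝ (Fin d)) :
    ∑ j ∈ Finset.range n, piece j f x = ∫ ξ,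
      Complex.exp (↑(2 * Real.pi * inner ℝ ξ x) * Complex.I) •
        (((∑ j ∈ Finset.range n, band j ξ : ℝ) : ℂ) *
          𝓕 (f : EuclideanSpace ℝ (Fin d) → ℂ) ξ) := by
  simp only [piece, Real.fourierInv_eq']
  rw [← integral_finsetSum]
  · congr 1; ext ξ
    rw [← Finset.smul_sum]; push_cast; rw [Finset.sum_mul]
  · intro j _
    refine (integrable_band_mul_fourier j f).bdd_mul (c := 1) ?_ ?_
    · exact Continuous.aestronglyMeasurable (by fun_prop)
    · exact .of_forall fun ξ => (Complex.norm_exp_ofReal_mul_I _).le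

lemma norm_sum_piece_le (n : ℕ) (f : 𝓢(EuclideanSpace ℝ (Fin d), ℂ))
    (x : EuclideanSpace ℝ (Fin d)) :
    ‖∑ j ∈ Finset.range n, piece j f x‖ ≤
      ∫ ξ, ‖𝓕 (f : EuclideanSpace ℝ (Fin d) → ℂ) ξ‖ := by
  rw [sum_piece_eq]
  refine norm_integral_le_of_norm_le (integrable_fourier_schwartz f).norm (.of_forall fun ξ => ?_)
  rw [norm_smul, Complex.norm_exp_ofReal_mul_I, one_mul, norm_mul, Complex.norm_real]
  refine mul_le_of_le_one_left (norm_nonneg _) ?_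
  rcases n with _ | n
  · simp
  · rw [sum_band, Real.norm_of_nonneg (cutoff_nonneg _)]
    exact cutoff_le_one _

lemma tendsto_sum_piece (f : 𝓢(EuclideanSpace ℝ (Fin d), ℂ)) (x : EuclideanSpace ℝ (Fin d)) :
    Filter.Tendsto (fun n => ∑ j ∈ Finset.range n, piece j f x) Filter.atTop (nhds (f x)) := by
  have hf : f x = ∫ ξ, Complex.exp (↑(2 * Real.pi * inner ℝ ξ x) * Complex.I) •
      (((1 : ℝ) : ℂ) * 𝓕 (f : EuclideanSpace ℝ (Fin d) → ℂ) ξ) := by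
    have h : 𝓕⁻ (𝓕 f) = f := FourierTransform.fourierInv_fourier_eq f
    have h2 := DFunLike.congr_fun h x
    rw [SchwartzMap.fourierInv_coe, SchwartzMap.fourier_coe, Real.fourierInv_eq'] at h2
    rw [← h2]
    simp
  rw [hf]
  simp only [sum_piece_eq]
  refine tendsto_integral_of_dominated_convergence
    (fun ξ => ‖𝓕 (f : EuclideanSpace ℝ (Fin d) → ℂ) ξ‖) ?_ (integrable_fourier_schwartz f).norm
    ?_ ?_
  · intro n
    have h1 := fun j => continuous_band (d := d) j
    have h2 := continuous_fourier_schwartz f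
    exact Continuous.aestronglyMeasurable (by fun_prop)
  · refine fun n => .of_forall fun ξ => ?_
    rw [norm_smul, Complex.norm_exp_ofReal_mul_I, one_mul, norm_mul, Complex.norm_real]
    refine mul_le_of_le_one_left (norm_nonneg _) ?_
    rcases n with _ | n
    · simp
    · rw [sum_band, Real.norm_of_nonneg (cutoff_nonneg _)]
      exact cutoff_le_one _
  · refine .of_forall fun ξ => ?_
    refine Filter.Tendsto.const_smul (Filter.Tendsto.mul_const _ ?_) _
    exact (Complex.continuous_ofReal.tendsto _).comp (tendsto_sum_band ξ)

/-- The partial sums of the pieces converge pointwise to `f` and are dominated by the `L¹` norm of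
its Fourier transform, so the spherical mean passes to the limit. -/
lemma sphericalMean_le_tsum_piece (f : 𝓢(EuclideanSpace ℝ (Fin d), ℂ)) (t : ℝ)
    (x : EuclideanSpace ℝ (Fin d)) :
    ‖sphericalMean t f x‖ₑ ≤ ∑' j, ‖sphericalMean t (piece j f) x‖ₑ := by
  have hint : ∀ j, Integrable (fun y : sphere (0 : EuclideanSpace ℝ (Fin d)) 1 =>
      piece j f (x - t • (y : EuclideanSpace ℝ (Fin d)))) (sphereMeasure d) := fun j => by
    have := continuous_piece j f
    exact integrable_sphereMeasure_of_continuous (by fun_prop)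
  have hlim : Filter.Tendsto (fun n => ∑ j ∈ Finset.range n, sphericalMean t (piece j f) x)
      Filter.atTop (nhds (sphericalMean t f x)) := by
    simp only [sphericalMean]
    simp_rw [← fun n : ℕ => integral_finsetSum (Finset.range n) fun j _ => hint j]
    refine tendsto_integral_of_dominated_convergence
      (fun _ => ∫ ξ, ‖𝓕 (f : EuclideanSpace ℝ (Fin d) → ℂ) ξ‖) ?_ (integrable_const _) ?_ ?_
    · exact fun n => (integrable_finsetSum _ fun j _ => hint j).aestronglyMeasurable
    · exact fun n => .of_forall fun y => norm_sum_piece_le n f _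
    · exact .of_forall fun y => tendsto_sum_piece f _
  refine le_of_tendsto' ((continuous_enorm.tendsto _).comp hlim) fun n => ?_
  exact (enorm_sum_le _ _).trans (ENNReal.sum_le_tsum _)

lemma piece_eq_integral (j : ℕ) (f : 𝓢(EuclideanSpace ℝ (Fin d), ℂ))
    (x : EuclideanSpace ℝ (Fin d)) :
    piece j f x = ∫ z, f z * 𝓕⁻ (fun ξ => (band j ξ : ℂ) ^ 1) (x - z) := by
  have hexp : Continuous fun ξ : EuclideanSpace ℝ (Fin d) =>
    Complex.exp (↑(2 * Real.pi * inner ℝ ξ x) * Complex.I) := by fun_prop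
  set g : EuclideanSpace ℝ (Fin d) → ℂ := fun ξ =>
    Complex.exp (↑(2 * Real.pi * inner ℝ ξ x) * Complex.I) * band j ξ
  have hg : Integrable g := (integrable_band j).bdd_mul (c := 1) hexp.aestronglyMeasurable
    (.of_forall fun ξ => (Complex.norm_exp_ofReal_mul_I _).le)
  have h := VectorFourier.integral_fourierIntegral_smul_eq_flip (L := innerₗ
    (EuclideanSpace ℝ (Fin d))) (μ := volume) (ν := volume) Real.continuous_fourierChar
    continuous_inner f.integrable hg
  rw [flip_innerₗ] at h
  change ∫ ξ, 𝓕 (f : EuclideanSpace ℝ (Fin d) → ℂ) ξ • g ξ = ∫ z, f z • 𝓕 g z at h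
  have h1 : piece j f x = ∫ ξ, 𝓕 (f : EuclideanSpace ℝ (Fin d) → ℂ) ξ • g ξ := by
    simp only [piece, Real.fourierInv_eq']
    congr 1; ext ξ
    simp only [g, smul_eq_mul]; ring
  rw [h1, h]
  congr 1; ext z
  rw [smul_eq_mul, Real.fourierInv_eq', Real.fourier_eq']
  congr 2; ext ξ
  simp only [g, smul_eq_mul, pow_one]
  rw [← mul_assoc, ← Complex.exp_add, inner_sub_right]
  congr 2
  push_cast
  ring

/-- Each piece is a convolution with a kernel dominated by the bump at scale `2^(-j)`; averaging
over the sphere turns the bump into `avgWeight`. All the `L¹` bounds follow from this pointwise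
estimate. -/
lemma exists_enorm_sphericalMean_piece_le (d : ℕ) [NeZero d] :
    ∃ C : ℝ≥0, ∀ (j : ℕ) (f : 𝓢(EuclideanSpace ℝ (Fin d), ℂ)) (t : ℝ)
      (x : EuclideanSpace ℝ (Fin d)),
      ‖sphericalMean t (piece j f) x‖ₑ ≤ C * ∫⁻ z, ‖f z‖ₑ * avgWeight j t (x - z) := by
  obtain ⟨C, hC0, hC⟩ := exists_fourierInv_band_pow_le d 1 (d + 1) one_ne_zero
  refine ⟨C.toNNReal, fun j f t x => ?_⟩
  have h1 : ∀ x, ‖piece j f x‖ₑ ≤ C.toNNReal * ∫⁻ z, ‖f z‖ₑ * ENNReal.ofReal (weight j (x - z)) :=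
    fun x => by
    rw [piece_eq_integral, ← lintegral_const_mul' _ _ (by simp)]
    refine (enorm_integral_le_lintegral_enorm _).trans (lintegral_mono fun z => ?_)
    rw [enorm_mul, mul_left_comm]
    gcongr
    rw [← ofReal_norm, ENNReal.ofNNReal_toNNReal, ← ENNReal.ofReal_mul hC0]
    exact ENNReal.ofReal_le_ofReal (hC j _)
  have hmeas : Measurable fun p : sphere (0 : EuclideanSpace ℝ (Fin d)) 1 ×
      EuclideanSpace ℝ (Fin d) => ‖f p.2‖ₑ *
        ENNReal.ofReal (weight j (x - t • (p.1 : EuclideanSpace ℝ (Fin d)) - p.2)) := by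
    exact (f.continuous.measurable.comp measurable_snd).enorm.mul
      ((measurable_weight j).comp (by fun_prop)).ennreal_ofReal
  calc ‖sphericalMean t (piece j f) x‖ₑ
      ≤ ∫⁻ y, ‖piece j f (x - t • (y : EuclideanSpace ℝ (Fin d)))‖ₑ ∂(sphereMeasure d) :=
        enorm_integral_le_lintegral_enorm _
    _ ≤ ∫⁻ y, (C.toNNReal * ∫⁻ z, ‖f z‖ₑ *
          ENNReal.ofReal (weight j (x - t • (y : EuclideanSpace ℝ (Fin d)) - z)))
          ∂(sphereMeasure d) := lintegral_mono fun y => h1 _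
    _ = C.toNNReal * ∫⁻ z, ∫⁻ y, ‖f z‖ₑ *
          ENNReal.ofReal (weight j (x - t • (y : EuclideanSpace ℝ (Fin d)) - z))
          ∂(sphereMeasure d) := by
        rw [lintegral_const_mul' _ _ (by simp), lintegral_lintegral_swap hmeas.aemeasurable]
    _ = _ := by
        congr 2; ext z
        rw [lintegral_const_mul' _ _ (by simp)]
        simp only [avgWeight, avg, sub_right_comm]

lemma measurable_avgWeight (j : ℕ) (t : ℝ) : Measurable (avgWeight (d := d) j t) :=
  measurable_avg (measurable_weight j).ennreal_ofReal

/-- The `L¹ → L^∞` bound for the pieces of the spherical means. -/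
lemma exists_sphericalMean_piece_le (d : ℕ) [NeZero d] :
    ∃ C : ℝ≥0, ∀ (j : ℕ) (f : 𝓢(EuclideanSpace ℝ (Fin d), ℂ)) (t : ℝ), t ∈ Icc (1 : ℝ) 2 →
      ∀ x : EuclideanSpace ℝ (Fin d),
      ‖sphericalMean t (piece j f) x‖ₑ ≤ C * 2 ^ j * ∫⁻ z, ‖f z‖ₑ := by
  obtain ⟨C₁, hC₁⟩ := exists_enorm_sphericalMean_piece_le d
  obtain ⟨C₂, hC₂⟩ := exists_avgWeight_le d
  refine ⟨C₁ * C₂, fun j f t ht x => (hC₁ j f t x).trans ?_⟩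
  calc C₁ * ∫⁻ z, ‖f z‖ₑ * avgWeight j t (x - z)
      ≤ C₁ * ∫⁻ z, ‖f z‖ₑ * (C₂ * 2 ^ j) := by
        gcongr with z; exact hC₂ j t ht _
    _ = _ := by
        rw [lintegral_mul_const' _ _ (ENNReal.mul_ne_top (by simp) (by simp))]
        push_cast
        ring

/-- The `L¹` bound for the local maximal function of a piece. -/
lemma exists_lintegral_iSup_piece_le (d : ℕ) [NeZero d] :
    ∃ C : ℝ≥0, ∀ (j : ℕ) (f : 𝓢(EuclideanSpace ℝ (Fin d), ℂ)) (s : ℝ) (T : Set ℝ),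
      (∀ t ∈ T, |t - s| ≤ ((2 : ℝ) ^ j)⁻¹) →
      ∫⁻ x, ⨆ t ∈ T, ‖sphericalMean t (piece j f) x‖ₑ ≤ C * ∫⁻ z, ‖f z‖ₑ := by
  obtain ⟨C₁, hC₁⟩ := exists_enorm_sphericalMean_piece_le d
  obtain ⟨C₂, hC₂⟩ := exists_lintegral_weight_le d
  refine ⟨C₁ * 2 ^ (d + 1) * C₂, fun j f s T hT => ?_⟩
  have hmeas : Measurable fun p : EuclideanSpace ℝ (Fin d) × EuclideanSpace ℝ (Fin d) =>
      ‖f p.2‖ₑ * avgWeight j s (p.1 - p.2) :=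
    (f.continuous.measurable.comp measurable_snd).enorm.mul
      ((measurable_avgWeight j s).comp (by fun_prop))
  calc ∫⁻ x, ⨆ t ∈ T, ‖sphericalMean t (piece j f) x‖ₑ
      ≤ ∫⁻ x, C₁ * 2 ^ (d + 1) * ∫⁻ z, ‖f z‖ₑ * avgWeight j s (x - z) := by
        -- The radius is frozen at `s`: this costs a factor `2^(d+1)`, after which the bound no
        -- longer depends on `t`.
        refine lintegral_mono fun x => iSup₂_le fun t ht => (hC₁ j f t x).trans ?_
        rw [mul_assoc]
        refine mul_le_mul_right ?_ _
        rw [← lintegral_const_mul' _ _ (by simp)]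
        refine lintegral_mono fun z => ?_
        rw [mul_left_comm]
        gcongr
        exact avgWeight_le_mul j (hT t ht) _
    _ = C₁ * 2 ^ (d + 1) * ∫⁻ z, ∫⁻ x, ‖f z‖ₑ * avgWeight j s (x - z) := by
        rw [lintegral_const_mul' _ _ (ENNReal.mul_ne_top (by simp) (by simp)),
          lintegral_lintegral_swap hmeas.aemeasurable]
    _ = C₁ * 2 ^ (d + 1) * ((∫⁻ z, ‖f z‖ₑ) * ∫⁻ x, ENNReal.ofReal (weight (d := d) j x)) := by
        congr 1
        rw [← lintegral_mul_const _ f.continuous.measurable.enorm]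
        congr 1; ext z
        rw [lintegral_const_mul' _ _ (by simp),
          lintegral_sub_right_eq_self (fun x => avgWeight j s x) z]
        congr 1
        exact lintegral_avg (measurable_weight j).ennreal_ofReal
    _ ≤ C₁ * 2 ^ (d + 1) * ((∫⁻ z, ‖f z‖ₑ) * C₂) := by gcongr; exact hC₂ j
    _ = _ := by push_cast; ring

end SphericalMax

end

set_option linter.unusedSectionVars false

noncomputable section

namespace SphericalMax

open Metric Set
open scoped FourierTransform SchwartzMap ContDiff

/-! ### The `L²` bound for the local maximal function of a piece -/

lemma sq_lintegral_le {α : Type*} [MeasurableSpace α] {μ : Measure α} {f : α → ℝ≥0∞}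
    (hf : AEMeasurable f μ) : (∫⁻ x, f x ∂μ) ^ 2 ≤ μ univ * ∫⁻ x, f x ^ 2 ∂μ := by
  have h := ENNReal.lintegral_mul_le_Lp_mul_Lq μ Real.HolderConjugate.two_two
    (f := fun _ => (1 : ℝ≥0∞)) aemeasurable_const hf
  simp only [Pi.mul_apply, one_mul, ENNReal.one_rpow, lintegral_const] at h
  calc (∫⁻ x, f x ∂μ) ^ 2 ≤ (μ univ ^ (1 / (2 : ℝ)) *
        (∫⁻ x, f x ^ (2 : ℝ) ∂μ) ^ (1 / (2 : ℝ))) ^ 2 := by gcongr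
    _ = _ := by
      rw [mul_pow, ← ENNReal.rpow_natCast, ← ENNReal.rpow_natCast, ← ENNReal.rpow_mul,
        ← ENNReal.rpow_mul]
      norm_num

lemma ENNReal_add_sq_le (a b : ℝ≥0∞) : (a + b) ^ 2 ≤ 4 * (a ^ 2 + b ^ 2) := by
  have h : a + b ≤ 2 * max a b := by
    rw [two_mul]; exact add_le_add (le_max_left _ _) (le_max_right _ _)
  calc (a + b) ^ 2 ≤ (2 * max a b) ^ 2 := by gcongr
    _ = 4 * max a b ^ 2 := by rw [mul_pow]; norm_num
    _ ≤ _ := by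
      gcongr
      rcases max_cases a b with h | h <;> rw [h.1]
      · exact le_self_add
      · exact le_add_self

lemma iSup_sq_le {ι : Type*} {T : Set ι} {a : ι → ℝ≥0∞} {B : ℝ≥0∞} (h : ∀ t ∈ T, a t ^ 2 ≤ B) :
    (⨆ t ∈ T, a t) ^ 2 ≤ B := by
  have key : ∀ c : ℝ≥0∞, c ^ 2 ≤ B ↔ c ≤ B ^ ((2 : ℝ)⁻¹) := fun c => by
    rw [ENNReal.le_rpow_inv_iff (by norm_num), ENNReal.rpow_ofNat]
  rw [key]
  exact iSup₂_le fun t ht => (key _).1 (h t ht)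

variable {d : ℕ} [NeZero d]

lemma lintegral_enorm_sq_fourier_schwartz (f : 𝓢(EuclideanSpace ℝ (Fin d), ℂ)) :
    ∫⁻ ξ, ‖𝓕 (f : EuclideanSpace ℝ (Fin d) → ℂ) ξ‖ₑ ^ 2 = ∫⁻ x, ‖f x‖ₑ ^ 2 := by
  have hp := eLpNorm_fourier_eq f.integrable (f.memLp 2)
  simp only [eLpNorm_eq_lintegral_rpow_enorm_toReal (p := 2) (by norm_num) (by norm_num)] at hp
  have := ENNReal.rpow_left_injective (x := 1 / (2 : ℝ≥0∞).toReal) (by norm_num) hp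
  simpa only [ENNReal.toReal_ofNat, ENNReal.rpow_ofNat] using this

/-- On the `j`th band, functions with the decay of the Fourier transform of the sphere measure
have size `2 ^ (-j (d - 1) / 2)`. -/
lemma band_mul_sq_le {v : ℝ → ℝ} {C : ℝ} (hC : 0 ≤ C)
    (hv : ∀ r, 0 ≤ r → (1 + r) ^ (d - 1) * v r ^ 2 ≤ C)
    (j : ℕ) {s : ℝ} (hs : 1 ≤ s) (ξ : EuclideanSpace ℝ (Fin d)) :
    (band j ξ * v (2 * Real.pi * s * ‖ξ‖)) ^ 2 ≤ 2 ^ (d - 1) * C * ((2 ^ j) ^ (d - 1))⁻¹ := by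
  by_cases hb : band j ξ = 0
  · rw [hb]; simp; positivity
  · set r := 2 * Real.pi * s * ‖ξ‖
    have hr : ‖ξ‖ ≤ r := by
      refine le_mul_of_one_le_left (norm_nonneg _) ?_
      nlinarith [Real.pi_gt_three]
    have hr0 : 0 ≤ r := (norm_nonneg _).trans hr
    have h1 : ((2 : ℝ) ^ j) ^ (d - 1) ≤ 2 ^ (d - 1) * (1 + r) ^ (d - 1) := by
      rw [← mul_pow]
      gcongr
      exact (le_norm_of_band_ne_zero hb).trans (by linarith)
    have h2 : band j ξ ^ 2 ≤ 1 := by rw [sq_le_one_iff_abs_le_one]; exact abs_band_le_one j ξ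
    rw [← div_eq_mul_inv, le_div_iff₀ (by positivity), mul_pow]
    calc band j ξ ^ 2 * v r ^ 2 * (2 ^ j) ^ (d - 1)
        ≤ 1 * v r ^ 2 * (2 ^ (d - 1) * (1 + r) ^ (d - 1)) := by gcongr
      _ = 2 ^ (d - 1) * ((1 + r) ^ (d - 1) * v r ^ 2) := by ring
      _ ≤ _ := by gcongr; exact hv r hr0

lemma memLp_two_of_le_fourier {h : EuclideanSpace ℝ (Fin d) → ℂ}
    (f : 𝓢(EuclideanSpace ℝ (Fin d), ℂ)) (hc : Continuous h) {K : ℝ}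
    (hK : ∀ ξ, ‖h ξ‖ ≤ K * ‖𝓕 (f : EuclideanSpace ℝ (Fin d) → ℂ) ξ‖) :
    Integrable h ∧ MemLp h 2 := by
  constructor
  · refine ((integrable_fourier_schwartz f).norm.const_mul K).mono' hc.aestronglyMeasurable
      (.of_forall hK)
  · have h2 : MemLp (𝓕 (f : EuclideanSpace ℝ (Fin d) → ℂ)) 2 := by
      rw [← SchwartzMap.fourier_coe]; exact (𝓕 f).memLp 2
    exact h2.of_le_mul hc.aestronglyMeasurable (.of_forall hK)

/-- The derivative in `t` of the spherical means of a piece. -/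
def pieceDeriv (j : ℕ) (f : 𝓢(EuclideanSpace ℝ (Fin d), ℂ)) (t : ℝ) :
    EuclideanSpace ℝ (Fin d) → ℂ :=
  𝓕⁻ (fun ξ => (2 * Real.pi * ‖ξ‖ : ℝ) * ((band j ξ : ℂ) *
    𝓕 (f : EuclideanSpace ℝ (Fin d) → ℂ) ξ) *
      ((-sphereSin d (2 * Real.pi * t * ‖ξ‖) : ℝ) : ℂ))

lemma norm_mul_band_le (j : ℕ) (ξ : EuclideanSpace ℝ (Fin d)) :
    2 * Real.pi * ‖ξ‖ * |band j ξ| ≤ 4 * Real.pi * 2 ^ j := by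
  by_cases hb : band j ξ = 0
  · rw [hb]; simp; positivity
  · have h1 := norm_le_of_band_ne_zero hb
    have h2 := abs_band_le_one j ξ
    calc 2 * Real.pi * ‖ξ‖ * |band j ξ| ≤ 2 * Real.pi * (2 * 2 ^ j) * 1 := by gcongr
      _ = _ := by ring

lemma norm_mul_band_mul_fourier_le (j : ℕ) (f : 𝓢(EuclideanSpace ℝ (Fin d), ℂ))
    (ξ : EuclideanSpace ℝ (Fin d)) :
    ‖((2 * Real.pi * ‖ξ‖ : ℝ) : ℂ) * ((band j ξ : ℂ) * 𝓕 (f : EuclideanSpace ℝ (Fin d) → ℂ) ξ)‖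
      ≤ 4 * Real.pi * 2 ^ j * ‖𝓕 (f : EuclideanSpace ℝ (Fin d) → ℂ) ξ‖ := by
  rw [← mul_assoc, norm_mul, norm_mul, Complex.norm_real, Complex.norm_real,
    Real.norm_of_nonneg (by positivity)]
  exact mul_le_mul_of_nonneg_right (norm_mul_band_le j ξ) (norm_nonneg _)

lemma integrable_norm_mul_band_mul_fourier (j : ℕ) (f : 𝓢(EuclideanSpace ℝ (Fin d), ℂ)) :
    Integrable fun ξ : EuclideanSpace ℝ (Fin d) => ((2 * Real.pi * ‖ξ‖ : ℝ) : ℂ) *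
      ((band j ξ : ℂ) * 𝓕 (f : EuclideanSpace ℝ (Fin d) → ℂ) ξ) := by
  have h1 := continuous_fourier_schwartz f
  have h2 := continuous_band (d := d) j
  exact (memLp_two_of_le_fourier f (by fun_prop) (norm_mul_band_mul_fourier_le j f)).1

/-- The spherical means of a piece, on the Fourier side. -/
def pieceMean (j : ℕ) (f : 𝓢(EuclideanSpace ℝ (Fin d), ℂ)) (t : ℝ) :
    EuclideanSpace ℝ (Fin d) → ℂ :=
  𝓕⁻ (fun ξ => (band j ξ : ℂ) * 𝓕 (f : EuclideanSpace ℝ (Fin d) → ℂ) ξ *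
      (sphereCos d (2 * Real.pi * t * ‖ξ‖) : ℂ))

lemma sphericalMean_piece (j : ℕ) (f : 𝓢(EuclideanSpace ℝ (Fin d), ℂ)) {t : ℝ} (ht : 0 ≤ t)
    (x : EuclideanSpace ℝ (Fin d)) : sphericalMean t (piece j f) x = pieceMean j f t x :=
  sphericalMean_fourierInv (integrable_band_mul_fourier j f) ht x

lemma continuous_pieceMean (j : ℕ) (f : 𝓢(EuclideanSpace ℝ (Fin d), ℂ)) (t : ℝ) :
    Continuous (pieceMean j f t) :=
  continuous_fourierInv (integrable_mul_sphereCos (integrable_band_mul_fourier j f) t)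

lemma hasDerivAt_pieceMean (j : ℕ) (f : 𝓢(EuclideanSpace ℝ (Fin d), ℂ))
    (x : EuclideanSpace ℝ (Fin d)) (t : ℝ) :
    HasDerivAt (fun t => pieceMean j f t x) (pieceDeriv j f t x) t :=
  hasDerivAt_fourierInv_mul_sphereCos (integrable_band_mul_fourier j f)
    (integrable_norm_mul_band_mul_fourier j f) x t

lemma continuous_pieceDeriv (j : ℕ) (f : 𝓢(EuclideanSpace ℝ (Fin d), ℂ)) :
    Continuous fun p : ℝ × EuclideanSpace ℝ (Fin d) => pieceDeriv j f p.1 p.2 := by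
  have h1 := continuous_fourier_schwartz f
  have h2 := continuous_band (d := d) j
  have h3 := continuous_sphereSin (d := d)
  simp only [pieceDeriv, Real.fourierInv_eq']
  refine continuous_of_dominated (fun p => ?_) (fun p => .of_forall fun ξ => ?_)
    (integrable_norm_mul_band_mul_fourier j f).norm (.of_forall fun ξ => ?_)
  · exact Continuous.aestronglyMeasurable (by fun_prop)
  · rw [norm_smul, Complex.norm_exp_ofReal_mul_I, one_mul, norm_mul]
    refine mul_le_of_le_one_right (norm_nonneg _) ?_
    rw [Complex.norm_real, norm_neg]
    exact abs_sphereSin_le_one _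
  · fun_prop

/-- The supremum over an interval of radii is controlled by the value at the left end and the
integral of the derivative in `t`; Cauchy–Schwarz on an interval of length `δ` produces the factor
`δ`. -/
lemma enorm_sphericalMean_piece_sq_le (j : ℕ) (f : 𝓢(EuclideanSpace ℝ (Fin d), ℂ)) {s δ t : ℝ}
    (hs : 0 ≤ s) (ht : t ∈ Icc s (s + δ)) (x : EuclideanSpace ℝ (Fin d)) :
    ‖sphericalMean t (piece j f) x‖ₑ ^ 2 ≤ 4 * (‖sphericalMean s (piece j f) x‖ₑ ^ 2 +
      ENNReal.ofReal δ * ∫⁻ r in Icc s (s + δ), ‖pieceDeriv j f r x‖ₑ ^ 2) := by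
  have hcont : Continuous fun r => pieceDeriv j f r x :=
    Continuous.comp (g := fun p : ℝ × EuclideanSpace ℝ (Fin d) => pieceDeriv j f p.1 p.2)
      (f := fun r : ℝ => (r, x)) (continuous_pieceDeriv j f) (by fun_prop)
  have hftc := intervalIntegral.integral_eq_sub_of_hasDerivAt
    (fun r _ => hasDerivAt_pieceMean j f x r) (hcont.intervalIntegrable s t)
  rw [← sphericalMean_piece j f hs, ← sphericalMean_piece j f (hs.trans ht.1)] at hftc
  have h1 : ‖sphericalMean t (piece j f) x‖ₑ ≤ ‖sphericalMean s (piece j f) x‖ₑ +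
      ∫⁻ r in Icc s (s + δ), ‖pieceDeriv j f r x‖ₑ := by
    have e : sphericalMean t (piece j f) x = sphericalMean s (piece j f) x +
      ∫ r in s..t, pieceDeriv j f r x := by
      rw [hftc]; ring
    rw [e]
    refine (enorm_add_le _ _).trans (add_le_add le_rfl ?_)
    rw [intervalIntegral.integral_of_le ht.1]
    refine (enorm_integral_le_lintegral_enorm _).trans (lintegral_mono_set ?_)
    exact fun r hr => ⟨hr.1.le, hr.2.trans ht.2⟩
  calc _ ≤ (‖sphericalMean s (piece j f) x‖ₑ +
      ∫⁻ r in Icc s (s + δ), ‖pieceDeriv j f r x‖ₑ) ^ 2 := by gcongr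
    _ ≤ _ := ENNReal_add_sq_le _ _
    _ ≤ _ := by
      gcongr
      refine (sq_lintegral_le hcont.measurable.enorm.aemeasurable).trans_eq ?_
      rw [Measure.restrict_apply_univ, Real.volume_Icc, add_sub_cancel_left]

lemma lintegral_enorm_sq_fourierInv_le {h : EuclideanSpace ℝ (Fin d) → ℂ}
    (f : 𝓢(EuclideanSpace ℝ (Fin d), ℂ)) (hc : Continuous h) {K : ℝ}
    (hK : ∀ ξ, ‖h ξ‖ ^ 2 ≤ K * ‖𝓕 (f : EuclideanSpace ℝ (Fin d) → ℂ) ξ‖ ^ 2) :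
    ∫⁻ x, ‖𝓕⁻ h x‖ₑ ^ 2 ≤ ENNReal.ofReal K * ∫⁻ x, ‖f x‖ₑ ^ 2 := by
  have hK' : ∀ ξ, ‖h ξ‖ ≤ √K * ‖𝓕 (f : EuclideanSpace ℝ (Fin d) → ℂ) ξ‖ := fun ξ => by
    have := Real.sqrt_le_sqrt (hK ξ)
    rwa [Real.sqrt_sq (norm_nonneg _), Real.sqrt_mul' _ (sq_nonneg _),
      Real.sqrt_sq (norm_nonneg _)] at this
  obtain ⟨i1, i2⟩ := memLp_two_of_le_fourier f hc hK'
  rw [lintegral_enorm_sq_fourierInv i1 i2, ← lintegral_enorm_sq_fourier_schwartz f,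
    ← lintegral_const_mul' _ _ (by simp)]
  refine lintegral_mono fun ξ => ?_
  rw [← ofReal_norm, ← ofReal_norm, ← ENNReal.ofReal_pow (norm_nonneg _),
    ← ENNReal.ofReal_pow (norm_nonneg _), ← ENNReal.ofReal_mul' (sq_nonneg _)]
  exact ENNReal.ofReal_le_ofReal (hK ξ)

/-- The `L²` bound for the local maximal function of a piece. -/
lemma exists_lintegral_iSup_piece_sq_le (d : ℕ) [NeZero d] :
    ∃ C : ℝ, 0 ≤ C ∧ ∀ (j : ℕ) (f : 𝓢(EuclideanSpace ℝ (Fin d), ℂ)) (s : ℝ) (T : Set ℝ),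
      1 ≤ s → T ⊆ Icc s (s + ((2 : ℝ) ^ j)⁻¹) →
      ∫⁻ x, (⨆ t ∈ T, ‖sphericalMean t (piece j f) x‖ₑ) ^ 2 ≤
        ENNReal.ofReal (C * ((2 ^ j) ^ (d - 1))⁻¹) * ∫⁻ z, ‖f z‖ₑ ^ 2 := by
  obtain ⟨C₀, hC1, hC⟩ := exists_sphereCos_decay d
  have hC0 : 0 ≤ C₀ := by linarith
  set K₀ := 2 ^ (d - 1) * C₀
  refine ⟨4 * (1 + (4 * Real.pi) ^ 2) * K₀, by positivity, fun j f s T hs hT => ?_⟩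
  set δ := ((2 : ℝ) ^ j)⁻¹
  set K := K₀ * (((2 : ℝ) ^ j) ^ (d - 1))⁻¹
  have hδ : 0 < δ := by positivity
  have hK0 : 0 ≤ K := by positivity
  have h1 := continuous_fourier_schwartz f
  have h2 := continuous_band (d := d) j
  have h3 := continuous_sphereSin (d := d)
  have h4 := continuous_sphereCos (d := d)
  have b1 : ∫⁻ x, ‖sphericalMean s (piece j f) x‖ₑ ^ 2 ≤
      ENNReal.ofReal K * ∫⁻ x, ‖f x‖ₑ ^ 2 := by
    simp only [piece, sphericalMean_fourierInv (integrable_band_mul_fourier j f)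
      (by linarith : 0 ≤ s)]
    refine lintegral_enorm_sq_fourierInv_le f (by fun_prop) fun ξ => ?_
    have := band_mul_sq_le hC0 (fun r hr => (hC r hr).1) j hs ξ
    rw [mul_right_comm, norm_mul, mul_pow, ← Complex.ofReal_mul, Complex.norm_real, Real.norm_eq_abs, sq_abs]
    gcongr
  -- The derivative in `t` brings down `2π‖ξ‖`, at most `4π 2^j` on the band, and replaces the
  -- profile by its derivative, which decays at the same rate.
  have b2 : ∀ r, 1 ≤ r → ∫⁻ x, ‖pieceDeriv j f r x‖ₑ ^ 2 ≤
      ENNReal.ofReal ((4 * Real.pi * 2 ^ j) ^ 2 * K) * ∫⁻ x, ‖f x‖ₑ ^ 2 := fun r hr => by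
    refine lintegral_enorm_sq_fourierInv_le f (by fun_prop) fun ξ => ?_
    by_cases hb : band j ξ = 0
    · simp only [hb]; simp; positivity
    have hn := norm_le_of_band_ne_zero hb
    have := band_mul_sq_le hC0 (fun r hr => (hC r hr).2) j hr ξ
    have e : ((2 * Real.pi * ‖ξ‖ : ℝ) : ℂ) * ((band j ξ : ℂ) *
        𝓕 (f : EuclideanSpace ℝ (Fin d) → ℂ) ξ) *
        ((-sphereSin d (2 * Real.pi * r * ‖ξ‖) : ℝ) : ℂ) =
        ((-(2 * Real.pi * ‖ξ‖ * (band j ξ * sphereSin d (2 * Real.pi * r * ‖ξ‖))) : ℝ) : ℂ) *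
        𝓕 (f : EuclideanSpace ℝ (Fin d) → ℂ) ξ := by push_cast; ring
    rw [e, norm_mul, mul_pow, Complex.norm_real, norm_neg, Real.norm_eq_abs, sq_abs, mul_pow]
    gcongr ?_ ^ 2 * ?_ * _
    calc 2 * Real.pi * ‖ξ‖ ≤ 2 * Real.pi * (2 * 2 ^ j) := by gcongr
      _ = _ := by ring
  calc ∫⁻ x, (⨆ t ∈ T, ‖sphericalMean t (piece j f) x‖ₑ) ^ 2
      ≤ ∫⁻ x, 4 * (‖sphericalMean s (piece j f) x‖ₑ ^ 2 +
        ENNReal.ofReal δ * ∫⁻ r in Icc s (s + δ), ‖pieceDeriv j f r x‖ₑ ^ 2) := by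
        refine lintegral_mono fun x => ?_
        exact iSup_sq_le fun t ht =>
          enorm_sphericalMean_piece_sq_le j f (by linarith) (hT ht) x
    _ = 4 * ((∫⁻ x, ‖sphericalMean s (piece j f) x‖ₑ ^ 2) +
        ENNReal.ofReal δ * ∫⁻ r in Icc s (s + δ), ∫⁻ x, ‖pieceDeriv j f r x‖ₑ ^ 2) := by
        rw [lintegral_const_mul' _ _ (by simp), lintegral_add_left,
          lintegral_const_mul' _ _ (by simp), lintegral_lintegral_swap]
        · exact (((continuous_pieceDeriv j f).comp continuous_swap).measurable.enorm.pow_const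
            2).aemeasurable
        · have : Continuous (sphericalMean s (piece j f)) := by
            rw [funext (sphericalMean_piece j f (by linarith : 0 ≤ s))]
            exact continuous_pieceMean j f s
          exact this.measurable.enorm.pow_const 2
    _ ≤ 4 * (ENNReal.ofReal K * (∫⁻ x, ‖f x‖ₑ ^ 2) +
        ENNReal.ofReal δ * (ENNReal.ofReal ((4 * Real.pi * 2 ^ j) ^ 2 * K) * (∫⁻ x, ‖f x‖ₑ ^ 2) *
          ENNReal.ofReal δ)) := by
        gcongr
        refine (setLIntegral_mono' measurableSet_Icc fun r hr => b2 r (hs.trans hr.1)).trans ?_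
        rw [setLIntegral_const, Real.volume_Icc, add_sub_cancel_left]
    _ = _ := by
        -- The two factors `δ = 2^(-j)` cancel the loss `2^(2j)` of the derivative, so both terms
        -- have the same size.
        have e : 4 * (1 + (4 * Real.pi) ^ 2) * K₀ * ((2 ^ j) ^ (d - 1))⁻¹ =
            4 * (K + δ * ((4 * Real.pi * 2 ^ j) ^ 2 * K) * δ) := by
          have : δ * 2 ^ j = 1 := inv_mul_cancel₀ (by positivity)
          have h5 : δ * ((4 * Real.pi * 2 ^ j) ^ 2 * K) * δ =
            (4 * Real.pi) ^ 2 * K * (δ * 2 ^ j) ^ 2 := by ring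
          rw [h5, this]
          simp only [K]; ring
        have e2 : ENNReal.ofReal (4 * (K + δ * ((4 * Real.pi * 2 ^ j) ^ 2 * K) * δ)) =
            4 * (ENNReal.ofReal K + ENNReal.ofReal δ *
              ENNReal.ofReal ((4 * Real.pi * 2 ^ j) ^ 2 * K) * ENNReal.ofReal δ) := by
          rw [ENNReal.ofReal_mul (by norm_num), ENNReal.ofReal_add hK0 (by positivity),
            ENNReal.ofReal_mul' hδ.le, ENNReal.ofReal_mul hδ.le, ENNReal.ofReal_ofNat]
        rw [e, e2]
        ring

end SphericalMax

end

set_option linter.unusedSectionVars false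

noncomputable section

namespace SphericalMax

open Metric Set
open scoped FourierTransform SchwartzMap ContDiff

/-! ### The kernel of the composition of two pieces of spherical means -/

variable {d : ℕ} [NeZero d]

/-- The inverse transform of a radial function is radial, hence equals its own mean over the sphere
of radius `‖v‖` about the origin, and spherical means act as multipliers. -/
lemma fourierInv_radial {m : EuclideanSpace ℝ (Fin d) → ℂ} (hm : Integrable m)
    (hrad : ∀ ξ η : EuclideanSpace ℝ (Fin d), ‖ξ‖ = ‖η‖ → m ξ = m η)
    (v : EuclideanSpace ℝ (Fin d)) :
    𝓕⁻ m v = ∫ ξ, m ξ * (sphereCos d (2 * Real.pi * ‖v‖ * ‖ξ‖) : ℂ) := by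
  have hinv : ∀ v w : EuclideanSpace ℝ (Fin d), ‖v‖ = ‖w‖ → 𝓕⁻ m v = 𝓕⁻ m w := fun v w h => by
    obtain ⟨L, hL⟩ := exists_isometry_apply_eq h
    have h1 := Real.fourierInv_comp_linearIsometry L m v
    have h2 : m ∘ L = m := funext fun ξ => hrad _ _ (by simp)
    rw [h2, hL] at h1
    exact h1
  have h1 := sphericalMean_fourierInv hm (norm_nonneg v) 0
  have h2 : sphericalMean ‖v‖ (𝓕⁻ m) 0 = 𝓕⁻ m v := by
    unfold sphericalMean
    have : ∀ y : sphere (0 : EuclideanSpace ℝ (Fin d)) 1,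
        𝓕⁻ m (0 - ‖v‖ • (y : EuclideanSpace ℝ (Fin d))) = 𝓕⁻ m v := fun y =>
      hinv _ _ (by simp [norm_smul])
    simp only [this, integral_const, probReal_univ, one_smul]
  rw [← h2, h1, Real.fourierInv_eq']
  simp

/-- The multiplier of the composition of the `j`th pieces of two spherical means. -/
def pairMultiplier (j : ℕ) (s t : ℝ) (ξ : EuclideanSpace ℝ (Fin d)) : ℂ :=
  (band j ξ : ℂ) ^ 2 * (sphereCos d (2 * Real.pi * t * ‖ξ‖) : ℂ) *
    (sphereCos d (2 * Real.pi * s * ‖ξ‖) : ℂ)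

lemma integrable_band_sq (j : ℕ) :
    Integrable fun ξ : EuclideanSpace ℝ (Fin d) => (band j ξ : ℂ) ^ 2 := by
  have := (integrable_band (d := d) j).bdd_mul (c := 1)
    (Complex.continuous_ofReal.comp (continuous_band j)).aestronglyMeasurable
    (.of_forall fun ξ => by
      rw [Function.comp_apply, Complex.norm_real]; exact abs_band_le_one j ξ)
  simpa [sq] using this

lemma integrable_pairMultiplier (j : ℕ) (s t : ℝ) : Integrable (pairMultiplier (d := d) j s t) :=
  integrable_mul_sphereCos (integrable_mul_sphereCos (integrable_band_sq j) t) s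

lemma pairMultiplier_radial (j : ℕ) (s t : ℝ) {ξ η : EuclideanSpace ℝ (Fin d)} (h : ‖ξ‖ = ‖η‖) :
    pairMultiplier j s t ξ = pairMultiplier j s t η := by
  simp only [pairMultiplier, band_congr_norm j h, h]

/-- By radiality a third Bessel-type factor `sphereCos d (2π‖v‖‖ξ‖)` appears. It gives the decay in
`2^j ‖v‖`, hence in `2^j |s - t|`; the first two factors give `2^(-j(d-1))`, and the volume of the
band gives `2^(jd)`. -/
lemma exists_pairMultiplier_far (d : ℕ) [NeZero d] :
    ∃ C : ℝ, 0 ≤ C ∧ ∀ (j : ℕ) (s t : ℝ), s ∈ Icc (1 : ℝ) 2 → t ∈ Icc (1 : ℝ) 2 →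
      ∀ v : EuclideanSpace ℝ (Fin d), |s - t| ≤ 2 * ‖v‖ →
      ‖𝓕⁻ (pairMultiplier j s t) v‖ ≤ C * (2 ^ j * (√((1 + 2 ^ j * |s - t|) ^ (d - 1)))⁻¹) := by
  obtain ⟨C₀, hC1, hC⟩ := exists_sphereCos_decay d
  have hC0 : 0 ≤ C₀ := by linarith
  set V := (volume : Measure (EuclideanSpace ℝ (Fin d))).real (closedBall 0 1)
  refine ⟨2 ^ (d - 1) * C₀ * √(3 ^ (d - 1) * C₀) * (2 ^ d * V), by positivity,
    fun j s t hs ht v hv => ?_⟩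
  rw [fourierInv_radial (integrable_pairMultiplier j s t)
    (fun ξ η h => pairMultiplier_radial j s t h)]
  set κ := 2 ^ j * |s - t|
  have hκ0 : 0 ≤ κ := by positivity
  set D := (√((1 + κ) ^ (d - 1)))⁻¹
  set B := 2 ^ (d - 1) * C₀ * ((2 ^ j) ^ (d - 1))⁻¹ * (√(3 ^ (d - 1) * C₀) * D) with hB
  have hst : |s - t| ≤ 1 := by
    rw [abs_le]; constructor <;> linarith [hs.1, hs.2, ht.1, ht.2]
  have hpt : ∀ ξ : EuclideanSpace ℝ (Fin d), ‖pairMultiplier j s t ξ *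
      (sphereCos d (2 * Real.pi * ‖v‖ * ‖ξ‖) : ℂ)‖ ≤
      (closedBall (0 : EuclideanSpace ℝ (Fin d)) (2 * 2 ^ j)).indicator (fun _ => B) ξ := by
    intro ξ
    by_cases hb : band j ξ = 0
    · rw [pairMultiplier, hb]
      simp only [Complex.ofReal_zero, ne_eq, OfNat.ofNat_ne_zero, not_false_eq_true, zero_pow,
        zero_mul, norm_zero]
      exact indicator_nonneg (fun _ _ => by positivity) _
    · rw [indicator_of_mem (by rw [mem_closedBall_zero_iff]; exact norm_le_of_band_ne_zero hb)]
      have h1 := band_mul_sq_le hC0 (fun r hr => (hC r hr).1) j hs.1 ξ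
      have h2 := band_mul_sq_le hC0 (fun r hr => (hC r hr).1) j ht.1 ξ
      set a := band j ξ * sphereCos d (2 * Real.pi * s * ‖ξ‖)
      set b := band j ξ * sphereCos d (2 * Real.pi * t * ‖ξ‖)
      have hab : |a * b| ≤ 2 ^ (d - 1) * C₀ * ((2 ^ j) ^ (d - 1))⁻¹ := by
        rw [abs_le]; constructor <;> nlinarith [sq_nonneg (a - b), sq_nonneg (a + b)]
      set ρ := 2 * Real.pi * ‖v‖ * ‖ξ‖
      have hρ : 0 ≤ ρ := by positivity
      have hu : |sphereCos d ρ| ≤ √(3 ^ (d - 1) * C₀) * D := by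
        -- On the band `2^j ≤ 2(1 + ‖ξ‖)`. With `|s - t| ≤ 1` and `|s - t| ≤ 2‖v‖` this gives `κ ≤ 2
        -- + 4‖v‖‖ξ‖ ≤ 2 + ρ`.
        have h3 : 1 + κ ≤ 3 * (1 + ρ) := by
          have h4 : κ ≤ 2 * (1 + ‖ξ‖) * |s - t| := by
            simp only [κ]; gcongr; exact le_norm_of_band_ne_zero hb
          have h5 : ‖ξ‖ * |s - t| ≤ ‖ξ‖ * (2 * ‖v‖) := by gcongr
          have h6 : 4 * (‖v‖ * ‖ξ‖) ≤ ρ := by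
            have : 0 ≤ ‖v‖ * ‖ξ‖ := by positivity
            simp only [ρ]; nlinarith [Real.pi_gt_three]
          nlinarith
        have h7 : (1 + κ) ^ (d - 1) * sphereCos d ρ ^ 2 ≤ 3 ^ (d - 1) * C₀ := by
          calc (1 + κ) ^ (d - 1) * sphereCos d ρ ^ 2
              ≤ (3 * (1 + ρ)) ^ (d - 1) * sphereCos d ρ ^ 2 := by gcongr
            _ = 3 ^ (d - 1) * ((1 + ρ) ^ (d - 1) * sphereCos d ρ ^ 2) := by rw [mul_pow]; ring
            _ ≤ _ := by gcongr; exact (hC ρ hρ).1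
        have h8 := Real.sqrt_le_sqrt h7
        rw [Real.sqrt_mul (by positivity), Real.sqrt_sq_eq_abs] at h8
        simp only [D]
        rw [← div_eq_mul_inv, le_div_iff₀ (by positivity), mul_comm]
        exact h8
      have e : pairMultiplier j s t ξ * (sphereCos d ρ : ℂ) =
          ((a * b * sphereCos d ρ : ℝ) : ℂ) := by
        simp only [pairMultiplier, a, b]; push_cast; ring
      rw [e, Complex.norm_real, Real.norm_eq_abs, abs_mul, hB]
      gcongr
  refine (norm_integral_le_of_norm_le ?_ (.of_forall hpt)).trans_eq ?_
  · exact (integrable_indicator_iff measurableSet_closedBall).2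
      (integrableOn_const (measure_closedBall_lt_top).ne)
  · rw [integral_indicator measurableSet_closedBall, setIntegral_const, smul_eq_mul,
      Measure.addHaar_real_closedBall _ _ (by positivity), finrank_euclideanSpace_fin, hB]
    have hd : (2 : ℝ) ^ j = (2 ^ j) ^ d * ((2 ^ j) ^ (d - 1))⁻¹ := by
      rw [eq_mul_inv_iff_mul_eq₀ (by positivity), ← pow_succ', Nat.sub_add_cancel NeZero.one_le]
    have hball : (volume : Measure (EuclideanSpace ℝ (Fin d))).real (ball 0 1) = V := by
      simp only [V]; rw [Measure.addHaar_real_closedBall_eq_addHaar_real_ball]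
    rw [hball]
    calc _ = 2 ^ (d - 1) * C₀ * √(3 ^ (d - 1) * C₀) * (2 ^ d * V) *
          (((2 ^ j) ^ d * ((2 ^ j) ^ (d - 1))⁻¹) * D) := by rw [mul_pow]; ring
      _ = _ := by rw [← hd]

/-- The kernel is an iterated spherical mean of a function concentrated at scale `2^(-j)` about the
origin. It is evaluated at points `v - s y - t z`, whose norm is at least `|s - t| - ‖v‖ ≥ |s - t| /
2`, so the rapid decay of that function suffices. -/
lemma exists_pairMultiplier_near (d : ℕ) [NeZero d] :
    ∃ C : ℝ, 0 ≤ C ∧ ∀ (j : ℕ) (s t : ℝ), s ∈ Icc (1 : ℝ) 2 → t ∈ Icc (1 : ℝ) 2 →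
      ∀ v : EuclideanSpace ℝ (Fin d), 2 * ‖v‖ ≤ |s - t| →
      ‖𝓕⁻ (pairMultiplier j s t) v‖ ≤ C * (2 ^ j * (√((1 + 2 ^ j * |s - t|) ^ (d - 1)))⁻¹) := by
  -- Of the `d + (d + 1)` powers, `d` are spent on the decay in `|s - t|` and `d + 1` recover the
  -- bump `weight`.
  obtain ⟨C₁, hC10, hC₁⟩ := exists_fourierInv_band_pow_le d 2 (d + (d + 1)) two_ne_zero
  obtain ⟨C₂, hC₂⟩ := exists_avgWeight_le d
  refine ⟨C₁ * 2 ^ d * C₂, by positivity, fun j s t hs ht v hv => ?_⟩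
  set κ := 2 ^ j * |s - t|
  have hκ0 : 0 ≤ κ := by positivity
  have hs0 : 0 ≤ s := by linarith [hs.1]
  have ht0 : 0 ≤ t := by linarith [ht.1]
  set Ψ : EuclideanSpace ℝ (Fin d) → ℂ := 𝓕⁻ (fun ξ => (band j ξ : ℂ) ^ 2)
  have e1 : sphericalMean t Ψ = _ := funext fun x =>
    sphericalMean_fourierInv (integrable_band_sq j) ht0 x
  have e2 : 𝓕⁻ (pairMultiplier j s t) v = sphericalMean s (sphericalMean t Ψ) v := by
    rw [e1, sphericalMean_fourierInv (integrable_mul_sphereCos (integrable_band_sq j) t) hs0]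
    rfl
  set A := C₁ * 2 ^ d * ((1 + κ) ^ d)⁻¹
  have hA : 0 ≤ A := by positivity
  have hpt : ∀ y z : sphere (0 : EuclideanSpace ℝ (Fin d)) 1,
      ‖Ψ (v - s • (y : EuclideanSpace ℝ (Fin d)) - t • (z : EuclideanSpace ℝ (Fin d)))‖ₑ ≤
      ENNReal.ofReal A * ENNReal.ofReal
        (weight j (v - s • (y : EuclideanSpace ℝ (Fin d)) - t • (z : EuclideanSpace ℝ (Fin d)))) := by
    intro y z
    set w := v - s • (y : EuclideanSpace ℝ (Fin d)) - t • (z : EuclideanSpace ℝ (Fin d)) with hw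
    have h1 : |s - t| ≤ ‖s • (y : EuclideanSpace ℝ (Fin d)) + t • (z : EuclideanSpace ℝ (Fin d))‖ := by
      have h2 := abs_norm_sub_norm_le (s • (y : EuclideanSpace ℝ (Fin d)))
        (-(t • (z : EuclideanSpace ℝ (Fin d))))
      rw [sub_neg_eq_add, norm_neg, norm_smul, norm_smul] at h2
      simpa [abs_of_nonneg hs0, abs_of_nonneg ht0] using h2
    have h3 : ‖s • (y : EuclideanSpace ℝ (Fin d)) + t • (z : EuclideanSpace ℝ (Fin d))‖ ≤
        ‖v‖ + ‖w‖ := by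
      have : s • (y : EuclideanSpace ℝ (Fin d)) + t • (z : EuclideanSpace ℝ (Fin d)) = v - w := by
        rw [hw]; abel
      rw [this]; exact norm_sub_le _ _
    have h4 : |s - t| ≤ 2 * ‖w‖ := by linarith
    have h5 : 1 + κ ≤ 2 * (1 + 2 ^ j * ‖w‖) := by
      have : κ ≤ 2 ^ j * (2 * ‖w‖) := by simp only [κ]; gcongr
      linarith
    rw [← ofReal_norm, ← ENNReal.ofReal_mul hA]
    refine ENNReal.ofReal_le_ofReal ((hC₁ j w).trans ?_)
    have h6 : ((1 + 2 ^ j * ‖w‖) ^ d)⁻¹ ≤ 2 ^ d * ((1 + κ) ^ d)⁻¹ := by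
      rw [← div_eq_mul_inv, inv_eq_one_div, div_le_div_iff₀ (by positivity) (by positivity),
        one_mul, ← mul_pow]
      gcongr
    simp only [weight, A]
    rw [pow_add _ d (d + 1), mul_inv]
    calc C₁ * ((2 ^ j) ^ d * (((1 + 2 ^ j * ‖w‖) ^ d)⁻¹ * ((1 + 2 ^ j * ‖w‖) ^ (d + 1))⁻¹))
        ≤ C₁ * ((2 ^ j) ^ d * ((2 ^ d * ((1 + κ) ^ d)⁻¹) * ((1 + 2 ^ j * ‖w‖) ^ (d + 1))⁻¹)) := by
          gcongr
      _ = _ := by ring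
  have hmain : ‖𝓕⁻ (pairMultiplier j s t) v‖ₑ ≤ ENNReal.ofReal A * (C₂ * 2 ^ j) := by
    rw [e2]
    calc ‖sphericalMean s (sphericalMean t Ψ) v‖ₑ
        ≤ ∫⁻ y, ‖sphericalMean t Ψ (v - s • (y : EuclideanSpace ℝ (Fin d)))‖ₑ ∂(sphereMeasure d) :=
          enorm_integral_le_lintegral_enorm _
      _ ≤ ∫⁻ y, ENNReal.ofReal A * (C₂ * 2 ^ j) ∂(sphereMeasure d) := by
          refine lintegral_mono fun y => ?_
          refine (enorm_integral_le_lintegral_enorm _).trans ?_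
          refine (lintegral_mono fun z => hpt y z).trans ?_
          rw [lintegral_const_mul' _ _ (by simp)]
          gcongr
          exact hC₂ j t ht _
      _ = _ := by simp
  -- The exponent `d` exceeds the required `(d - 1) / 2`.
  have hD : ((1 + κ) ^ d)⁻¹ ≤ (√((1 + κ) ^ (d - 1)))⁻¹ := by
    refine inv_anti₀ (by positivity) ?_
    rw [Real.sqrt_le_left (by positivity), ← pow_mul]
    exact pow_le_pow_right₀ (by linarith) (by omega)
  have h7 : ‖𝓕⁻ (pairMultiplier j s t) v‖ ≤ A * (C₂ * 2 ^ j) := by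
    rw [← ofReal_norm] at hmain
    have e : ENNReal.ofReal A * (C₂ * 2 ^ j) = ENNReal.ofReal (A * (C₂ * 2 ^ j)) := by
      rw [ENNReal.ofReal_mul hA, ENNReal.ofReal_mul (q := 2 ^ j) (by positivity),
        ENNReal.ofReal_pow (by norm_num)]
      simp
    rw [e] at hmain
    exact (ENNReal.ofReal_le_ofReal_iff (by positivity)).1 hmain
  refine h7.trans ?_
  simp only [A]
  calc C₁ * 2 ^ d * ((1 + κ) ^ d)⁻¹ * (C₂ * 2 ^ j)
      ≤ C₁ * 2 ^ d * (√((1 + κ) ^ (d - 1)))⁻¹ * (C₂ * 2 ^ j) := by gcongr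
    _ = _ := by ring

/-- The pointwise bound for the kernel of the composition of two pieces. -/
lemma exists_pairMultiplier_le (d : ℕ) [NeZero d] :
    ∃ C : ℝ, 0 ≤ C ∧ ∀ (j : ℕ) (s t : ℝ), s ∈ Icc (1 : ℝ) 2 → t ∈ Icc (1 : ℝ) 2 →
      ∀ v : EuclideanSpace ℝ (Fin d),
      ‖𝓕⁻ (pairMultiplier j s t) v‖ ≤ C * (2 ^ j * (√((1 + 2 ^ j * |s - t|) ^ (d - 1)))⁻¹) := by
  obtain ⟨C₁, h₁, hC₁⟩ := exists_pairMultiplier_far d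
  obtain ⟨C₂, h₂, hC₂⟩ := exists_pairMultiplier_near d
  refine ⟨max C₁ C₂, le_max_of_le_left h₁, fun j s t hs ht v => ?_⟩
  rcases le_total |s - t| (2 * ‖v‖) with h | h
  · exact (hC₁ j s t hs ht v h).trans (by gcongr; exact le_max_left _ _)
  · exact (hC₂ j s t hs ht v h).trans (by gcongr; exact le_max_right _ _)

end SphericalMax

end

set_option linter.unusedSectionVars false

noncomputable section

namespace SphericalMax

open Metric Set

/-! ### Sums of minima of geometric progressions -/

lemma exists_tsum_two_rpow_abs_sub_le {c : ℝ} (hc : 0 < c) :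
    ∃ C : ℝ≥0, ∀ x : ℝ, ∑' k : ℤ, ENNReal.ofReal ((2 : ℝ) ^ (-c * |(k : ℝ) - x|)) ≤ C := by
  have hsum : Summable fun k : ℤ => (2 : ℝ) ^ (-c * |(k : ℝ)|) := by
    have h1 : Summable fun n : ℕ => (2 : ℝ) ^ (-c * (n : ℝ)) := by
      have h2 : Summable fun n : ℕ => ((2 : ℝ) ^ (-c)) ^ n :=
        summable_geometric_of_lt_one (by positivity)
          (Real.rpow_lt_one_of_one_lt_of_neg (by norm_num) (by linarith))
      refine h2.congr fun n => ?_
      rw [Real.rpow_mul (by norm_num), Real.rpow_natCast]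
    refine Summable.of_nat_of_neg ?_ ?_
    · simpa using h1
    · simpa using h1
  refine ⟨((2 : ℝ) ^ c * ∑' k : ℤ, (2 : ℝ) ^ (-c * |(k : ℝ)|)).toNNReal, fun x => ?_⟩
  calc ∑' k : ℤ, ENNReal.ofReal ((2 : ℝ) ^ (-c * |(k : ℝ) - x|))
      ≤ ∑' k : ℤ, ENNReal.ofReal ((2 : ℝ) ^ c * (2 : ℝ) ^ (-c * |((k - ⌊x⌋ : ℤ) : ℝ)|)) := by
        refine ENNReal.tsum_le_tsum fun k => ENNReal.ofReal_le_ofReal ?_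
        rw [← Real.rpow_add (by norm_num)]
        refine Real.rpow_le_rpow_of_exponent_le (by norm_num) ?_
        have h1 : |((k - ⌊x⌋ : ℤ) : ℝ)| ≤ |(k : ℝ) - x| + 1 := by
          push_cast
          calc |(k : ℝ) - ⌊x⌋| = |((k : ℝ) - x) + (x - ⌊x⌋)| := by congr 1; ring
            _ ≤ |(k : ℝ) - x| + |x - ⌊x⌋| := abs_add_le _ _
            _ ≤ _ := by
              gcongr
              rw [abs_of_nonneg (by linarith [Int.floor_le x])]
              linarith [Int.lt_floor_add_one x]
        nlinarith
    _ = ∑' k : ℤ, ENNReal.ofReal ((2 : ℝ) ^ c * (2 : ℝ) ^ (-c * |(k : ℝ)|)) :=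
        (Equiv.subRight ⌊x⌋).tsum_eq
          (fun k : ℤ => ENNReal.ofReal ((2 : ℝ) ^ c * (2 : ℝ) ^ (-c * |(k : ℝ)|)))
    _ = ENNReal.ofReal ((2 : ℝ) ^ c * ∑' k : ℤ, (2 : ℝ) ^ (-c * |(k : ℝ)|)) := by
        rw [← tsum_mul_left, ENNReal.ofReal_tsum_of_nonneg (fun k => by positivity)
          (hsum.mul_left _)]
    _ ≤ _ := le_rfl

/-- The two progressions cross at `x = log₂(B/A) / (a + b)` with common value `A^(b/(a+b))
B^(a/(a+b))`, and on either side of `x` the smaller one decays geometrically. This summation keeps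
the endpoint. -/
lemma exists_tsum_min_le {a b : ℝ} (ha : 0 < a) (hb : 0 < b) :
    ∃ C : ℝ≥0, ∀ A B : ℝ, 0 ≤ A → 0 ≤ B →
      ∑' m : ℕ, ENNReal.ofReal (min (A * 2 ^ (a * (m : ℝ))) (B * 2 ^ (-b * (m : ℝ)))) ≤
        C * ENNReal.ofReal (A ^ (b / (a + b)) * B ^ (a / (a + b))) := by
  obtain ⟨C, hC⟩ := exists_tsum_two_rpow_abs_sub_le (lt_min ha hb)
  refine ⟨C, fun A B hA hB => ?_⟩
  rcases hA.eq_or_lt with rfl | hA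
  · simp
  rcases hB.eq_or_lt with rfl | hB
  · simp
  set x := Real.logb 2 (B / A) / (a + b) with hx
  set V := A ^ (b / (a + b)) * B ^ (a / (a + b)) with hV
  have hV0 : 0 < V := by positivity
  have hab : a + b ≠ 0 := by positivity
  have h2 : ∀ y, (2 : ℝ) ^ (Real.logb 2 (B / A) * y) = (B / A) ^ y := fun y => by
    rw [Real.rpow_mul (by norm_num), Real.rpow_logb (by norm_num) (by norm_num) (by positivity)]
  have hVA : V = A * 2 ^ (a * x) := by
    have e : a * x = Real.logb 2 (B / A) * (a / (a + b)) := by rw [hx]; field_simp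
    rw [e, h2, Real.div_rpow hB.le hA.le, hV]
    have : A ^ (b / (a + b)) * A ^ (a / (a + b)) = A := by
      rw [← Real.rpow_add hA, ← add_div, add_comm b a, div_self hab, Real.rpow_one]
    have hne : A ^ (a / (a + b)) ≠ 0 := by positivity
    field_simp
    linear_combination this
  have hVB : V = B * 2 ^ (-b * x) := by
    have e : -b * x = Real.logb 2 (B / A) * (-(b / (a + b))) := by rw [hx]; field_simp
    rw [e, h2, Real.rpow_neg (by positivity), Real.div_rpow hB.le hA.le, hV]
    have : B ^ (b / (a + b)) * B ^ (a / (a + b)) = B := by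
      rw [← Real.rpow_add hB, ← add_div, add_comm b a, div_self hab, Real.rpow_one]
    have hne : B ^ (b / (a + b)) ≠ 0 := by positivity
    field_simp
    linear_combination this
  have hterm : ∀ m : ℕ, min (A * 2 ^ (a * (m : ℝ))) (B * 2 ^ (-b * (m : ℝ))) ≤
      V * 2 ^ (-(min a b) * |((m : ℤ) : ℝ) - x|) := fun m => by
    rcases le_total (m : ℝ) x with h | h
    · refine (min_le_left _ _).trans ?_
      rw [hVA, mul_assoc, ← Real.rpow_add (by norm_num)]
      gcongr
      · norm_num
      · push_cast
        rw [abs_of_nonpos (by linarith)]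
        nlinarith [min_le_left a b]
    · refine (min_le_right _ _).trans ?_
      rw [hVB, mul_assoc, ← Real.rpow_add (by norm_num)]
      gcongr
      · norm_num
      · push_cast
        rw [abs_of_nonneg (by linarith)]
        nlinarith [min_le_right a b]
  calc ∑' m : ℕ, ENNReal.ofReal (min (A * 2 ^ (a * (m : ℝ))) (B * 2 ^ (-b * (m : ℝ))))
      ≤ ∑' m : ℕ, ENNReal.ofReal V *
          ENNReal.ofReal (2 ^ (-(min a b) * |((m : ℤ) : ℝ) - x|)) := by
        refine ENNReal.tsum_le_tsum fun m => ?_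
        rw [← ENNReal.ofReal_mul hV0.le]
        exact ENNReal.ofReal_le_ofReal (hterm m)
    _ = ENNReal.ofReal V * ∑' m : ℕ, ENNReal.ofReal (2 ^ (-(min a b) * |((m : ℤ) : ℝ) - x|)) :=
        ENNReal.tsum_mul_left
    _ ≤ ENNReal.ofReal V * ∑' k : ℤ, ENNReal.ofReal (2 ^ (-(min a b) * |(k : ℝ) - x|)) := by
        gcongr
        exact ENNReal.tsum_comp_le_tsum_of_injective Nat.cast_injective
          (fun k : ℤ => ENNReal.ofReal (2 ^ (-(min a b) * |(k : ℝ) - x|)))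
    _ ≤ ENNReal.ofReal V * C := by gcongr; exact hC x
    _ = _ := mul_comm _ _

lemma exists_sum_min_le {a b : ℝ} (ha : 0 < a) (hb : 0 < b) :
    ∃ C : ℝ, 0 ≤ C ∧ ∀ A B : ℝ, 0 ≤ A → 0 ≤ B → ∀ N : ℕ,
      ∑ m ∈ Finset.range N, min (A * 2 ^ (a * (m : ℝ))) (B * 2 ^ (-b * (m : ℝ))) ≤
        C * (A ^ (b / (a + b)) * B ^ (a / (a + b))) := by
  obtain ⟨C, hC⟩ := exists_tsum_min_le ha hb
  refine ⟨C, C.2, fun A B hA hB N => ?_⟩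
  have h0 : ∀ m : ℕ, 0 ≤ min (A * 2 ^ (a * (m : ℝ))) (B * 2 ^ (-b * (m : ℝ))) :=
    fun m => le_min (by positivity) (by positivity)
  have h1 := (ENNReal.sum_le_tsum (Finset.range N)).trans (hC A B hA hB)
  rw [← ENNReal.ofReal_sum_of_nonneg fun m _ => h0 m, ← ENNReal.ofReal_coe_nnreal,
    ← ENNReal.ofReal_mul C.coe_nonneg] at h1
  exact (ENNReal.ofReal_le_ofReal_iff (by positivity)).1 h1

end SphericalMax

end

set_option linter.unusedSectionVars false

noncomputable section

namespace SphericalMax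

open Metric Set
open scoped FourierTransform SchwartzMap

/-! ### Linearized maximal functions and their adjoints -/

section General

variable {V : Type*} [NormedAddCommGroup V] [InnerProductSpace ℝ V] [FiniteDimensional ℝ V]
  [MeasurableSpace V] [BorelSpace V]

lemma eLpNorm_two_sq {α : Type*} [MeasurableSpace α] {μ : Measure α} (f : α → ℂ) :
    eLpNorm f 2 μ ^ 2 = ∫⁻ x, ‖f x‖ₑ ^ 2 ∂μ := by
  have := eLpNorm_nnreal_pow_eq_lintegral (f := f) (μ := μ) (p := 2) (by norm_num)
  simpa using this

/-- Duality in `L²`: by density the inequality extends from Schwartz functions to `φ = conj Z`.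
Since `Z` is in `L²` beforehand, one factor of its norm may be cancelled. -/
lemma lintegral_enorm_sq_le_of_forall_schwartz {Z : V → ℂ} (hZ : MemLp Z 2) {B : ℝ≥0∞}
    (hB : B ≠ ∞) (h : ∀ φ : 𝓢(V, ℂ), ‖∫ ξ, φ ξ * Z ξ‖ₑ ^ 2 ≤ B * ∫⁻ ξ, ‖φ ξ‖ₑ ^ 2) :
    ∫⁻ ξ, ‖Z ξ‖ₑ ^ 2 ≤ B := by
  have hZ' : MemLp (fun ξ => (starRingEnd ℂ) (Z ξ)) 2 := hZ.star
  set z : Lp ℂ 2 (volume : Measure V) := hZ'.toLp _ with hz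
  have key : ∀ φ : Lp ℂ 2 (volume : Measure V), ‖inner ℂ z φ‖ ^ 2 ≤ B.toReal * ‖φ‖ ^ 2 := by
    intro φ
    refine (SchwartzMap.denseRange_toLpCLM (F := ℂ) (p := 2) (μ := (volume : Measure V))
      (by norm_num)).induction_on (p := fun φ : Lp ℂ 2 (volume : Measure V) =>
        ‖inner ℂ z φ‖ ^ 2 ≤ B.toReal * ‖φ‖ ^ 2) φ ?_ fun φ => ?_
    · exact isClosed_le (by fun_prop) (by fun_prop)
    · have e1 : inner ℂ z (SchwartzMap.toLpCLM ℝ ℂ 2 volume φ) = ∫ ξ, φ ξ * Z ξ := by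
        rw [L2.inner_def]
        refine integral_congr_ae ?_
        filter_upwards [hZ'.coeFn_toLp, SchwartzMap.coeFn_toLp φ 2 volume] with ξ h1 h2
        rw [hz, h1, SchwartzMap.toLpCLM_apply, h2]
        simp [mul_comm]
      have e2 : ‖SchwartzMap.toLpCLM ℝ ℂ 2 volume φ‖ ^ 2 = (∫⁻ ξ, ‖φ ξ‖ₑ ^ 2).toReal := by
        rw [SchwartzMap.toLpCLM_apply, SchwartzMap.norm_toLp, ← ENNReal.toReal_pow,
          eLpNorm_two_sq]
      rw [e1, e2, ← ENNReal.toReal_mul]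
      have := ENNReal.toReal_mono ?_ (h φ)
      · rwa [ENNReal.toReal_pow, toReal_enorm] at this
      · refine ENNReal.mul_ne_top hB ?_
        rw [← eLpNorm_two_sq]
        exact ENNReal.pow_ne_top (φ.memLp 2 volume).eLpNorm_ne_top
  have hk := key z
  rw [inner_self_eq_norm_sq_to_K] at hk
  have hn : ‖z‖ ^ 2 ≤ B.toReal := by
    rcases (norm_nonneg z).eq_or_lt with h0 | h0
    · rw [← h0]; simp
    · have : ‖z‖ ^ 2 * ‖z‖ ^ 2 ≤ B.toReal * ‖z‖ ^ 2 := by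
        simpa [← pow_mul, ← pow_add] using hk
      exact le_of_mul_le_mul_right this (by positivity)
  have e3 : ‖z‖ ^ 2 = (∫⁻ ξ, ‖Z ξ‖ₑ ^ 2).toReal := by
    rw [hz, Lp.norm_toLp, ← ENNReal.toReal_pow, eLpNorm_two_sq]
    simp
  rw [e3] at hn
  have hfin : ∫⁻ ξ, ‖Z ξ‖ₑ ^ 2 ≠ ∞ := by
    rw [← eLpNorm_two_sq]
    exact ENNReal.pow_ne_top hZ.eLpNorm_ne_top
  exact (ENNReal.toReal_le_toReal hfin hB).1 hn

lemma integral_mul_fourierInv {a h : V → ℂ} (ha : Integrable a) (hh : Integrable h) :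
    ∫ x, a x * 𝓕⁻ h x = ∫ ξ, 𝓕⁻ a ξ * h ξ := by
  have e := VectorFourier.integral_fourierIntegral_smul_eq_flip (L := innerₗ V)
    (μ := volume) (ν := volume) Real.continuous_fourierChar continuous_inner hh ha.comp_neg
  rw [flip_innerₗ] at e
  change ∫ ξ, 𝓕 h ξ • a (-ξ) = ∫ ξ, h ξ • 𝓕 (fun x => a (-x)) ξ at e
  rw [← integral_neg_eq_self (fun x => a x * 𝓕⁻ h x)]
  simp only [Real.fourierInv_eq_fourier_neg h, neg_neg]
  rw [Real.fourierInv_eq_fourier_comp_neg a]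
  simpa [mul_comm] using e

lemma fourierInv_mul_fourier {m a : V → ℂ} (hm : Integrable m) (ha : Integrable a) (x : V) :
    𝓕⁻ (fun ξ => m ξ * 𝓕 a ξ) x = ∫ z, a z * 𝓕⁻ m (x - z) := by
  have hexp : Continuous fun ξ : V =>
    Complex.exp (↑(2 * Real.pi * inner ℝ ξ x) * Complex.I) := by fun_prop
  set g : V → ℂ := fun ξ => Complex.exp (↑(2 * Real.pi * inner ℝ ξ x) * Complex.I) * m ξ
  have hg : Integrable g := hm.bdd_mul (c := 1) hexp.aestronglyMeasurable
    (.of_forall fun ξ => (Complex.norm_exp_ofReal_mul_I _).le)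
  have h := VectorFourier.integral_fourierIntegral_smul_eq_flip (L := innerₗ V)
    (μ := volume) (ν := volume) Real.continuous_fourierChar continuous_inner ha hg
  rw [flip_innerₗ] at h
  change ∫ ξ, 𝓕 a ξ • g ξ = ∫ z, a z • 𝓕 g z at h
  have h1 : 𝓕⁻ (fun ξ => m ξ * 𝓕 a ξ) x = ∫ ξ, 𝓕 a ξ • g ξ := by
    simp only [Real.fourierInv_eq']
    congr 1; ext ξ
    simp only [g, smul_eq_mul]; ring
  rw [h1, h]
  congr 1; ext z
  rw [smul_eq_mul, Real.fourierInv_eq', Real.fourier_eq']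
  congr 2; ext ξ
  simp only [g, smul_eq_mul]
  rw [← mul_assoc, ← Complex.exp_add, inner_sub_right]
  congr 2
  push_cast
  ring

lemma conj_fourierInv (a : V → ℂ) (ξ : V) :
    (starRingEnd ℂ) (𝓕⁻ a ξ) = 𝓕 (fun x => (starRingEnd ℂ) (a x)) ξ := by
  rw [Real.fourierInv_eq', Real.fourier_eq', ← integral_conj]
  congr 1; ext x
  rw [smul_eq_mul, smul_eq_mul, map_mul, ← Complex.exp_conj]
  congr 2
  simp only [map_mul, Complex.conj_I, Complex.conj_ofReal]
  push_cast
  ring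

lemma norm_fourier_le (a : V → ℂ) (ξ : V) : ‖𝓕 a ξ‖ ≤ ∫ x, ‖a x‖ :=
  VectorFourier.norm_fourierIntegral_le_integral_norm _ _ _ _ _

lemma continuous_fourier {a : V → ℂ} (ha : Integrable a) : Continuous (𝓕 a) :=
  VectorFourier.fourierIntegral_continuous Real.continuous_fourierChar
    (innerSL ℝ).continuous₂ ha

/-- Transferring one transform turns the pairing into `∫ a · (𝓕⁻ m * conj b)`, and a bounded kernel
pairs two `L¹` functions. -/
lemma norm_integral_mul_fourierInv_mul_conj_le {m a b : V → ℂ} (hm : Integrable m)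
    (ha : Integrable a) (hb : Integrable b) {K : ℝ} (hK : ∀ v, ‖𝓕⁻ m v‖ ≤ K) :
    ‖∫ ξ, m ξ * 𝓕⁻ a ξ * (starRingEnd ℂ) (𝓕⁻ b ξ)‖ ≤ K * (∫ x, ‖a x‖) * ∫ x, ‖b x‖ := by
  set b' : V → ℂ := fun x => (starRingEnd ℂ) (b x)
  have hb' : Integrable b' := (LinearIsometryEquiv.integrable_comp_iff Complex.conjLIE).2 hb
  have hnb : ∫ x, ‖b' x‖ = ∫ x, ‖b x‖ := by simp [b']
  have hmb : Integrable fun ξ => m ξ * 𝓕 b' ξ :=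
    hm.mul_bdd (c := ∫ x, ‖b' x‖) (continuous_fourier hb').aestronglyMeasurable
      (.of_forall fun ξ => norm_fourier_le _ _)
  have e : ∫ ξ, m ξ * 𝓕⁻ a ξ * (starRingEnd ℂ) (𝓕⁻ b ξ) =
      ∫ x, a x * 𝓕⁻ (fun ξ => m ξ * 𝓕 b' ξ) x := by
    rw [integral_mul_fourierInv ha hmb]
    congr 1; ext ξ
    rw [conj_fourierInv]; ring
  have hbd : ∀ x, ‖𝓕⁻ (fun ξ => m ξ * 𝓕 b' ξ) x‖ ≤ K * ∫ x, ‖b x‖ := fun x => by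
    rw [fourierInv_mul_fourier hm hb', ← hnb, ← integral_const_mul]
    refine norm_integral_le_of_norm_le (hb'.norm.const_mul K) (.of_forall fun z => ?_)
    rw [norm_mul, mul_comm]
    gcongr
    exact hK _
  rw [e]
  calc _ ≤ ∫ x, ‖a x‖ * (K * ∫ x, ‖b x‖) := by
        refine norm_integral_le_of_norm_le (ha.norm.mul_const _) (.of_forall fun x => ?_)
        rw [norm_mul]
        gcongr
        exact hbd x
    _ = _ := by rw [integral_mul_const]; ring

end General

/-- A measurable choice of a maximizing index. -/
lemma exists_partition_lintegral_iSup_le {α ι : Type*} [MeasurableSpace α] {μ : Measure α}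
    [DecidableEq ι] {h : ι → α → ℝ≥0∞} (hh : ∀ t, Measurable (h t)) (S : Finset ι) :
    ∀ {G : Set α}, MeasurableSet G → ∃ P : ι → Set α, (∀ t, MeasurableSet (P t)) ∧
      (∀ t, P t ⊆ G) ∧ (S : Set ι).PairwiseDisjoint P ∧
      ∫⁻ x in G, ⨆ t ∈ S, h t x ∂μ ≤ ∑ t ∈ S, ∫⁻ x in P t, h t x ∂μ := by
  induction S using Finset.induction_on with
  | empty => exact fun _ => ⟨fun _ => ∅, by simp⟩
  | insert a S ha ih =>
    intro G hG
    have hsup : Measurable fun x => ⨆ t ∈ S, h t x :=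
      .biSup _ S.countable_toSet fun t _ => hh t
    -- The set where the new index `a` beats all the earlier ones; there it takes over, and the
    -- induction hypothesis handles the complement.
    set R : Set α := {x | ⨆ t ∈ S, h t x ≤ h a x}
    have hR : MeasurableSet R := measurableSet_le hsup (hh a)
    obtain ⟨P, hP1, hP2, hP3, hP4⟩ := ih (hG.diff hR)
    have hne : ∀ t ∈ S, t ≠ a := fun t ht h => ha (h ▸ ht)
    refine ⟨Function.update P a (G ∩ R), fun t => ?_, fun t => ?_, ?_, ?_⟩
    · rcases eq_or_ne t a with rfl | h
      · simpa using hG.inter hR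
      · simpa [h] using hP1 t
    · rcases eq_or_ne t a with rfl | h
      · simp
      · simpa [h] using (hP2 t).trans sdiff_subset
    · rw [Finset.coe_insert, Set.pairwiseDisjoint_insert]
      refine ⟨fun s hs t ht hst => ?_, fun t ht _ => ?_⟩
      · simpa [Function.onFun, hne s hs, hne t ht] using hP3 hs ht hst
      · rw [Function.update_self, Function.update_of_ne (hne t ht)]
        exact (disjoint_sdiff_inter (s := G) (t := R)).symm.mono_right (hP2 t)
    · rw [Finset.sum_insert ha, Function.update_self,
        Finset.sum_congr rfl fun t ht => by rw [Function.update_of_ne (hne t ht)],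
        ← lintegral_inter_add_sdiff _ G hR]
      refine add_le_add (setLIntegral_mono (hh a) fun x hx => ?_)
        ((setLIntegral_mono hsup fun x hx => ?_).trans hP4)
      · rw [Finset.iSup_insert]
        exact sup_le le_rfl hx.2
      · rw [Finset.iSup_insert]
        exact sup_le (le_of_not_ge hx.2) le_rfl

variable {d : ℕ} [NeZero d]

/-- Functions `g t`, bounded by one and supported in pairwise disjoint sets `P t` of finite measure,
used to linearize a maximal function over the finite set `S` of radii. -/
structure IsLinearizing (S : Finset ℝ) (P : ℝ → Set (EuclideanSpace ℝ (Fin d)))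
    (g : ℝ → EuclideanSpace ℝ (Fin d) → ℂ) : Prop where
  measurableSet : ∀ t, MeasurableSet (P t)
  measure_ne_top : ∀ t, volume (P t) ≠ ∞
  disjoint : (S : Set ℝ).PairwiseDisjoint P
  measurable : ∀ t, Measurable (g t)
  norm_le : ∀ t x, ‖g t x‖ ≤ (P t).indicator 1 x

namespace IsLinearizing

variable {S : Finset ℝ} {P : ℝ → Set (EuclideanSpace ℝ (Fin d))}
    {g : ℝ → EuclideanSpace ℝ (Fin d) → ℂ}

lemma mono {S' : Finset ℝ} (h : IsLinearizing S P g) (hS : S' ⊆ S) : IsLinearizing S' P g :=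
  ⟨h.1, h.2, h.3.subset (Finset.coe_subset.2 hS), h.4, h.5⟩

lemma integrable_indicator (h : IsLinearizing S P g) (t : ℝ) :
    Integrable ((P t).indicator (1 : EuclideanSpace ℝ (Fin d) → ℝ)) :=
  (integrable_indicator_iff (h.1 t)).2 (integrableOn_const (h.2 t))

lemma integrable (h : IsLinearizing S P g) (t : ℝ) : Integrable (g t) :=
  (h.integrable_indicator t).mono' (h.4 t).aestronglyMeasurable (.of_forall (h.5 t))

lemma integral_norm_le (h : IsLinearizing S P g) (t : ℝ) :
    ∫ x, ‖g t x‖ ≤ volume.real (P t) := by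
  calc _ ≤ ∫ x, (P t).indicator (1 : EuclideanSpace ℝ (Fin d) → ℝ) x :=
        integral_mono (h.integrable t).norm (h.integrable_indicator t) (h.5 t)
    _ = _ := integral_indicator_one (h.1 t)

end IsLinearizing

/-- The adjoint of the `j`th piece of the spherical mean, on the Fourier side. -/
def adjointPiece (j : ℕ) (t : ℝ) (g : EuclideanSpace ℝ (Fin d) → ℂ)
    (ξ : EuclideanSpace ℝ (Fin d)) : ℂ :=
  (band j ξ : ℂ) * (sphereCos d (2 * Real.pi * t * ‖ξ‖) : ℂ) * 𝓕⁻ g ξ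

lemma continuous_adjointPiece (j : ℕ) (t : ℝ) {g : EuclideanSpace ℝ (Fin d) → ℂ}
    (hg : Integrable g) : Continuous (adjointPiece j t g) := by
  have h1 := continuous_band (d := d) j
  have h2 := continuous_sphereCos (d := d)
  have h3 := continuous_fourierInv hg
  exact ((Complex.continuous_ofReal.comp h1).mul (Complex.continuous_ofReal.comp
    (h2.comp (by fun_prop)))).mul h3

lemma hasCompactSupport_adjointPiece (j : ℕ) (t : ℝ) (g : EuclideanSpace ℝ (Fin d) → ℂ) :
    HasCompactSupport (adjointPiece j t g) := by
  refine HasCompactSupport.of_support_subset_isCompact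
    (isCompact_closedBall (0 : EuclideanSpace ℝ (Fin d)) (2 * 2 ^ j)) fun ξ hξ => ?_
  rw [mem_closedBall_zero_iff]
  refine norm_le_of_band_ne_zero fun h => hξ ?_
  simp [adjointPiece, h]

lemma integral_fourier_mul_adjointPiece (j : ℕ) (t : ℝ) {g : EuclideanSpace ℝ (Fin d) → ℂ}
    (hg : Integrable g) (f : 𝓢(EuclideanSpace ℝ (Fin d), ℂ)) :
    ∫ ξ, 𝓕 (f : EuclideanSpace ℝ (Fin d) → ℂ) ξ * adjointPiece j t g ξ =
      ∫ x, g x * pieceMean j f t x := by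
  rw [pieceMean, integral_mul_fourierInv hg
    (integrable_mul_sphereCos (integrable_band_mul_fourier j f) t)]
  congr 1; ext ξ
  rw [adjointPiece]; ring

lemma enorm_integral_mul_sum_adjointPiece_le {S : Finset ℝ}
    {P : ℝ → Set (EuclideanSpace ℝ (Fin d))} {g : ℝ → EuclideanSpace ℝ (Fin d) → ℂ}
    (h : IsLinearizing S P g) (hS : ∀ t ∈ S, 0 ≤ t) (j : ℕ)
    (f : 𝓢(EuclideanSpace ℝ (Fin d), ℂ)) :
    ‖∫ ξ, 𝓕 (f : EuclideanSpace ℝ (Fin d) → ℂ) ξ * ∑ t ∈ S, adjointPiece j t (g t) ξ‖ₑ ≤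
      ∫⁻ x in ⋃ t ∈ S, P t, ⨆ t ∈ S, ‖sphericalMean t (piece j f) x‖ₑ := by
  simp_rw [Finset.mul_sum]
  rw [integral_finsetSum _ fun t _ => ?_]
  swap
  · exact ((continuous_fourier_schwartz f).mul
      (continuous_adjointPiece j t (h.integrable t))).integrable_of_hasCompactSupport
      (hasCompactSupport_adjointPiece j t (g t)).mul_left
  rw [lintegral_biUnion_finset h.3 fun t _ => h.1 t]
  refine (enorm_sum_le _ _).trans (Finset.sum_le_sum fun t ht => ?_)
  rw [integral_fourier_mul_adjointPiece j t (h.integrable t), ← lintegral_indicator (h.1 t)]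
  refine (enorm_integral_le_lintegral_enorm _).trans (lintegral_mono fun x => ?_)
  rw [enorm_mul, ← sphericalMean_piece j f (hS t ht)]
  by_cases hx : x ∈ P t
  · have h5 := h.5 t x
    simp only [hx, indicator_of_mem, Pi.one_apply] at h5 ⊢
    calc _ ≤ 1 * ‖sphericalMean t (piece j f) x‖ₑ := by
          gcongr
          rw [← ofReal_norm, ← ENNReal.ofReal_one]
          exact ENNReal.ofReal_le_ofReal h5
      _ ≤ _ := by
          rw [one_mul]
          exact le_iSup₂_of_le t ht le_rfl
  · have h5 := h.5 t x
    simp only [hx, not_false_eq_true, indicator_of_notMem] at h5 ⊢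
    rw [norm_le_zero_iff] at h5
    simp [h5]

/-- The dual form of the `L²` bound for the local maximal function: the sum is tested against the
transform of an arbitrary Schwartz `f`, and the pairing is at most the integral of the maximal
function of its piece over the union of the `P t`. -/
lemma exists_lintegral_sum_adjointPiece_sq_le (d : ℕ) [NeZero d] :
    ∃ C : ℝ, 0 ≤ C ∧ ∀ (j : ℕ) (s : ℝ) (S : Finset ℝ) (P : ℝ → Set (EuclideanSpace ℝ (Fin d)))
      (g : ℝ → EuclideanSpace ℝ (Fin d) → ℂ), IsLinearizing S P g → 1 ≤ s →
      (S : Set ℝ) ⊆ Icc s (s + ((2 : ℝ) ^ j)⁻¹) →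
      ∫⁻ ξ, ‖∑ t ∈ S, adjointPiece j t (g t) ξ‖ₑ ^ 2 ≤
        ENNReal.ofReal (C * ((2 ^ j) ^ (d - 1))⁻¹) * ∑ t ∈ S, volume (P t) := by
  obtain ⟨C, hC0, hC⟩ := exists_lintegral_iSup_piece_sq_le d
  refine ⟨C, hC0, fun j s S P g h hs hS => ?_⟩
  have hcont : Continuous fun ξ => ∑ t ∈ S, adjointPiece j t (g t) ξ :=
    continuous_finsetSum _ fun t _ => continuous_adjointPiece j t (h.integrable t)
  have hsupp : HasCompactSupport fun ξ => ∑ t ∈ S, adjointPiece j t (g t) ξ := by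
    refine HasCompactSupport.of_support_subset_isCompact
      (isCompact_closedBall (0 : EuclideanSpace ℝ (Fin d)) (2 * 2 ^ j)) fun ξ hξ => ?_
    rw [mem_closedBall_zero_iff]
    refine norm_le_of_band_ne_zero fun h => hξ ?_
    simp [adjointPiece, h]
  refine lintegral_enorm_sq_le_of_forall_schwartz (hcont.memLp_of_hasCompactSupport hsupp)
    (ENNReal.mul_ne_top ENNReal.ofReal_ne_top (ENNReal.sum_ne_top.2 fun t _ => h.2 t)) fun φ => ?_
  set f : 𝓢(EuclideanSpace ℝ (Fin d), ℂ) := 𝓕⁻ φ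
  have hf : 𝓕 (f : EuclideanSpace ℝ (Fin d) → ℂ) = φ := by
    rw [← SchwartzMap.fourier_coe]
    simp [f]
  have h1 := enorm_integral_mul_sum_adjointPiece_le h
    (fun t ht => by linarith [(hS ht).1]) j f
  rw [hf] at h1
  have h2 := lintegral_enorm_sq_fourier_schwartz f
  rw [hf] at h2
  have hmeas : Measurable fun x => ⨆ t ∈ S, ‖sphericalMean t (piece j f) x‖ₑ := by
    refine .biSup _ S.countable_toSet fun t ht => ?_
    have := funext fun x => sphericalMean_piece j f (t := t) (by linarith [(hS ht).1]) x
    rw [this]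
    exact (continuous_pieceMean j f t).measurable.enorm
  -- Cauchy–Schwarz on the union of the `P t` turns the `L²` bound into one that involves only their
  -- total measure.
  calc _ ≤ (∫⁻ x in ⋃ t ∈ S, P t, ⨆ t ∈ S, ‖sphericalMean t (piece j f) x‖ₑ) ^ 2 := by gcongr
    _ ≤ volume (⋃ t ∈ S, P t) *
        ∫⁻ x, (⨆ t ∈ (S : Set ℝ), ‖sphericalMean t (piece j f) x‖ₑ) ^ 2 := by
      refine (sq_lintegral_le hmeas.aemeasurable).trans ?_
      rw [Measure.restrict_apply_univ]
      gcongr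
      exact Measure.restrict_le_self
    _ ≤ (∑ t ∈ S, volume (P t)) * (ENNReal.ofReal (C * ((2 ^ j) ^ (d - 1))⁻¹) *
        ∫⁻ z, ‖f z‖ₑ ^ 2) := by
      gcongr
      · exact measure_biUnion_finset_le _ _
      · exact hC j f s S hs hS
    _ = _ := by rw [h2]; ring

/-- The correlation of the adjoints of pieces of spherical means with two radii. -/
lemma exists_norm_integral_adjointPiece_mul_conj_le (d : ℕ) [NeZero d] :
    ∃ C : ℝ, 0 ≤ C ∧ ∀ (j : ℕ) (s t : ℝ), s ∈ Icc (1 : ℝ) 2 → t ∈ Icc (1 : ℝ) 2 →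
      ∀ a b : EuclideanSpace ℝ (Fin d) → ℂ, Integrable a → Integrable b →
      ‖∫ ξ, adjointPiece j t a ξ * (starRingEnd ℂ) (adjointPiece j s b ξ)‖ ≤
        C * (2 ^ j * (√((1 + 2 ^ j * |s - t|) ^ (d - 1)))⁻¹) * (∫ x, ‖a x‖) * ∫ x, ‖b x‖ := by
  obtain ⟨C, hC0, hC⟩ := exists_pairMultiplier_le d
  refine ⟨C, hC0, fun j s t hs ht a b ha hb => ?_⟩
  have := norm_integral_mul_fourierInv_mul_conj_le (integrable_pairMultiplier j s t) ha hb
    (hC j s t hs ht)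
  refine le_trans (le_of_eq ?_) this
  congr 2; ext ξ
  simp only [adjointPiece, pairMultiplier, map_mul, Complex.conj_ofReal]
  ring

end SphericalMax

end

set_option linter.unusedSectionVars false

noncomputable section

namespace SphericalMax

open Metric Set
open scoped FourierTransform SchwartzMap

/-! ### The `L²` improving bound for a piece of the maximal function -/

/-- Split the pairs by `1 + |i - i'| ≈ 2^m` and let `M` be the total mass. The first bound and the
number of neighbours give `A B M 2^(γm)`; the second gives `K M² 2^(-bm)`. The sum over `m` of the
smaller one is a weighted geometric mean. -/
lemma exists_sum_sum_le {γ b : ℝ} (hγ : 0 < γ) (hb : 0 < b) :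
    ∃ C : ℝ, 0 ≤ C ∧ ∀ (I : Finset ℤ) (μ : ℤ → ℝ) (c : ℤ → ℤ → ℝ) (A B K : ℝ),
      (∀ i, 0 ≤ μ i) → 0 ≤ A → 0 ≤ B → 0 ≤ K →
      (∀ i ∈ I, ∀ i' ∈ I, c i i' ≤ B / 2 * (μ i + μ i')) →
      (∀ i ∈ I, ∀ i' ∈ I, ∀ m : ℕ, 2 ^ m ≤ 1 + |(i : ℝ) - i'| →
        c i i' ≤ K * 2 ^ (-b * (m : ℝ)) * (μ i * μ i')) →
      (∀ (i : ℤ) (m : ℕ), ((I.filter fun i' : ℤ => |(i' : ℝ) - i| ≤ 2 ^ (m + 1)).card : ℝ) ≤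
        A * 2 ^ (γ * (m : ℝ))) →
      ∑ i ∈ I, ∑ i' ∈ I, c i i' ≤ C * ((A * B * ∑ i ∈ I, μ i) ^ (b / (γ + b)) *
        (K * (∑ i ∈ I, μ i) ^ 2) ^ (γ / (γ + b))) := by
  obtain ⟨C, hC0, hC⟩ := exists_sum_min_le hγ hb
  refine ⟨C, hC0, fun I μ c A B K hμ hA0 hB0 hK0 h1 h2 hA => ?_⟩
  set M := ∑ i ∈ I, μ i
  have hM : 0 ≤ M := Finset.sum_nonneg fun i _ => hμ i
  -- The dyadic distance: `2^r ≤ 1 + |i - i'| < 2^(r+1)`.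
  set r : ℤ × ℤ → ℕ := fun p => Nat.log 2 (1 + (p.1 - p.2).natAbs)
  have hcast : ∀ p : ℤ × ℤ, ((1 + (p.1 - p.2).natAbs : ℕ) : ℝ) = 1 + |(p.1 : ℝ) - p.2| :=
    fun p => by
      rw [Nat.cast_add, Nat.cast_one, Nat.cast_natAbs]
      push_cast; rfl
  have hr1 : ∀ p : ℤ × ℤ, (2 : ℝ) ^ r p ≤ 1 + |(p.1 : ℝ) - p.2| := fun p => by
    rw [← hcast]
    exact_mod_cast Nat.pow_log_le_self 2 (x := 1 + (p.1 - p.2).natAbs) (by omega)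
  have hr2 : ∀ p : ℤ × ℤ, |(p.1 : ℝ) - p.2| ≤ 2 ^ (r p + 1) := fun p => by
    have : ((1 + (p.1 - p.2).natAbs : ℕ) : ℝ) < 2 ^ (r p + 1) := by
      exact_mod_cast Nat.lt_pow_succ_log_self (by norm_num) (1 + (p.1 - p.2).natAbs)
    rw [hcast] at this
    linarith
  set N := ((I ×ˢ I).sup r) + 1
  rw [← Finset.sum_product', ← Finset.sum_fiberwise_of_maps_to (t := Finset.range N) (g := r)
    fun p hp => Finset.mem_range.2 (Nat.lt_succ_of_le (Finset.le_sup hp))]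
  refine (Finset.sum_le_sum fun m _ => ?_).trans
    (hC (A * B * M) (K * M ^ 2) (by positivity) (by positivity) N)
  have hfst : ∑ p ∈ (I ×ˢ I) with r p = m, μ p.1 ≤ A * 2 ^ (γ * (m : ℝ)) * M := by
    rw [Finset.sum_filter, Finset.sum_product, Finset.mul_sum]
    refine Finset.sum_le_sum fun i _ => ?_
    simp only [← Finset.sum_filter, Finset.sum_const, nsmul_eq_mul]
    refine mul_le_mul_of_nonneg_right (le_trans ?_ (hA i m)) (hμ i)
    gcongr with i' hi'
    rintro rfl
    rw [abs_sub_comm]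
    exact hr2 (i, i')
  have hsnd : ∑ p ∈ (I ×ˢ I) with r p = m, μ p.2 ≤ A * 2 ^ (γ * (m : ℝ)) * M := by
    rw [Finset.sum_filter, Finset.sum_product_right, Finset.mul_sum]
    refine Finset.sum_le_sum fun i _ => ?_
    simp only [← Finset.sum_filter, Finset.sum_const, nsmul_eq_mul]
    refine mul_le_mul_of_nonneg_right (le_trans ?_ (hA i m)) (hμ i)
    gcongr with i' hi'
    rintro rfl
    exact hr2 (i', i)
  refine le_min ?_ ?_
  · calc ∑ p ∈ (I ×ˢ I) with r p = m, c p.1 p.2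
        ≤ ∑ p ∈ (I ×ˢ I) with r p = m, B / 2 * (μ p.1 + μ p.2) := by
          refine Finset.sum_le_sum fun p hp => ?_
          rw [Finset.mem_filter, Finset.mem_product] at hp
          exact h1 _ hp.1.1 _ hp.1.2
      _ ≤ B / 2 * (A * 2 ^ (γ * (m : ℝ)) * M + A * 2 ^ (γ * (m : ℝ)) * M) := by
          rw [← Finset.mul_sum, Finset.sum_add_distrib]
          gcongr
      _ = _ := by ring
  · calc ∑ p ∈ (I ×ˢ I) with r p = m, c p.1 p.2
        ≤ ∑ p ∈ (I ×ˢ I) with r p = m, K * 2 ^ (-b * (m : ℝ)) * (μ p.1 * μ p.2) := by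
          refine Finset.sum_le_sum fun p hp => ?_
          rw [Finset.mem_filter, Finset.mem_product] at hp
          exact h2 _ hp.1.1 _ hp.1.2 m (hp.2 ▸ hr1 p)
      _ ≤ ∑ p ∈ I ×ˢ I, K * 2 ^ (-b * (m : ℝ)) * (μ p.1 * μ p.2) := by
          refine Finset.sum_le_sum_of_subset_of_nonneg (Finset.filter_subset _ _)
            fun p _ _ => ?_
          have := hμ p.1
          have := hμ p.2
          positivity
      _ = _ := by
          rw [← Finset.mul_sum, Finset.sum_product, ← Finset.sum_mul_sum]
          ring

lemma sq_lintegral_mul_le {α : Type*} [MeasurableSpace α] {μ : Measure α} {f g : α → ℝ≥0∞}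
    (hf : AEMeasurable f μ) (hg : AEMeasurable g μ) :
    (∫⁻ x, f x * g x ∂μ) ^ 2 ≤ (∫⁻ x, f x ^ 2 ∂μ) * ∫⁻ x, g x ^ 2 ∂μ := by
  have h := ENNReal.lintegral_mul_le_Lp_mul_Lq μ Real.HolderConjugate.two_two hf hg
  simp only [Pi.mul_apply, ENNReal.rpow_ofNat] at h
  calc _ ≤ ((∫⁻ x, f x ^ 2 ∂μ) ^ (1 / (2 : ℝ)) *
        (∫⁻ x, g x ^ 2 ∂μ) ^ (1 / (2 : ℝ))) ^ 2 := by gcongr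
    _ = _ := by
      rw [mul_pow, ← ENNReal.rpow_natCast, ← ENNReal.rpow_natCast, ← ENNReal.rpow_mul,
        ← ENNReal.rpow_mul]
      norm_num

lemma integral_norm_sum_sq_le {α ι : Type*} [MeasurableSpace α] {μ : Measure α} (I : Finset ι)
    {Z : ι → α → ℂ} (hZ : ∀ i ∈ I, MemLp (Z i) 2 μ) :
    ∫ x, ‖∑ i ∈ I, Z i x‖ ^ 2 ∂μ ≤
      ∑ i ∈ I, ∑ i' ∈ I, ‖∫ x, Z i x * (starRingEnd ℂ) (Z i' x) ∂μ‖ := by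
  have hint : ∀ i ∈ I, ∀ i' ∈ I, Integrable (fun x => Z i x * (starRingEnd ℂ) (Z i' x)) μ :=
    fun i hi i' hi' => (hZ i hi).integrable_mul (hZ i' hi').star
  have e : ((∫ x, ‖∑ i ∈ I, Z i x‖ ^ 2 ∂μ : ℝ) : ℂ) =
      ∑ i ∈ I, ∑ i' ∈ I, ∫ x, Z i x * (starRingEnd ℂ) (Z i' x) ∂μ := by
    rw [← integral_complex_ofReal]
    have : ∀ x, ((‖∑ i ∈ I, Z i x‖ ^ 2 : ℝ) : ℂ) =
        ∑ i ∈ I, ∑ i' ∈ I, Z i x * (starRingEnd ℂ) (Z i' x) := fun x => by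
      rw [← Finset.sum_mul_sum, ← map_sum, Complex.mul_conj, Complex.normSq_eq_norm_sq]
    simp only [this]
    rw [integral_finsetSum _ fun i hi => integrable_finsetSum _ fun i' hi' => hint i hi i' hi']
    refine Finset.sum_congr rfl fun i hi => ?_
    rw [integral_finsetSum _ fun i' hi' => hint i hi i' hi']
  calc ∫ x, ‖∑ i ∈ I, Z i x‖ ^ 2 ∂μ = ‖((∫ x, ‖∑ i ∈ I, Z i x‖ ^ 2 ∂μ : ℝ) : ℂ)‖ := by
        rw [Complex.norm_real, Real.norm_of_nonneg (integral_nonneg fun x => by positivity)]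
    _ ≤ _ := by
        rw [e]
        exact (norm_sum_le _ _).trans (Finset.sum_le_sum fun i _ => norm_sum_le _ _)

lemma norm_integral_mul_conj_le {α : Type*} [MeasurableSpace α] {μ : Measure α} {a b : α → ℂ}
    (ha : MemLp a 2 μ) (hb : MemLp b 2 μ) :
    ‖∫ x, a x * (starRingEnd ℂ) (b x) ∂μ‖ ≤
      1 / 2 * ((∫ x, ‖a x‖ ^ 2 ∂μ) + ∫ x, ‖b x‖ ^ 2 ∂μ) := by
  have ha2 := ha.integrable_norm_pow (p := 2) (by norm_num)
  have hb2 := hb.integrable_norm_pow (p := 2) (by norm_num)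
  rw [← integral_add ha2 hb2, ← integral_const_mul]
  refine norm_integral_le_of_norm_le ((ha2.add hb2).const_mul _) (.of_forall fun x => ?_)
  simp only [norm_mul, RCLike.norm_conj]
  nlinarith [sq_nonneg (‖a x‖ - ‖b x‖)]

/-- The index of the dyadic interval of length `2 ^ (-j)` that contains `t`. -/
def cell (j : ℕ) (t : ℝ) : ℤ := ⌊2 ^ j * t⌋

lemma cell_le (j : ℕ) (t : ℝ) : (cell j t : ℝ) ≤ 2 ^ j * t := Int.floor_le _

lemma lt_cell_add_one (j : ℕ) (t : ℝ) : 2 ^ j * t < cell j t + 1 := Int.lt_floor_add_one _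

lemma mem_Icc_of_cell_eq {j : ℕ} {t : ℝ} {i : ℤ} (h : cell j t = i) :
    t ∈ Icc ((i : ℝ) / 2 ^ j) ((i : ℝ) / 2 ^ j + ((2 : ℝ) ^ j)⁻¹) := by
  have h1 := cell_le j t
  have h2 := lt_cell_add_one j t
  have h3 : (0 : ℝ) < 2 ^ j := by positivity
  rw [h] at h1 h2
  constructor
  · rw [div_le_iff₀ h3]; linarith
  · rw [inv_eq_one_div, ← add_div, le_div_iff₀ h3]; linarith

lemma one_le_cell_div {j : ℕ} {t : ℝ} (ht : 1 ≤ t) : 1 ≤ (cell j t : ℝ) / 2 ^ j := by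
  rw [le_div_iff₀ (by positivity), one_mul]
  have : ((2 ^ j : ℤ) : ℝ) ≤ 2 ^ j * t := by
    push_cast
    exact le_mul_of_one_le_right (by positivity) ht
  have h := Int.le_floor.2 this
  rw [← cell] at h
  exact_mod_cast h

lemma abs_cell_sub_le (j : ℕ) (s t : ℝ) :
    1 + |(cell j s : ℝ) - cell j t| ≤ 2 * (1 + 2 ^ j * |s - t|) := by
  have h0 : (0 : ℝ) < 2 ^ j := by positivity
  have : |(cell j s : ℝ) - cell j t| ≤ 2 ^ j * |s - t| + 1 := by
    have e : 2 ^ j * |s - t| = |2 ^ j * (s - t)| := by rw [abs_mul, abs_of_pos h0]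
    rw [e, abs_le]
    have h1 := cell_le j t
    have h2 := lt_cell_add_one j t
    have h3 := cell_le j s
    have h4 := lt_cell_add_one j s
    have h5 := abs_le.1 (le_refl |2 ^ j * (s - t)|)
    constructor <;> nlinarith
  nlinarith [abs_nonneg (s - t)]

lemma inv_sqrt_pow_le {n m : ℕ} {y : ℝ} (hy : 2 ^ m ≤ 2 * y) :
    (√(y ^ n))⁻¹ ≤ 2 ^ ((n : ℝ) / 2) * 2 ^ (-((n : ℝ) / 2) * (m : ℝ)) := by
  have h0 : (0 : ℝ) < 2 ^ m := by positivity
  have hy0 : 0 < y := by linarith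
  have h1 : √(y ^ n) = y ^ ((n : ℝ) / 2) := by
    rw [Real.sqrt_eq_rpow, ← Real.rpow_natCast, ← Real.rpow_mul hy0.le]
    ring_nf
  have h2 : (2 : ℝ) ^ (-((n : ℝ) / 2) * (m : ℝ)) = (((2 : ℝ) ^ m) ^ ((n : ℝ) / 2))⁻¹ := by
    rw [neg_mul, Real.rpow_neg (by norm_num), ← Real.rpow_natCast, ← Real.rpow_mul (by norm_num),
      mul_comm]
  rw [h1, h2, ← div_eq_mul_inv, le_div_iff₀ (by positivity), inv_mul_le_iff₀ (by positivity),
    mul_comm (y ^ _), ← Real.mul_rpow (by norm_num) hy0.le]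
  exact Real.rpow_le_rpow h0.le hy (by positivity)

variable {d : ℕ} [NeZero d]

lemma memLp_sum_adjointPiece {S : Finset ℝ} {P : ℝ → Set (EuclideanSpace ℝ (Fin d))}
    {g : ℝ → EuclideanSpace ℝ (Fin d) → ℂ} (h : IsLinearizing S P g) (j : ℕ) (T : Finset ℝ) :
    MemLp (fun ξ => ∑ t ∈ T, adjointPiece j t (g t) ξ) 2 :=
  memLp_finsetSum _ fun t _ => (continuous_adjointPiece j t
    (h.integrable t)).memLp_of_hasCompactSupport (hasCompactSupport_adjointPiece j t (g t))

/-- The `TT*` estimate. The adjoint is grouped by cells and its squared norm expanded into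
correlations. Within a cell the `L²` bound controls the norm by the measure of the sets. Between
cells the kernel bound uses the `L¹` masses, again at most those measures, and decays with the
distance of the cells. Everything is expressed by measures, so the output is a restricted estimate
at once. -/
lemma exists_integral_norm_sum_adjointPiece_sq_le (hd : 2 ≤ d) {γ A : ℝ} (hγ : 0 < γ)
    (hA0 : 0 ≤ A) :
    ∃ C : ℝ, 0 ≤ C ∧ ∀ (j : ℕ) (S : Finset ℝ) (P : ℝ → Set (EuclideanSpace ℝ (Fin d)))
      (g : ℝ → EuclideanSpace ℝ (Fin d) → ℂ), IsLinearizing S P g → (S : Set ℝ) ⊆ Icc 1 2 →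
      (∀ (i : ℤ) (m : ℕ), (((S.image (cell j)).filter
        fun i' : ℤ => |(i' : ℝ) - i| ≤ 2 ^ (m + 1)).card : ℝ) ≤ A * 2 ^ (γ * (m : ℝ))) →
      ∫ ξ, ‖∑ t ∈ S, adjointPiece j t (g t) ξ‖ ^ 2 ≤
        C * ((((2 ^ j) ^ (d - 1))⁻¹ * ∑ t ∈ S, volume.real (P t)) ^
            ((((d - 1 : ℕ) : ℝ) / 2) / (γ + ((d - 1 : ℕ) : ℝ) / 2)) *
          (2 ^ j * (∑ t ∈ S, volume.real (P t)) ^ 2) ^ (γ / (γ + ((d - 1 : ℕ) : ℝ) / 2))) := by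
  set b : ℝ := ((d - 1 : ℕ) : ℝ) / 2 with hb
  have hb0 : 0 < b := by
    have : 0 < d - 1 := by omega
    positivity
  obtain ⟨C₁, hC₁, h₁⟩ := exists_lintegral_sum_adjointPiece_sq_le d
  obtain ⟨C₂, hC₂, h₂⟩ := exists_norm_integral_adjointPiece_mul_conj_le d
  obtain ⟨C₃, hC₃, h₃⟩ := exists_sum_sum_le hγ hb0
  refine ⟨C₃ * ((A * C₁) ^ (b / (γ + b)) * (C₂ * 2 ^ b) ^ (γ / (γ + b))), by positivity,
    fun j S P g h hS hA => ?_⟩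
  set I := S.image (cell j)
  set T : ℤ → Finset ℝ := fun i => S.filter fun t => cell j t = i
  set Z : ℤ → EuclideanSpace ℝ (Fin d) → ℂ := fun i ξ => ∑ t ∈ T i, adjointPiece j t (g t) ξ
  have hmaps : ∀ t ∈ S, cell j t ∈ I := fun t ht => Finset.mem_image_of_mem _ ht
  have hZ : ∀ i, MemLp (Z i) 2 := fun i => memLp_sum_adjointPiece h j (T i)
  set μ : ℤ → ℝ := fun i => ∑ t ∈ T i, volume.real (P t)
  have hμ0 : ∀ i, 0 ≤ μ i := fun i => Finset.sum_nonneg fun t _ => measureReal_nonneg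
  have hμ : ∑ i ∈ I, μ i = ∑ t ∈ S, volume.real (P t) :=
    Finset.sum_fiberwise_of_maps_to hmaps _
  have hZsum : ∀ ξ, ∑ t ∈ S, adjointPiece j t (g t) ξ = ∑ i ∈ I, Z i ξ := fun ξ =>
    (Finset.sum_fiberwise_of_maps_to hmaps _).symm
  set B := C₁ * (((2 : ℝ) ^ j) ^ (d - 1))⁻¹
  have hsq : ∀ i ∈ I, ∫ ξ, ‖Z i ξ‖ ^ 2 ≤ B * μ i := fun i hi => by
    obtain ⟨t₀, ht₀, rfl⟩ := Finset.mem_image.1 hi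
    have e := h₁ j _ (T (cell j t₀)) P g (h.mono (Finset.filter_subset _ _))
      (one_le_cell_div (hS ht₀).1) fun t ht =>
        mem_Icc_of_cell_eq (Finset.mem_filter.1 (Finset.mem_coe.1 ht)).2
    rw [integral_eq_lintegral_of_nonneg_ae (.of_forall fun x => by positivity)
      ((hZ (cell j t₀)).integrable_norm_pow (p := 2) (by norm_num)).1]
    refine ENNReal.toReal_le_of_le_ofReal (mul_nonneg (by positivity) (hμ0 _)) ?_
    rw [ENNReal.ofReal_mul (by positivity), ENNReal.ofReal_sum_of_nonneg
      fun t _ => measureReal_nonneg]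
    simp only [ofReal_measureReal (h.2 _)]
    refine le_trans (le_of_eq ?_) e
    congr 1; ext ξ
    rw [ENNReal.ofReal_pow (norm_nonneg _), ofReal_norm]
  have hc1 : ∀ i ∈ I, ∀ i' ∈ I, ‖∫ x, Z i x * (starRingEnd ℂ) (Z i' x)‖ ≤
      B / 2 * (μ i + μ i') := fun i hi i' hi' => by
    refine (norm_integral_mul_conj_le (hZ i) (hZ i')).trans ?_
    have := hsq i hi
    have := hsq i' hi'
    linarith
  have hc2 : ∀ i ∈ I, ∀ i' ∈ I, ∀ m : ℕ, 2 ^ m ≤ 1 + |(i : ℝ) - i'| →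
      ‖∫ x, Z i x * (starRingEnd ℂ) (Z i' x)‖ ≤
        C₂ * 2 ^ b * 2 ^ j * 2 ^ (-b * (m : ℝ)) * (μ i * μ i') := fun i hi i' hi' m hm => by
    have hint : ∀ t s : ℝ, Integrable fun ξ =>
        adjointPiece j t (g t) ξ * (starRingEnd ℂ) (adjointPiece j s (g s) ξ) := fun t s => by
      have h1 : ∀ t, MemLp (adjointPiece j t (g t)) 2 := fun t => (continuous_adjointPiece j t
        (h.integrable t)).memLp_of_hasCompactSupport (hasCompactSupport_adjointPiece j t (g t))
      exact (h1 t).integrable_mul (h1 s).star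
    have e : ∫ x, Z i x * (starRingEnd ℂ) (Z i' x) = ∑ t ∈ T i, ∑ s ∈ T i',
        ∫ ξ, adjointPiece j t (g t) ξ * (starRingEnd ℂ) (adjointPiece j s (g s) ξ) := by
      simp only [Z, map_sum, Finset.sum_mul_sum]
      rw [integral_finsetSum _ fun t _ => integrable_finsetSum _ fun s _ => hint t s]
      refine Finset.sum_congr rfl fun t _ => ?_
      rw [integral_finsetSum _ fun s _ => hint t s]
    rw [e]
    refine (norm_sum_le _ _).trans ((Finset.sum_le_sum fun t _ => norm_sum_le _ _).trans ?_)
    rw [Finset.sum_mul_sum, Finset.mul_sum]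
    refine Finset.sum_le_sum fun t ht => ?_
    rw [Finset.mul_sum]
    refine Finset.sum_le_sum fun s hs => ?_
    obtain ⟨htS, rfl⟩ := Finset.mem_filter.1 ht
    obtain ⟨hsS, rfl⟩ := Finset.mem_filter.1 hs
    have hy := hm.trans (abs_cell_sub_le j t s)
    rw [abs_sub_comm] at hy
    have hdec := inv_sqrt_pow_le (n := d - 1) hy
    refine (h₂ j s t (hS hsS) (hS htS) _ _ (h.integrable t) (h.integrable s)).trans ?_
    calc _ ≤ C₂ * (2 ^ j * (2 ^ b * 2 ^ (-b * (m : ℝ)))) * volume.real (P t) *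
          volume.real (P s) := by
          gcongr
          · exact h.integral_norm_le t
          · exact h.integral_norm_le s
      _ = _ := by ring
  simp only [hZsum]
  refine (integral_norm_sum_sq_le I fun i _ => hZ i).trans
    ((h₃ I μ _ A B (C₂ * 2 ^ b * 2 ^ j) hμ0 hA0 (by positivity) (by positivity) hc1 hc2
      hA).trans (le_of_eq ?_))
  rw [hμ]
  have hM : 0 ≤ ∑ t ∈ S, volume.real (P t) := Finset.sum_nonneg fun t _ => measureReal_nonneg
  rw [show A * B * ∑ t ∈ S, volume.real (P t) =
      A * C₁ * ((((2 : ℝ) ^ j) ^ (d - 1))⁻¹ * ∑ t ∈ S, volume.real (P t)) by ring,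
    mul_assoc (C₂ * 2 ^ b), Real.mul_rpow (x := A * C₁) (by positivity) (by positivity),
    Real.mul_rpow (x := C₂ * 2 ^ b) (by positivity) (by positivity)]
  ring

/-- The `L²` improving bound for a piece of the maximal function, over radii whose dyadic
intervals are sparse. -/
lemma exists_sq_lintegral_iSup_piece_le (hd : 2 ≤ d) {γ A : ℝ} (hγ : 0 < γ) (hA0 : 0 ≤ A) :
    ∃ C : ℝ, 0 ≤ C ∧ ∀ (j : ℕ) (S : Finset ℝ), (S : Set ℝ) ⊆ Icc 1 2 →
      (∀ (i : ℤ) (m : ℕ), (((S.image (cell j)).filter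
        fun i' : ℤ => |(i' : ℝ) - i| ≤ 2 ^ (m + 1)).card : ℝ) ≤ A * 2 ^ (γ * (m : ℝ))) →
      ∀ (f : 𝓢(EuclideanSpace ℝ (Fin d), ℂ)) (G : Set (EuclideanSpace ℝ (Fin d))),
      MeasurableSet G → volume G ≠ ∞ →
      (∫⁻ x in G, ⨆ t ∈ S, ‖sphericalMean t (piece j f) x‖ₑ) ^ 2 ≤
        (∫⁻ x, ‖f x‖ₑ ^ 2) * ENNReal.ofReal (C * ((((2 ^ j) ^ (d - 1))⁻¹ * volume.real G) ^
            ((((d - 1 : ℕ) : ℝ) / 2) / (γ + ((d - 1 : ℕ) : ℝ) / 2)) *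
          (2 ^ j * volume.real G ^ 2) ^ (γ / (γ + ((d - 1 : ℕ) : ℝ) / 2)))) := by
  obtain ⟨C, hC0, hC⟩ := exists_integral_norm_sum_adjointPiece_sq_le hd hγ hA0
  refine ⟨C, hC0, fun j S hS hA f G hG hGfin => ?_⟩
  have hmean : ∀ t ∈ S, ∀ x, sphericalMean t (piece j f) x = pieceMean j f t x :=
    fun t ht x => sphericalMean_piece j f (by linarith [(hS ht).1]) x
  have hcont := continuous_pieceMean j f
  obtain ⟨P, hP1, hP2, hP3, hP4⟩ := exists_partition_lintegral_iSup_le (μ := volume)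
    (h := fun t x => ‖pieceMean j f t x‖ₑ) (fun t => (hcont t).measurable.enorm) S hG
  have hPfin : ∀ t, volume (P t) ≠ ∞ := fun t => measure_ne_top_of_subset (hP2 t) hGfin
  -- The conjugate phase of the mean on `P t`, so that `g t` times the mean is its modulus there.
  -- Where the mean vanishes the quotient is zero by convention, which is harmless.
  set g : ℝ → EuclideanSpace ℝ (Fin d) → ℂ := fun t => (P t).indicator fun x =>
    (starRingEnd ℂ) (pieceMean j f t x) / (‖pieceMean j f t x‖ : ℂ)
  have hlin : IsLinearizing S P g := by
    refine ⟨hP1, hPfin, hP3, fun t => ?_, fun t x => ?_⟩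
    · have := (hcont t).measurable
      exact Measurable.indicator (by fun_prop) (hP1 t)
    · by_cases hx : x ∈ P t
      · simp only [g, hx, indicator_of_mem, norm_div, RCLike.norm_conj, Complex.norm_real,
          norm_norm, Pi.one_apply]
        exact div_self_le_one _
      · simp [g, hx]
  have hgF : ∀ t x, g t x * pieceMean j f t x =
      (((P t).indicator (fun x => ‖pieceMean j f t x‖) x : ℝ) : ℂ) := fun t x => by
    by_cases hx : x ∈ P t
    · simp only [g, hx, indicator_of_mem]
      rcases eq_or_ne (pieceMean j f t x) 0 with h0 | h0
      · simp [h0]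
      · have : (‖pieceMean j f t x‖ : ℂ) ≠ 0 := by exact_mod_cast (norm_pos_iff.2 h0).ne'
        rw [div_mul_eq_mul_div, div_eq_iff this, mul_comm, Complex.mul_conj,
          Complex.normSq_eq_norm_sq]
        push_cast; ring
    · simp [g, hx]
  have hbdd : ∀ t, ∃ c, ∀ x, ‖pieceMean j f t x‖ ≤ c := fun t =>
    ⟨_, fun x => by
      rw [pieceMean, Real.fourierInv_eq_fourier_neg]
      exact norm_fourier_le _ _⟩
  have hint : ∀ t, Integrable ((P t).indicator fun x => ‖pieceMean j f t x‖) := fun t => by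
    obtain ⟨c, hc⟩ := hbdd t
    have := (hlin.integrable t).mul_bdd (c := c) (hcont t).aestronglyMeasurable
      (.of_forall hc)
    simp only [hgF] at this
    simpa using this.re
  set Z : EuclideanSpace ℝ (Fin d) → ℂ := fun ξ => ∑ t ∈ S, adjointPiece j t (g t) ξ
  have hpair : ∫ ξ, 𝓕 (f : EuclideanSpace ℝ (Fin d) → ℂ) ξ * Z ξ =
      ((∑ t ∈ S, ∫ x, (P t).indicator (fun x => ‖pieceMean j f t x‖) x : ℝ) : ℂ) := by
    simp only [Z, Finset.mul_sum]
    rw [integral_finsetSum _ fun t _ => ?_]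
    · push_cast
      refine Finset.sum_congr rfl fun t _ => ?_
      rw [integral_fourier_mul_adjointPiece j t (hlin.integrable t), ← integral_complex_ofReal]
      simp only [hgF]
    · exact ((continuous_fourier_schwartz f).mul
        (continuous_adjointPiece j t (hlin.integrable t))).integrable_of_hasCompactSupport
        (hasCompactSupport_adjointPiece j t (g t)).mul_left
  have hle : ∫⁻ x in G, ⨆ t ∈ S, ‖sphericalMean t (piece j f) x‖ₑ ≤
      ‖∫ ξ, 𝓕 (f : EuclideanSpace ℝ (Fin d) → ℂ) ξ * Z ξ‖ₑ := by
    have h0 : ∀ t, 0 ≤ ∫ x, (P t).indicator (fun x => ‖pieceMean j f t x‖) x := fun t =>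
      integral_nonneg fun x => indicator_nonneg (fun _ _ => norm_nonneg _) _
    rw [hpair, ← ofReal_norm, Complex.norm_real,
      Real.norm_of_nonneg (Finset.sum_nonneg fun t _ => h0 t),
      ENNReal.ofReal_sum_of_nonneg fun t _ => h0 t]
    refine le_trans (le_of_eq ?_) (hP4.trans (Finset.sum_le_sum fun t _ => ?_))
    · congr 1; ext x
      exact iSup_congr fun t => iSup_congr fun ht => by rw [hmean t ht]
    · rw [ofReal_integral_eq_lintegral_ofReal (hint t)
        (.of_forall fun x => indicator_nonneg (fun _ _ => norm_nonneg _) _),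
        ← lintegral_indicator (hP1 t)]
      refine lintegral_mono fun x => ?_
      by_cases hx : x ∈ P t <;> simp [hx]
  have hZmem : MemLp Z 2 := memLp_sum_adjointPiece hlin j S
  calc _ ≤ (∫⁻ ξ, ‖𝓕 (f : EuclideanSpace ℝ (Fin d) → ℂ) ξ‖ₑ * ‖Z ξ‖ₑ) ^ 2 := by
        refine pow_le_pow_left' ?_ 2
        refine hle.trans ((enorm_integral_le_lintegral_enorm _).trans (le_of_eq ?_))
        simp only [enorm_mul]
    _ ≤ (∫⁻ ξ, ‖𝓕 (f : EuclideanSpace ℝ (Fin d) → ℂ) ξ‖ₑ ^ 2) * ∫⁻ ξ, ‖Z ξ‖ₑ ^ 2 :=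
        sq_lintegral_mul_le (continuous_fourier_schwartz f).measurable.enorm.aemeasurable
          hZmem.1.enorm
    _ ≤ _ := by
        rw [lintegral_enorm_sq_fourier_schwartz]
        gcongr
        have e : ∫⁻ ξ, ‖Z ξ‖ₑ ^ 2 = ENNReal.ofReal (∫ ξ, ‖Z ξ‖ ^ 2) := by
          rw [ofReal_integral_eq_lintegral_ofReal (hZmem.integrable_norm_pow (by norm_num))
            (.of_forall fun x => by positivity)]
          congr 1; ext ξ
          rw [ENNReal.ofReal_pow (norm_nonneg _), ofReal_norm]
        rw [e]
        refine ENNReal.ofReal_le_ofReal ((hC j S P g hlin hS hA).trans ?_)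
        have hsum : ∑ t ∈ S, volume.real (P t) ≤ volume.real G := by
          rw [← measureReal_biUnion_finset hP3 (fun t _ => hP1 t) fun t _ => hPfin t]
          exact measureReal_mono (iUnion₂_subset fun t _ => hP2 t) hGfin
        have h0 : 0 ≤ ∑ t ∈ S, volume.real (P t) := Finset.sum_nonneg fun _ _ => measureReal_nonneg
        gcongr

end SphericalMax

end

set_option linter.unusedSectionVars false

noncomputable section

namespace SphericalMax

open Metric Set
open scoped FourierTransform SchwartzMap

/-! ### Counting dyadic intervals -/

/-- A closed interval of length `2^(-j)` meets at most two consecutive dyadic cells. -/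
lemma card_image_cell_le {j : ℕ} {S T : Finset ℝ}
    (h : (S : Set ℝ) ⊆ ⋃ a ∈ T, Icc a (a + ((2 : ℝ) ^ j)⁻¹)) :
    (S.image (cell j)).card ≤ 2 * T.card := by
  have hsub : S.image (cell j) ⊆ T.biUnion fun a => {cell j a, cell j a + 1} := by
    intro i hi
    obtain ⟨t, ht, rfl⟩ := Finset.mem_image.1 hi
    obtain ⟨a, ha, hat⟩ := mem_iUnion₂.1 (h ht)
    refine Finset.mem_biUnion.2 ⟨a, ha, ?_⟩
    have h0 : (0 : ℝ) < 2 ^ j := by positivity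
    have h1 : 2 ^ j * a ≤ 2 ^ j * t := by gcongr; exact hat.1
    have h2 : 2 ^ j * t ≤ 2 ^ j * a + 1 := by
      calc 2 ^ j * t ≤ 2 ^ j * (a + ((2 : ℝ) ^ j)⁻¹) := by gcongr; exact hat.2
        _ = _ := by field_simp
    have h3 : cell j a ≤ cell j t := Int.floor_mono h1
    have h4 : cell j t ≤ cell j a + 1 := by
      have := Int.floor_mono h2
      rwa [Int.floor_add_one] at this
    simp only [Finset.mem_insert, Finset.mem_singleton]
    omega
  refine (Finset.card_le_card hsub).trans (Finset.card_biUnion_le.trans ?_)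
  rw [mul_comm]
  exact Finset.sum_le_card_nsmul _ _ _ fun a _ => Finset.card_le_two

lemma card_image_cell_le_coveringNumber {j : ℕ} {S : Finset ℝ} {E : Set ℝ}
    (hE : E ⊆ Icc 1 2) (hS : (S : Set ℝ) ⊆ E) :
    (S.image (cell j)).card ≤ 2 * coveringNumber E (((2 : ℝ) ^ j)⁻¹) := by
  -- The infimum of the empty set of naturals is zero, so the existence of some finite cover has to
  -- be checked before the minimum is used.
  have hne : {n : ℕ | ∃ T : Finset ℝ, T.card = n ∧
      E ⊆ ⋃ a ∈ T, Set.Icc a (a + ((2 : ℝ) ^ j)⁻¹)}.Nonempty := by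
    refine ⟨_, (Finset.range (2 ^ j + 1)).image fun k : ℕ => 1 + (k : ℝ) * ((2 : ℝ) ^ j)⁻¹,
      rfl, fun t ht => ?_⟩
    obtain ⟨h1, h2⟩ := hE ht
    have h0 : (0 : ℝ) < 2 ^ j := by positivity
    have hk1 := Nat.floor_le (show 0 ≤ 2 ^ j * (t - 1) by nlinarith)
    have hk2 := Nat.lt_floor_add_one (2 ^ j * (t - 1))
    set k := ⌊2 ^ j * (t - 1)⌋₊
    refine mem_iUnion₂.2 ⟨1 + (k : ℝ) * ((2 : ℝ) ^ j)⁻¹,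
      Finset.mem_image_of_mem _ (Finset.mem_range.2 ?_), ?_, ?_⟩
    · have : (k : ℝ) ≤ 2 ^ j := hk1.trans (by nlinarith)
      have : k ≤ 2 ^ j := by exact_mod_cast this
      omega
    · have : (k : ℝ) * ((2 : ℝ) ^ j)⁻¹ ≤ t - 1 := by
        rw [← div_eq_mul_inv, div_le_iff₀ h0]; linarith
      linarith
    · have : t - 1 ≤ (k + 1 : ℝ) * ((2 : ℝ) ^ j)⁻¹ := by
        rw [← div_eq_mul_inv, le_div_iff₀ h0]; linarith
      linarith
  obtain ⟨T, hT, hET⟩ := Nat.sInf_mem hne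
  refine (card_image_cell_le (hS.trans hET)).trans ?_
  rw [hT]; rfl

lemma two_pow_inv_mem_Ioo {j : ℕ} (hj : j ≠ 0) : ((2 : ℝ) ^ j)⁻¹ ∈ Ioo (0 : ℝ) 1 :=
  ⟨by positivity, inv_lt_one_of_one_lt₀ (one_lt_pow₀ (by norm_num) hj)⟩

lemma card_image_cell_zero_le {S : Finset ℝ} (hS : (S : Set ℝ) ⊆ Icc 1 2) :
    (S.image (cell 0)).card ≤ 2 := by
  have : (S : Set ℝ) ⊆ ⋃ a ∈ ({1} : Finset ℝ), Icc a (a + ((2 : ℝ) ^ 0)⁻¹) := by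
    refine hS.trans ?_
    norm_num
  simpa using card_image_cell_le this

lemma MinkowskiBound.exists_card_le {E : Set ℝ} {β : ℝ} (h : MinkowskiBound E β)
    (hE : E ⊆ Icc 1 2) :
    ∃ A : ℝ, 0 ≤ A ∧ ∀ (j : ℕ) (S : Finset ℝ), (S : Set ℝ) ⊆ E →
      ((S.image (cell j)).card : ℝ) ≤ A * 2 ^ (β * (j : ℝ)) := by
  obtain ⟨C, hC⟩ := h
  refine ⟨max (2 * C) 2, le_max_of_le_right (by norm_num), fun j S hS => ?_⟩
  -- For `j = 0` the length is `δ = 1`, outside the range of the hypothesis; there `[1, 2]` meets at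
  -- most two cells.
  rcases eq_or_ne j 0 with rfl | hj
  · have : ((S.image (cell 0)).card : ℝ) ≤ 2 := by
      exact_mod_cast card_image_cell_zero_le (hS.trans hE)
    simpa using Or.inr this
  · have h1 := hC _ (two_pow_inv_mem_Ioo hj)
    have h2 : ((S.image (cell j)).card : ℝ) ≤ 2 * coveringNumber E (((2 : ℝ) ^ j)⁻¹) := by
      exact_mod_cast card_image_cell_le_coveringNumber hE hS
    have h3 : (((2 : ℝ) ^ j)⁻¹) ^ β = (2 ^ (β * (j : ℝ)))⁻¹ := by
      rw [Real.inv_rpow (by positivity), ← Real.rpow_natCast, ← Real.rpow_mul (by norm_num),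
        mul_comm]
    rw [h3, inv_mul_le_iff₀ (by positivity)] at h1
    calc _ ≤ 2 * (coveringNumber E (((2 : ℝ) ^ j)⁻¹) : ℝ) := h2
      _ ≤ 2 * (2 ^ (β * (j : ℝ)) * C) := by gcongr
      _ = 2 * C * 2 ^ (β * (j : ℝ)) := by ring
      _ ≤ _ := by gcongr; exact le_max_left _ _

lemma AssouadBound.minkowskiBound {E : Set ℝ} {γ : ℝ} (h : AssouadBound E γ)
    (hE : E ⊆ Icc 1 2) : MinkowskiBound E γ := by
  obtain ⟨C, hC⟩ := h
  refine ⟨C, fun δ hδ => ?_⟩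
  have := hC δ hδ 1 ⟨hδ.2.le, le_rfl⟩ 1
  rwa [div_one, inter_eq_left.2 (by norm_num; exact hE)] at this

lemma AssouadBound.exists_card_le {E : Set ℝ} {γ : ℝ} (h : AssouadBound E γ) (hγ : 0 ≤ γ)
    (hE : E ⊆ Icc 1 2) :
    ∃ A : ℝ, 0 ≤ A ∧ ∀ (j : ℕ) (S : Finset ℝ), (S : Set ℝ) ⊆ E → ∀ (i : ℤ) (m : ℕ),
      (((S.image (cell j)).filter fun i' : ℤ => |(i' : ℝ) - i| ≤ 2 ^ (m + 1)).card : ℝ) ≤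
        A * 2 ^ (γ * (m : ℝ)) := by
  obtain ⟨A₁, hA₁, h₁⟩ := (h.minkowskiBound hE).exists_card_le hE
  obtain ⟨C, hC⟩ := h
  set A := max A₁ (2 * C)
  have hA : 0 ≤ A := le_max_of_le_left hA₁
  refine ⟨A * 2 ^ (γ * 3), by positivity, fun j S hS i m => ?_⟩
  rw [mul_assoc, ← Real.rpow_add (by norm_num), ← mul_add]
  -- The cells within `2^(m+1)` of `i` lie in an interval of length `2^(m+3-j)`, with room for the
  -- width of the last cell. If that length exceeds one, the Assouad condition is silent and the
  -- global count takes over.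
  rcases le_or_gt (m + 3) j with hm | hm
  · set a : ℝ := ((i : ℝ) - 2 ^ (m + 1)) / 2 ^ j
    set ℓ : ℝ := 2 ^ (m + 3) / 2 ^ j with hℓ
    have h0 : (0 : ℝ) < 2 ^ j := by positivity
    have hℓ1 : ℓ ≤ 1 := by
      rw [div_le_one h0]
      exact pow_le_pow_right₀ (by norm_num) hm
    have hℓ0 : ((2 : ℝ) ^ j)⁻¹ ≤ ℓ := by
      rw [hℓ, inv_eq_one_div]
      gcongr
      exact one_le_pow₀ (by norm_num)
    set S' := S.filter fun t => t ∈ Icc a (a + ℓ)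
    have hS' : (S' : Set ℝ) ⊆ E ∩ Icc a (a + ℓ) := fun t ht => by
      have := Finset.mem_filter.1 (Finset.mem_coe.1 ht)
      exact ⟨hS this.1, this.2⟩
    have hsub : (S.image (cell j)).filter (fun i' : ℤ => |(i' : ℝ) - i| ≤ 2 ^ (m + 1)) ⊆
        S'.image (cell j) := by
      intro i' hi'
      obtain ⟨h1, h2⟩ := Finset.mem_filter.1 hi'
      obtain ⟨t, ht, rfl⟩ := Finset.mem_image.1 h1
      refine Finset.mem_image_of_mem _ (Finset.mem_filter.2 ⟨ht, ?_, ?_⟩)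
      · rw [div_le_iff₀ h0]
        linarith [(abs_le.1 h2).1, cell_le j t]
      · rw [← add_div, le_div_iff₀ h0]
        have : (1 : ℝ) ≤ 2 ^ m := one_le_pow₀ (by norm_num)
        rw [pow_succ] at h2
        rw [pow_succ, pow_add]
        linarith [(abs_le.1 h2).2, lt_cell_add_one j t]
    have h2 : ((S'.image (cell j)).card : ℝ) ≤
        2 * coveringNumber (E ∩ Icc a (a + ℓ)) (((2 : ℝ) ^ j)⁻¹) := by
      exact_mod_cast card_image_cell_le_coveringNumber (inter_subset_left.trans hE) hS'
    have h1 := hC _ (two_pow_inv_mem_Ioo (j := j) (by omega)) ℓ ⟨hℓ0, hℓ1⟩ a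
    have h3 : (((2 : ℝ) ^ j)⁻¹ / ℓ) ^ γ = (2 ^ (γ * ((m : ℝ) + 3)))⁻¹ := by
      have : ((2 : ℝ) ^ j)⁻¹ / ℓ = (2 ^ (m + 3))⁻¹ := by rw [hℓ]; field_simp
      rw [this, Real.inv_rpow (by positivity), ← Real.rpow_natCast,
        ← Real.rpow_mul (by norm_num), mul_comm γ]
      push_cast; rfl
    rw [h3, inv_mul_le_iff₀ (by positivity)] at h1
    calc _ ≤ ((S'.image (cell j)).card : ℝ) := by exact_mod_cast Finset.card_le_card hsub
      _ ≤ 2 * (coveringNumber (E ∩ Icc a (a + ℓ)) (((2 : ℝ) ^ j)⁻¹) : ℝ) := h2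
      _ ≤ 2 * (2 ^ (γ * ((m : ℝ) + 3)) * C) := by gcongr
      _ = 2 * C * 2 ^ (γ * ((m : ℝ) + 3)) := by ring
      _ ≤ A * 2 ^ (γ * (3 + (m : ℝ))) := by
        rw [add_comm (3 : ℝ)]; gcongr; exact le_max_right _ _
  · calc _ ≤ ((S.image (cell j)).card : ℝ) := by
          exact_mod_cast Finset.card_le_card (Finset.filter_subset _ _)
      _ ≤ A₁ * 2 ^ (γ * (j : ℝ)) := h₁ j S hS
      _ ≤ A * 2 ^ (γ * (3 + (m : ℝ))) := by
        gcongr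
        · exact le_max_left _ _
        · norm_num
        · have : (j : ℝ) ≤ m + 3 := by exact_mod_cast hm.le
          linarith

/-! ### Bounds for the pieces and for their sum -/

variable {d : ℕ} [NeZero d]

lemma measurable_iSup_piece (j : ℕ) (f : 𝓢(EuclideanSpace ℝ (Fin d), ℂ)) {S : Finset ℝ}
    (hS : (S : Set ℝ) ⊆ Icc 1 2) :
    Measurable fun x => ⨆ t ∈ S, ‖sphericalMean t (piece j f) x‖ₑ := by
  refine .biSup _ S.countable_toSet fun t ht => ?_
  have := funext fun x => sphericalMean_piece j f (t := t) (by linarith [(hS ht).1]) x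
  rw [this]
  exact (continuous_pieceMean j f t).measurable.enorm

lemma exists_lintegral_iSup_piece_le_card (d : ℕ) [NeZero d] :
    ∃ C : ℝ≥0, ∀ (j : ℕ) (f : 𝓢(EuclideanSpace ℝ (Fin d), ℂ)) (S : Finset ℝ),
      (S : Set ℝ) ⊆ Icc 1 2 →
      ∫⁻ x, ⨆ t ∈ S, ‖sphericalMean t (piece j f) x‖ₑ ≤
        C * (S.image (cell j)).card * ∫⁻ z, ‖f z‖ₑ := by
  obtain ⟨C, hC⟩ := exists_lintegral_iSup_piece_le d
  refine ⟨C, fun j f S hS => ?_⟩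
  set T : ℤ → Finset ℝ := fun i => S.filter fun t => cell j t = i
  have hT : ∀ i, (T i : Set ℝ) ⊆ Icc 1 2 := fun i =>
    (Finset.coe_subset.2 (Finset.filter_subset _ _)).trans hS
  calc _ ≤ ∫⁻ x, ∑ i ∈ S.image (cell j), ⨆ t ∈ T i, ‖sphericalMean t (piece j f) x‖ₑ := by
        refine lintegral_mono fun x => iSup₂_le fun t ht => ?_
        refine le_trans ?_ (Finset.single_le_sum (f := fun i => ⨆ t ∈ T i,
          ‖sphericalMean t (piece j f) x‖ₑ) (fun _ _ => zero_le)
          (Finset.mem_image_of_mem (cell j) ht))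
        exact le_iSup₂_of_le t (Finset.mem_filter.2 ⟨ht, rfl⟩) le_rfl
    _ = ∑ i ∈ S.image (cell j), ∫⁻ x, ⨆ t ∈ T i, ‖sphericalMean t (piece j f) x‖ₑ :=
        lintegral_finsetSum _ fun i _ => measurable_iSup_piece j f (hT i)
    _ ≤ ∑ i ∈ S.image (cell j), (C : ℝ≥0∞) * ∫⁻ z, ‖f z‖ₑ := by
        refine Finset.sum_le_sum fun i hi => ?_
        refine hC j f ((i : ℝ) / 2 ^ j) (T i) fun t ht => ?_
        have := mem_Icc_of_cell_eq (Finset.mem_filter.1 (Finset.mem_coe.1 ht)).2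
        rw [abs_of_nonneg (by linarith [this.1])]
        linarith [this.2]
    _ = _ := by
        rw [Finset.sum_const, nsmul_eq_mul]; ring

lemma exists_lintegral_iSup_piece_sq_le_card (d : ℕ) [NeZero d] :
    ∃ C : ℝ, 0 ≤ C ∧ ∀ (j : ℕ) (f : 𝓢(EuclideanSpace ℝ (Fin d), ℂ)) (S : Finset ℝ),
      (S : Set ℝ) ⊆ Icc 1 2 →
      ∫⁻ x, (⨆ t ∈ S, ‖sphericalMean t (piece j f) x‖ₑ) ^ 2 ≤
        (S.image (cell j)).card * (ENNReal.ofReal (C * ((2 ^ j) ^ (d - 1))⁻¹) *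
          ∫⁻ z, ‖f z‖ₑ ^ 2) := by
  obtain ⟨C, hC0, hC⟩ := exists_lintegral_iSup_piece_sq_le d
  refine ⟨C, hC0, fun j f S hS => ?_⟩
  set T : ℤ → Finset ℝ := fun i => S.filter fun t => cell j t = i
  have hT : ∀ i, (T i : Set ℝ) ⊆ Icc 1 2 := fun i =>
    (Finset.coe_subset.2 (Finset.filter_subset _ _)).trans hS
  calc _ ≤ ∫⁻ x, ∑ i ∈ S.image (cell j), (⨆ t ∈ T i, ‖sphericalMean t (piece j f) x‖ₑ) ^ 2 := by
        refine lintegral_mono fun x => ?_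
        refine iSup_sq_le (T := (S : Set ℝ)) fun t ht => ?_
        refine le_trans ?_ (Finset.single_le_sum (f := fun i => (⨆ t ∈ T i,
          ‖sphericalMean t (piece j f) x‖ₑ) ^ 2) (fun _ _ => zero_le)
          (Finset.mem_image_of_mem (cell j) ht))
        gcongr
        exact le_iSup₂_of_le t (Finset.mem_filter.2 ⟨ht, rfl⟩) le_rfl
    _ = ∑ i ∈ S.image (cell j), ∫⁻ x, (⨆ t ∈ T i, ‖sphericalMean t (piece j f) x‖ₑ) ^ 2 :=
        lintegral_finsetSum _ fun i _ => (measurable_iSup_piece j f (hT i)).pow_const 2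
    _ ≤ ∑ i ∈ S.image (cell j), ENNReal.ofReal (C * ((2 ^ j) ^ (d - 1))⁻¹) *
          ∫⁻ z, ‖f z‖ₑ ^ 2 := by
        refine Finset.sum_le_sum fun i hi => ?_
        obtain ⟨t₀, ht₀, rfl⟩ := Finset.mem_image.1 hi
        exact hC j f _ (T (cell j t₀)) (one_le_cell_div (hS ht₀).1) fun t ht =>
          mem_Icc_of_cell_eq (Finset.mem_filter.1 (Finset.mem_coe.1 ht)).2
    _ = _ := by
        rw [Finset.sum_const, nsmul_eq_mul]

end SphericalMax

end

set_option linter.unusedSectionVars false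

noncomputable section

namespace SphericalMax

open Metric Set
open scoped FourierTransform SchwartzMap

/-! ### Restricted estimates for Schwartz functions -/

/-- The restricted type estimate `∫_G M f ≤ C ‖f‖₁ ^ x |G| ^ w` for Schwartz functions bounded by
one, uniformly over the finite sets of radii in `E`. -/
def SchwartzRestricted (d : ℕ) (E : Set ℝ) (x w : ℝ) : Prop :=
  ∃ C : ℝ≥0, ∀ S : Finset ℝ, (S : Set ℝ) ⊆ E →
    ∀ f : 𝓢(EuclideanSpace ℝ (Fin d), ℂ), (∀ z, ‖f z‖ ≤ 1) →
    ∀ G : Set (EuclideanSpace ℝ (Fin d)), MeasurableSet G → volume G ≠ ∞ →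
      ∫⁻ z in G, ⨆ t ∈ S, ‖sphericalMean t f z‖ₑ ≤ C * ((∫⁻ z, ‖f z‖ₑ) ^ x * volume G ^ w)

/-- The estimate for the pieces, with the factor `2 ^ (c j)`. -/
def PieceRestricted (d : ℕ) (E : Set ℝ) (c x w : ℝ) : Prop :=
  ∃ C : ℝ, 0 ≤ C ∧ ∀ (j : ℕ) (S : Finset ℝ), (S : Set ℝ) ⊆ E →
    ∀ f : 𝓢(EuclideanSpace ℝ (Fin d), ℂ), (∀ z, ‖f z‖ ≤ 1) →
    ∀ G : Set (EuclideanSpace ℝ (Fin d)), MeasurableSet G → volume G ≠ ∞ →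
      ∫⁻ z in G, ⨆ t ∈ S, ‖sphericalMean t (piece j f) z‖ₑ ≤
        ENNReal.ofReal (C * ((∫⁻ z, ‖f z‖ₑ).toReal ^ x * volume.real G ^ w) *
          2 ^ (c * (j : ℝ)))

lemma lintegral_enorm_schwartz_ne_top {d : ℕ} (f : 𝓢(EuclideanSpace ℝ (Fin d), ℂ)) :
    ∫⁻ z, ‖f z‖ₑ ≠ ∞ := (f.integrable (μ := volume)).2.ne

lemma lintegral_enorm_sq_le_of_norm_le_one {d : ℕ} {f : 𝓢(EuclideanSpace ℝ (Fin d), ℂ)}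
    (hf : ∀ z, ‖f z‖ ≤ 1) : ∫⁻ z, ‖f z‖ₑ ^ 2 ≤ ∫⁻ z, ‖f z‖ₑ := by
  refine lintegral_mono fun z => pow_le_of_le_one zero_le ?_ two_ne_zero
  rw [← ofReal_norm, ← ENNReal.ofReal_one]
  exact ENNReal.ofReal_le_ofReal (hf z)

lemma le_ofReal_rpow_of_sq_le {X : ℝ≥0∞} {c : ℝ} (hc : 0 ≤ c) (h : X ^ 2 ≤ ENNReal.ofReal c) :
    X ≤ ENNReal.ofReal (c ^ (2 : ℝ)⁻¹) := by
  rw [← ENNReal.ofReal_rpow_of_nonneg hc (by norm_num), ENNReal.le_rpow_inv_iff (by norm_num),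
    ENNReal.rpow_ofNat]
  exact h

variable {d : ℕ} [NeZero d]

/-- Bourgain's interpolation: for each `f` and `G` the better of the two bounds is used for each
piece. The sum over `j` is dominated by the crossing value, whose exponents are the stated convex
combinations. -/
lemma PieceRestricted.schwartzRestricted {E : Set ℝ} {a b x₀ w₀ x₁ w₁ : ℝ}
    (ha : 0 < a) (hb : 0 < b) (hx₀ : 0 ≤ x₀) (hw₀ : 0 ≤ w₀) (hx₁ : 0 ≤ x₁) (hw₁ : 0 ≤ w₁)
    (hE : E ⊆ Icc 1 2) (h₀ : PieceRestricted d E a x₀ w₀) (h₁ : PieceRestricted d E (-b) x₁ w₁) :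
    SchwartzRestricted d E (x₀ * (b / (a + b)) + x₁ * (a / (a + b)))
      (w₀ * (b / (a + b)) + w₁ * (a / (a + b))) := by
  obtain ⟨C₀, hC₀, h₀⟩ := h₀
  obtain ⟨C₁, hC₁, h₁⟩ := h₁
  obtain ⟨C, hC⟩ := exists_tsum_min_le ha hb
  set θ := b / (a + b)
  set θ' := a / (a + b)
  have hθ : 0 ≤ θ := by positivity
  have hθ' : 0 ≤ θ' := by positivity
  refine ⟨C * (C₀ ^ θ * C₁ ^ θ').toNNReal, fun S hS f hf G hG hGfin => ?_⟩
  have hF := lintegral_enorm_schwartz_ne_top f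
  set F := ∫⁻ z, ‖f z‖ₑ
  set r := F.toReal
  have hr : 0 ≤ r := ENNReal.toReal_nonneg
  set g := volume.real G
  have hg : 0 ≤ g := measureReal_nonneg
  have hSI := hS.trans hE
  calc ∫⁻ z in G, ⨆ t ∈ S, ‖sphericalMean t f z‖ₑ
      ≤ ∫⁻ z in G, ∑' j, ⨆ t ∈ S, ‖sphericalMean t (piece j f) z‖ₑ := by
        refine lintegral_mono fun z => iSup₂_le fun t ht => ?_
        refine (sphericalMean_le_tsum_piece f t z).trans (ENNReal.tsum_le_tsum fun j => ?_)
        exact le_iSup₂_of_le (f := fun t (_ : t ∈ S) => ‖sphericalMean t (piece j f) z‖ₑ)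
          t ht le_rfl
    _ = ∑' j, ∫⁻ z in G, ⨆ t ∈ S, ‖sphericalMean t (piece j f) z‖ₑ :=
        lintegral_tsum fun j => (measurable_iSup_piece j f hSI).aemeasurable
    _ ≤ ∑' j : ℕ, ENNReal.ofReal (min (C₀ * (r ^ x₀ * g ^ w₀) * 2 ^ (a * (j : ℝ)))
          (C₁ * (r ^ x₁ * g ^ w₁) * 2 ^ (-b * (j : ℝ)))) := by
        refine ENNReal.tsum_le_tsum fun j => ?_
        rw [ENNReal.ofReal_min]
        exact le_min (h₀ j S hS f hf G hG hGfin) (h₁ j S hS f hf G hG hGfin)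
    _ ≤ C * ENNReal.ofReal ((C₀ * (r ^ x₀ * g ^ w₀)) ^ θ * (C₁ * (r ^ x₁ * g ^ w₁)) ^ θ') :=
        hC _ _ (by positivity) (by positivity)
    _ = _ := by
        have e1 : F ^ (x₀ * θ + x₁ * θ') = ENNReal.ofReal (r ^ (x₀ * θ + x₁ * θ')) := by
          rw [← ENNReal.ofReal_rpow_of_nonneg hr (by positivity), ENNReal.ofReal_toReal hF]
        have e2 : volume G ^ (w₀ * θ + w₁ * θ') = ENNReal.ofReal (g ^ (w₀ * θ + w₁ * θ')) := by
          rw [← ENNReal.ofReal_rpow_of_nonneg hg (by positivity), ofReal_measureReal hGfin]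
        rw [e1, e2, ENNReal.coe_mul, mul_assoc]
        congr 1
        change _ = ENNReal.ofReal _ * _
        rw [← ENNReal.ofReal_mul (by positivity), ← ENNReal.ofReal_mul (by positivity)]
        congr 1
        rw [Real.rpow_add_of_nonneg hr (by positivity) (by positivity),
          Real.rpow_add_of_nonneg hg (by positivity) (by positivity),
          Real.mul_rpow hC₀ (by positivity), Real.mul_rpow hC₁ (by positivity),
          Real.mul_rpow (by positivity) (by positivity),
          Real.mul_rpow (by positivity) (by positivity),
          Real.rpow_mul hr, Real.rpow_mul hr, Real.rpow_mul hg, Real.rpow_mul hg]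
        ring

lemma pieceRestricted_one_zero {E : Set ℝ} {β : ℝ} (hE : E ⊆ Icc 1 2) (h : MinkowskiBound E β) :
    PieceRestricted d E β 1 0 := by
  obtain ⟨A, hA, hcard⟩ := h.exists_card_le hE
  obtain ⟨C, hC⟩ := exists_lintegral_iSup_piece_le_card d
  refine ⟨C * A, by positivity, fun j S hS f hf G hG hGfin => ?_⟩
  refine (setLIntegral_le_lintegral _ _).trans ((hC j f S (hS.trans hE)).trans ?_)
  have hF := lintegral_enorm_schwartz_ne_top f
  rw [Real.rpow_one, Real.rpow_zero, mul_one,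
    show (C : ℝ) * A * (∫⁻ z, ‖f z‖ₑ).toReal * 2 ^ (β * (j : ℝ)) =
      C * (A * 2 ^ (β * (j : ℝ))) * (∫⁻ z, ‖f z‖ₑ).toReal by ring,
    ENNReal.ofReal_mul (by positivity), ENNReal.ofReal_mul (by positivity),
    ENNReal.ofReal_toReal hF, ENNReal.ofReal_coe_nnreal]
  gcongr
  rw [← ENNReal.ofReal_natCast]
  exact ENNReal.ofReal_le_ofReal (hcard j S hS)

lemma pieceRestricted_one_one {E : Set ℝ} (hE : E ⊆ Icc 1 2) : PieceRestricted d E 1 1 1 := by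
  obtain ⟨C, hC⟩ := exists_sphericalMean_piece_le d
  refine ⟨C, by positivity, fun j S hS f hf G hG hGfin => ?_⟩
  have hF := lintegral_enorm_schwartz_ne_top f
  calc _ ≤ ∫⁻ _ in G, C * 2 ^ j * ∫⁻ z, ‖f z‖ₑ :=
        lintegral_mono fun z => iSup₂_le fun t ht => hC j f t (hE (hS ht)) z
    _ = _ := by
        rw [setLIntegral_const, Real.rpow_one, Real.rpow_one, one_mul, Real.rpow_natCast,
          ENNReal.ofReal_mul (by positivity), ENNReal.ofReal_mul (by positivity),
          ENNReal.ofReal_mul (by positivity), ENNReal.ofReal_toReal hF,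
          ofReal_measureReal hGfin, ENNReal.ofReal_coe_nnreal,
          ENNReal.ofReal_pow (by norm_num), ENNReal.ofReal_ofNat]
        ring

/-- Cauchy–Schwarz on `G` and the one-cell `L²` bound summed over about `2^(βj)` cells. The bound
`|f| ≤ 1` replaces the `L²` norm of `f` by a power of its `L¹` norm. -/
lemma pieceRestricted_half_half {E : Set ℝ} {β : ℝ} (hE : E ⊆ Icc 1 2)
    (h : MinkowskiBound E β) : PieceRestricted d E (-((d - 1 - β) / 2)) 2⁻¹ 2⁻¹ := by
  obtain ⟨A, hA, hcard⟩ := h.exists_card_le hE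
  obtain ⟨C, hC0, hC⟩ := exists_lintegral_iSup_piece_sq_le_card d
  refine ⟨(A * C) ^ (2 : ℝ)⁻¹, by positivity, fun j S hS f hf G hG hGfin => ?_⟩
  have hF := lintegral_enorm_schwartz_ne_top f
  set F := ∫⁻ z, ‖f z‖ₑ
  set r := F.toReal
  have hr : 0 ≤ r := ENNReal.toReal_nonneg
  set g := volume.real G
  have hg : 0 ≤ g := measureReal_nonneg
  have hSI := hS.trans hE
  have key : (∫⁻ z in G, ⨆ t ∈ S, ‖sphericalMean t (piece j f) z‖ₑ) ^ 2 ≤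
      ENNReal.ofReal (g * ((A * 2 ^ (β * (j : ℝ))) * (C * ((2 ^ j) ^ (d - 1))⁻¹ * r))) := by
    refine (sq_lintegral_le (measurable_iSup_piece j f hSI).aemeasurable).trans ?_
    rw [Measure.restrict_apply_univ, ENNReal.ofReal_mul hg, ENNReal.ofReal_mul (by positivity),
      ENNReal.ofReal_mul (q := r) (by positivity), ENNReal.ofReal_toReal hF,
      ofReal_measureReal hGfin]
    refine mul_le_mul_right ((setLIntegral_le_lintegral _ _).trans
      ((hC j f S hSI).trans ?_)) _
    gcongr
    · rw [← ENNReal.ofReal_natCast]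
      exact ENNReal.ofReal_le_ofReal (hcard j S hS)
    · exact lintegral_enorm_sq_le_of_norm_le_one hf
  refine (le_ofReal_rpow_of_sq_le (by positivity) key).trans (le_of_eq ?_)
  congr 1
  have e : ((((2 : ℝ) ^ j) ^ (d - 1))⁻¹) * 2 ^ (β * (j : ℝ)) =
      (2 : ℝ) ^ (-(((d : ℝ) - 1 - β)) * (j : ℝ)) := by
    have hd1 : ((d - 1 : ℕ) : ℝ) = (d : ℝ) - 1 := by
      rw [Nat.cast_sub (Nat.one_le_iff_ne_zero.2 (NeZero.ne d))]; simp
    rw [← pow_mul, ← Real.rpow_natCast, ← Real.rpow_neg (by norm_num),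
      ← Real.rpow_add (by norm_num)]
    push_cast
    rw [hd1]
    congr 1; ring
  rw [show g * (A * 2 ^ (β * (j : ℝ)) * (C * (((2 : ℝ) ^ j) ^ (d - 1))⁻¹ * r)) =
      A * C * (r * g) * ((((2 : ℝ) ^ j) ^ (d - 1))⁻¹ * 2 ^ (β * (j : ℝ))) by ring, e,
    Real.mul_rpow (by positivity) (by positivity), Real.mul_rpow (by positivity) (by positivity),
    Real.mul_rpow hr hg, ← Real.rpow_mul (by norm_num)]
  congr 2
  ring

/-- With `θ = (d-1)/(2γ+d-1)`, the square of the integral is bounded by `‖f‖₂² (2^(-j(d-1)) |G|)^θ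
(2^j |G|²)^(1-θ)`. The powers combine to `2^(-j(dθ-1)) |G|^(2-θ)`, and a square root finishes. -/
lemma pieceRestricted_of_assouadBound {E : Set ℝ} {γ : ℝ} (hd : 2 ≤ d) (hE : E ⊆ Icc 1 2)
    (hγ : 0 < γ) (h : AssouadBound E γ) :
    PieceRestricted d E (-((d * ((d - 1) / (2 * γ + d - 1)) - 1) / 2)) 2⁻¹
      (1 - (d - 1) / (2 * γ + d - 1) / 2) := by
  obtain ⟨A, hA, hcard⟩ := h.exists_card_le hγ.le hE
  obtain ⟨C, hC0, hC⟩ := exists_sq_lintegral_iSup_piece_le hd hγ hA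
  refine ⟨C ^ (2 : ℝ)⁻¹, by positivity, fun j S hS f hf G hG hGfin => ?_⟩
  have hF := lintegral_enorm_schwartz_ne_top f
  set F := ∫⁻ z, ‖f z‖ₑ
  set r := F.toReal
  have hr : 0 ≤ r := ENNReal.toReal_nonneg
  have hg : 0 ≤ volume.real G := measureReal_nonneg
  have hd2 : (2 : ℝ) ≤ d := by exact_mod_cast hd
  have hd1 : ((d - 1 : ℕ) : ℝ) = (d : ℝ) - 1 := by
    rw [Nat.cast_sub (by omega)]; simp
  have key := hC j S (hS.trans hE) (hcard j S hS) f G hG hGfin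
  rw [hd1] at key
  set g := volume.real G
  set θ : ℝ := (d - 1) / (2 * γ + d - 1) with hθ
  have hden : 0 < 2 * γ + (d : ℝ) - 1 := by linarith
  have hθ0 : 0 ≤ θ := div_nonneg (by linarith) hden.le
  have hθ1 : θ ≤ 1 := by rw [hθ, div_le_one hden]; linarith
  have e1 : ((d : ℝ) - 1) / 2 / (γ + ((d : ℝ) - 1) / 2) = θ := by
    rw [hθ, div_eq_div_iff (by linarith) hden.ne']; ring
  have e2 : γ / (γ + ((d : ℝ) - 1) / 2) = 1 - θ := by
    rw [hθ, div_eq_iff (by linarith), sub_mul, div_mul_eq_mul_div, one_mul,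
      eq_sub_iff_add_eq, ← eq_sub_iff_add_eq', div_eq_iff hden.ne']
    ring
  rw [e1, e2] at key
  have e3 : ((((2 : ℝ) ^ j) ^ (d - 1))⁻¹ * g) ^ θ * (2 ^ j * g ^ 2) ^ (1 - θ) =
      2 ^ (-(d * θ - 1) * (j : ℝ)) * g ^ (2 - θ) := by
    rw [← pow_mul, ← Real.rpow_natCast, ← Real.rpow_neg (by norm_num), ← Real.rpow_natCast,
      Real.mul_rpow (by positivity) hg, Real.mul_rpow (by positivity) (by positivity),
      ← Real.rpow_mul (by norm_num), ← Real.rpow_mul (by norm_num), ← Real.rpow_natCast,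
      ← Real.rpow_mul hg,
      show (2 : ℝ) - θ = θ + ((2 : ℕ) : ℝ) * (1 - θ) by push_cast; ring,
      Real.rpow_add_of_nonneg hg hθ0 (by push_cast; linarith),
      show -(d * θ - 1) * (j : ℝ) = -((j * (d - 1 : ℕ) : ℕ) : ℝ) * θ + (j : ℝ) * (1 - θ) by
        push_cast; rw [hd1]; ring, Real.rpow_add (by norm_num)]
    ring
  have key' : (∫⁻ z in G, ⨆ t ∈ S, ‖sphericalMean t (piece j f) z‖ₑ) ^ 2 ≤
      ENNReal.ofReal (C * (r * g ^ (2 - θ)) * 2 ^ (-(d * θ - 1) * (j : ℝ))) := by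
    refine key.trans ?_
    rw [e3, show C * (r * g ^ (2 - θ)) * (2 : ℝ) ^ (-(d * θ - 1) * (j : ℝ)) =
      r * (C * (2 ^ (-(d * θ - 1) * (j : ℝ)) * g ^ (2 - θ))) by ring,
      ENNReal.ofReal_mul hr, ENNReal.ofReal_toReal hF]
    gcongr
    exact lintegral_enorm_sq_le_of_norm_le_one hf
  refine (le_ofReal_rpow_of_sq_le (by positivity) key').trans (le_of_eq ?_)
  congr 1
  rw [Real.mul_rpow (by positivity) (by positivity), Real.mul_rpow hC0 (by positivity),
    Real.mul_rpow hr (by positivity), ← Real.rpow_mul hg, ← Real.rpow_mul (by norm_num)]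
  rw [show (2 - θ) * 2⁻¹ = 1 - θ / 2 by ring,
    show -(d * θ - 1) * (j : ℝ) * 2⁻¹ = -((d * θ - 1) / 2) * (j : ℝ) by ring]

/-- Each single mean is a contraction of `L¹`, so boundedly many radii need no cancellation. -/
lemma schwartzRestricted_one_zero_of_card {E : Set ℝ} {A : ℝ≥0}
    (h : ∀ S : Finset ℝ, (S : Set ℝ) ⊆ E → (S.card : ℝ≥0∞) ≤ A) :
    SchwartzRestricted d E 1 0 := by
  refine ⟨A, fun S hS f _ G _ _ => ?_⟩
  rw [ENNReal.rpow_one, ENNReal.rpow_zero, mul_one]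
  have hm : Measurable fun z : EuclideanSpace ℝ (Fin d) => ‖f z‖ₑ :=
    f.continuous.measurable.enorm
  calc _ ≤ ∫⁻ z, ∑ t ∈ S, avg t (fun z => ‖f z‖ₑ) z := by
        refine (setLIntegral_le_lintegral _ _).trans
          (lintegral_mono fun z => iSup₂_le fun t ht => ?_)
        refine le_trans (enorm_integral_le_lintegral_enorm _) ?_
        exact Finset.single_le_sum (f := fun t => avg t (fun z => ‖f z‖ₑ) z)
          (fun _ _ => zero_le) ht
    _ = ∑ t ∈ S, ∫⁻ z, ‖f z‖ₑ := by
        rw [lintegral_finsetSum _ fun t _ => measurable_avg hm]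
        exact Finset.sum_congr rfl fun t _ => lintegral_avg hm
    _ ≤ _ := by
        rw [Finset.sum_const, nsmul_eq_mul]
        gcongr
        exact h S hS

/-- At fine scales distinct radii occupy distinct cells, so a count of cells that is bounded
uniformly in `j` bounds the number of radii. -/
lemma exists_card_image_cell_eq (S : Finset ℝ) : ∃ j : ℕ, (S.image (cell j)).card = S.card := by
  have h : ∀ᶠ j : ℕ in Filter.atTop, ∀ s ∈ S, ∀ t ∈ S, cell j s = cell j t → s = t := by
    rw [Filter.eventually_all_finset]
    intro s _
    rw [Filter.eventually_all_finset]
    intro t _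
    rcases eq_or_ne s t with rfl | hst
    · exact .of_forall fun _ _ => rfl
    · have h1 : Filter.Tendsto (fun j : ℕ => (2 : ℝ) ^ j * |s - t|) Filter.atTop Filter.atTop :=
        (tendsto_pow_atTop_atTop_of_one_lt (by norm_num)).atTop_mul_const
          (abs_pos.2 (sub_ne_zero.2 hst))
      filter_upwards [h1.eventually_ge_atTop 1] with j hj he
      exfalso
      have h2 := mem_Icc_of_cell_eq he
      have a1 := cell_le j s
      have a2 := lt_cell_add_one j s
      have b1 := cell_le j t
      have b2 := lt_cell_add_one j t
      rw [he] at a1 a2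
      have : |2 ^ j * (s - t)| < 1 := by rw [abs_lt]; constructor <;> nlinarith
      rw [abs_mul, abs_of_pos (by positivity)] at this
      linarith
  obtain ⟨j, hj⟩ := h.exists
  exact ⟨j, Finset.card_image_of_injOn fun s hs t ht => hj s hs t ht⟩

lemma schwartzRestricted_Q₂ {E : Set ℝ} {β : ℝ} (hE : E ⊆ Icc 1 2) (hβ : 0 ≤ β)
    (hβd : β < d - 1) (h : MinkowskiBound E β) :
    SchwartzRestricted d E (Q₂ d β).1 (1 - (Q₂ d β).2) := by
  have hpos : 0 < (d : ℝ) - 1 + β := by linarith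
  -- For `β = 0` the `L¹` bound does not grow with `j` and the progressions never cross; instead `E`
  -- has boundedly many points and `L¹ → L¹` is immediate.
  rcases hβ.eq_or_lt with rfl | hβ
  · obtain ⟨A, hA, hcard⟩ := h.exists_card_le hE
    have e : ((d : ℝ) - 1) / (d - 1 + 0) = 1 := by rw [add_zero, div_self (by linarith)]
    simp only [Q₂, e, sub_self]
    refine schwartzRestricted_one_zero_of_card (A := A.toNNReal) fun S hS => ?_
    obtain ⟨j, hj⟩ := exists_card_image_cell_eq S
    have := hcard j S hS
    rw [hj, zero_mul, Real.rpow_zero, mul_one] at this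
    rw [← ENNReal.ofReal_natCast]
    exact ENNReal.ofReal_le_ofReal this
  · have := PieceRestricted.schwartzRestricted (b := (d - 1 - β) / 2) hβ (by linarith) zero_le_one
      le_rfl (by norm_num) (by norm_num) hE (pieceRestricted_one_zero (d := d) hE h)
      (pieceRestricted_half_half hE h)
    have hne := hpos.ne'
    rw [show β + ((d : ℝ) - 1 - β) / 2 = (d - 1 + β) / 2 by ring] at this
    convert this using 1 <;> simp only [Q₂] <;> field_simp <;> ring

lemma schwartzRestricted_Q₃ {E : Set ℝ} {β : ℝ} (hE : E ⊆ Icc 1 2)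
    (hβd : β < d - 1) (h : MinkowskiBound E β) :
    SchwartzRestricted d E (Q₃ d β).1 (1 - (Q₃ d β).2) := by
  have := PieceRestricted.schwartzRestricted (b := (d - 1 - β) / 2) one_pos (by linarith)
    zero_le_one zero_le_one (by norm_num) (by norm_num) hE (pieceRestricted_one_one (d := d) hE)
    (pieceRestricted_half_half hE h)
  rw [show 1 + ((d : ℝ) - 1 - β) / 2 = (d - β + 1) / 2 by ring] at this
  have hden' : (d : ℝ) - β + 1 ≠ 0 := by linarith
  convert this using 1 <;> simp only [Q₃] <;> field_simp <;> ring

lemma schwartzRestricted_Q₄ {E : Set ℝ} {γ : ℝ} (hd : 2 ≤ d) (hE : E ⊆ Icc 1 2) (hγ : 0 ≤ γ)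
    (hγd : 2 * γ < ((d : ℝ) - 1) ^ 2) (h : AssouadBound E γ) :
    SchwartzRestricted d E (Q₄ d γ).1 (1 - (Q₄ d γ).2) := by
  have hd2 : (2 : ℝ) ≤ d := by exact_mod_cast hd
  -- For `γ = 0` the number of neighbouring cells does not grow with `m`, so the sum over distances
  -- has no crossing; but then `Q₄` coincides with `Q₃` at `β = 0`.
  rcases hγ.eq_or_lt with rfl | hγ
  · have := schwartzRestricted_Q₃ (d := d) hE (by linarith) (h.minkowskiBound hE)
    have e : Q₄ d 0 = Q₃ d 0 := by
      have h1 : (d : ℝ) ^ 2 + 2 * 0 - 1 ≠ 0 := by nlinarith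
      have h2 : (d : ℝ) - 0 + 1 ≠ 0 := by linarith
      simp only [Q₃, Q₄, Prod.mk.injEq]
      constructor <;> rw [div_eq_div_iff h1 h2] <;> ring
    rwa [e]
  · have hden : 0 < 2 * γ + (d : ℝ) - 1 := by linarith
    set θ : ℝ := (d - 1) / (2 * γ + d - 1) with hθ
    have hθ1 : θ ≤ 1 := by rw [hθ, div_le_one hden]; linarith
    -- This is `2γ < (d-1)²` rewritten, and it makes the `L²` improving bound decay in `j`.
    have hdθ : 1 < d * θ := by
      rw [hθ, ← mul_div_assoc, one_lt_div hden]; nlinarith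
    have := PieceRestricted.schwartzRestricted one_pos (by linarith) zero_le_one zero_le_one
      (by norm_num) (by linarith) hE (pieceRestricted_one_one (d := d) hE)
      (pieceRestricted_of_assouadBound hd hE hγ h)
    rw [← hθ] at this
    have hne : d * θ + 1 ≠ 0 := by linarith
    have hQ1 : (Q₄ d γ).1 = d * θ / (d * θ + 1) := by
      simp only [Q₄]
      rw [div_eq_div_iff (by nlinarith) hne, hθ]
      field_simp
      ring
    have hQ2 : (Q₄ d γ).2 = θ / (d * θ + 1) := by
      simp only [Q₄]
      rw [div_eq_div_iff (by nlinarith) hne, hθ]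
      field_simp
      ring
    rw [show 1 + (d * θ - 1) / 2 = (d * θ + 1) / 2 by ring] at this
    have hne' : θ * d + 1 ≠ 0 := by rwa [mul_comm]
    rw [hQ1, hQ2]
    convert this using 1 <;> field_simp <;> ring

end SphericalMax

end

set_option linter.unusedSectionVars false

noncomputable section

namespace SphericalMax

open Metric Set Filter Topology
open scoped SchwartzMap

/-! ### From Schwartz functions to characteristic functions -/

variable {d : ℕ}

/-- The maximal function of a nonnegative function. -/
def maxAvg (E : Set ℝ) (g : EuclideanSpace ℝ (Fin d) → ℝ≥0∞) (x : EuclideanSpace ℝ (Fin d)) :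
    ℝ≥0∞ :=
  ⨆ t ∈ E, avg t g x

lemma avg_mono {g h : EuclideanSpace ℝ (Fin d) → ℝ≥0∞} (hgh : ∀ z, g z ≤ h z) (t : ℝ)
    (x : EuclideanSpace ℝ (Fin d)) : avg t g x ≤ avg t h x :=
  lintegral_mono fun _ => hgh _

lemma maxAvg_mono {E : Set ℝ} {g h : EuclideanSpace ℝ (Fin d) → ℝ≥0∞} (hgh : ∀ z, g z ≤ h z)
    (x : EuclideanSpace ℝ (Fin d)) : maxAvg E g x ≤ maxAvg E h x :=
  iSup₂_mono fun t _ => avg_mono hgh t x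

lemma maximalFunction_le_maxAvg (E : Set ℝ) (f : EuclideanSpace ℝ (Fin d) → ℂ)
    (x : EuclideanSpace ℝ (Fin d)) : maximalFunction E f x ≤ maxAvg E (fun z => ‖f z‖ₑ) x :=
  iSup₂_mono fun _ _ => enorm_integral_le_lintegral_enorm _

/-- The restricted type estimate `∫_G M 1_U ≤ C |U| ^ x |G| ^ w`. -/
def Restricted (d : ℕ) (E : Set ℝ) (x w : ℝ) : Prop :=
  ∃ C : ℝ≥0, ∀ U : Set (EuclideanSpace ℝ (Fin d)), IsOpen U → volume U ≠ ∞ →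
    ∀ G : Set (EuclideanSpace ℝ (Fin d)), MeasurableSet G → volume G ≠ ∞ →
      ∫⁻ z in G, maxAvg E (U.indicator 1) z ≤ C * (volume U ^ x * volume G ^ w)

lemma exists_schwartz_cutoff {K U : Set (EuclideanSpace ℝ (Fin d))} (hK : IsCompact K)
    (hU : IsOpen U) (hKU : K ⊆ U) :
    ∃ (f : 𝓢(EuclideanSpace ℝ (Fin d), ℂ)) (φ : EuclideanSpace ℝ (Fin d) → ℝ),
      (∀ z, f z = φ z) ∧ (∀ z, φ z ∈ Icc 0 1) ∧ (∀ z ∈ K, φ z = 1) ∧ ∀ z ∉ U, φ z = 0 := by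
  obtain ⟨L, hL, hKL, hLU⟩ := exists_compact_between hK hU hKU
  obtain ⟨φ, h1, h2, h3, h4⟩ := exists_contMDiff_support_eq_eq_one_iff
    (n := (⊤ : ℕ∞)) (modelWithCornersSelf ℝ (EuclideanSpace ℝ (Fin d)))
    (isOpen_interior (s := L)) hK.isClosed hKL
  have hc : HasCompactSupport fun z => (φ z : ℂ) := by
    refine HasCompactSupport.of_support_subset_isCompact hL fun z hz => ?_
    refine interior_subset (h3 ▸ fun h => hz ?_)
    simp [h]
  refine ⟨hc.toSchwartzMap (Complex.ofRealCLM.contDiff.comp h1.contDiff), φ, fun z => rfl,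
    fun z => h2 (mem_range_self z), fun z hz => (h4 z).1 hz, fun z hz => ?_⟩
  by_contra h
  exact hz (hLU (interior_subset (h3 ▸ Function.mem_support.2 h)))

/-- A countable set of radii suffices for lower semicontinuous spherical means. -/
lemma exists_countable_iSup_eq (E : Set ℝ) : ∃ E₀ ⊆ E, E₀.Countable ∧
    ∀ a : ℝ → ℝ≥0∞, (∀ (s : ℕ → ℝ) (t : ℝ), Tendsto s atTop (𝓝 t) →
      a t ≤ liminf (fun n => a (s n)) atTop) → ⨆ t ∈ E, a t = ⨆ t ∈ E₀, a t := by
  obtain ⟨E₀, h1, h2, h3⟩ :=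
    (TopologicalSpace.IsSeparable.of_separableSpace E).exists_countable_dense_subset
  refine ⟨E₀, h1, h2, fun a ha => le_antisymm (iSup₂_le fun t ht => ?_)
    (biSup_mono fun t ht => h1 ht)⟩
  obtain ⟨s, hs, hst⟩ := mem_closure_iff_seq_limit.1 (h3 ht)
  refine (ha s t hst).trans ?_
  calc liminf (fun n => a (s n)) atTop ≤ liminf (fun _ : ℕ => ⨆ t ∈ E₀, a t) atTop :=
        liminf_le_liminf (.of_forall fun n => le_iSup₂_of_le (s n) (hs n) le_rfl)
    _ = _ := liminf_const _

/-- The indicator of an open set is lower semicontinuous, and Fatou's lemma passes this to its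
spherical means as functions of the radius. This is why open sets come first. -/
lemma le_liminf_avg_indicator {U : Set (EuclideanSpace ℝ (Fin d))} (hU : IsOpen U)
    (x : EuclideanSpace ℝ (Fin d)) {s : ℕ → ℝ} {t : ℝ} (hs : Tendsto s atTop (𝓝 t)) :
    avg t (U.indicator 1) x ≤ liminf (fun n => avg (s n) (U.indicator 1) x) atTop := by
  have hm : Measurable (U.indicator (1 : EuclideanSpace ℝ (Fin d) → ℝ≥0∞)) :=
    measurable_one.indicator hU.measurableSet
  refine le_trans (lintegral_mono fun y => ?_) (lintegral_liminf_le fun n =>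
    hm.comp (by fun_prop))
  by_cases hy : x - t • (y : EuclideanSpace ℝ (Fin d)) ∈ U
  · have h1 : Tendsto (fun n => x - s n • (y : EuclideanSpace ℝ (Fin d))) atTop
        (𝓝 (x - t • (y : EuclideanSpace ℝ (Fin d)))) :=
      tendsto_const_nhds.sub (hs.smul_const _)
    have h2 : ∀ᶠ n in atTop, (1 : ℝ≥0∞) ≤
        U.indicator 1 (x - s n • (y : EuclideanSpace ℝ (Fin d))) := by
      filter_upwards [h1.eventually (hU.mem_nhds hy)] with n hn
      rw [indicator_of_mem hn]; rfl
    simp only [indicator_of_mem hy, Pi.one_apply]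
    exact le_liminf_of_le (by isBoundedDefault) h2
  · simp [indicator_of_notMem hy]

lemma measurable_maxAvg_indicator (E : Set ℝ) {U : Set (EuclideanSpace ℝ (Fin d))}
    [NeZero d] (hU : IsOpen U) : Measurable (maxAvg E (U.indicator 1)) := by
  obtain ⟨E₀, _, h2, h3⟩ := exists_countable_iSup_eq E
  have : maxAvg E (U.indicator 1) = fun x => ⨆ t ∈ E₀, avg t (U.indicator 1) x :=
    funext fun x => h3 _ fun s t hs => le_liminf_avg_indicator hU x hs
  rw [this]
  exact .biSup _ h2 fun t _ => measurable_avg (measurable_one.indicator hU.measurableSet)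

variable [NeZero d]

/-- The open set is exhausted by compact sets `K n`. A smooth cutoff between `K n` and `U` dominates
the indicator of `K n` and has `L¹` norm at most `|U|`; monotone convergence does the rest. -/
lemma SchwartzRestricted.lintegral_iSup_avg_le {E : Set ℝ} {x w : ℝ} (hx : 0 ≤ x) {C : ℝ≥0}
    (h : ∀ S : Finset ℝ, (S : Set ℝ) ⊆ E →
      ∀ f : 𝓢(EuclideanSpace ℝ (Fin d), ℂ), (∀ z, ‖f z‖ ≤ 1) →
      ∀ G : Set (EuclideanSpace ℝ (Fin d)), MeasurableSet G → volume G ≠ ∞ →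
      ∫⁻ z in G, ⨆ t ∈ S, ‖sphericalMean t f z‖ₑ ≤ C * ((∫⁻ z, ‖f z‖ₑ) ^ x * volume G ^ w))
    {S : Finset ℝ} (hS : (S : Set ℝ) ⊆ E) {U : Set (EuclideanSpace ℝ (Fin d))} (hU : IsOpen U)
    {G : Set (EuclideanSpace ℝ (Fin d))} (hG : MeasurableSet G) (hGfin : volume G ≠ ∞) :
    ∫⁻ z in G, ⨆ t ∈ S, avg t (U.indicator 1) z ≤ C * (volume U ^ x * volume G ^ w) := by
  obtain ⟨F, hF1, hF2, hF3, hF4⟩ := hU.exists_iUnion_isClosed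
  set K : ℕ → Set (EuclideanSpace ℝ (Fin d)) := fun n => F n ∩ closedBall 0 n
  have hK : ∀ n, IsCompact (K n) := fun n => (isCompact_closedBall _ _).inter_left (hF1 n)
  have hKU : ∀ n, K n ⊆ U := fun n => inter_subset_left.trans (hF2 n)
  have hKm : Monotone K := fun m n hmn => inter_subset_inter (hF4 hmn)
    (closedBall_subset_closedBall (by exact_mod_cast hmn))
  have hKun : ⋃ n, K n = U := by
    refine subset_antisymm (iUnion_subset hKU) fun z hz => ?_
    rw [← hF3] at hz
    obtain ⟨m, hm⟩ := mem_iUnion.1 hz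
    obtain ⟨n, hn⟩ := exists_nat_ge ‖z‖
    refine mem_iUnion.2 ⟨max m n, hF4 (le_max_left _ _) hm, ?_⟩
    rw [mem_closedBall_zero_iff]
    exact hn.trans (by exact_mod_cast le_max_right _ _)
  have hmeas : ∀ n, Measurable ((K n).indicator (1 : EuclideanSpace ℝ (Fin d) → ℝ≥0∞)) :=
    fun n => measurable_one.indicator (hK n).measurableSet
  have hind : ∀ z, U.indicator (1 : EuclideanSpace ℝ (Fin d) → ℝ≥0∞) z =
      ⨆ n, (K n).indicator 1 z := fun z => by
    rw [← hKun, indicator_iUnion_apply (by simp)]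
  have hmono : Monotone fun n => (K n).indicator (1 : EuclideanSpace ℝ (Fin d) → ℝ≥0∞) :=
    fun m n hmn z => indicator_le_indicator_of_subset (hKm hmn) (fun _ => zero_le) z
  have havg : ∀ t z, avg t (U.indicator 1) z = ⨆ n, avg t ((K n).indicator 1) z := fun t z => by
    unfold avg
    simp only [hind]
    exact lintegral_iSup (fun n => (hmeas n).comp (by fun_prop)) fun m n hmn y => hmono hmn _
  calc ∫⁻ z in G, ⨆ t ∈ S, avg t (U.indicator 1) z
      = ∫⁻ z in G, ⨆ n, ⨆ t ∈ S, avg t ((K n).indicator 1) z := by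
        congr 1; ext z
        simp only [havg]
        exact (iSup_congr fun t => iSup_comm).trans iSup_comm
    _ = ⨆ n, ∫⁻ z in G, ⨆ t ∈ S, avg t ((K n).indicator 1) z :=
        lintegral_iSup (fun n => .biSup _ S.countable_toSet fun t _ => measurable_avg (hmeas n))
          fun m n hmn z => iSup₂_mono fun t _ => avg_mono (hmono hmn) t z
    _ ≤ _ := iSup_le fun n => ?_
  obtain ⟨f, φ, hfφ, hφ, hφK, hφU⟩ := exists_schwartz_cutoff (hK n) hU (hKU n)
  have hφc : Continuous φ := by
    have : φ = fun z => (f z).re := funext fun z => by rw [hfφ]; simp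
    rw [this]
    exact Complex.continuous_re.comp f.continuous
  have hf1 : ∀ z, ‖f z‖ ≤ 1 := fun z => by
    rw [hfφ, Complex.norm_real, Real.norm_of_nonneg (hφ z).1]
    exact (hφ z).2
  have hfU : ∫⁻ z, ‖f z‖ₑ ≤ volume U := by
    rw [← lintegral_indicator_one hU.measurableSet]
    refine lintegral_mono fun z => ?_
    by_cases hz : z ∈ U
    · rw [indicator_of_mem hz, ← ofReal_norm, Pi.one_apply, ← ENNReal.ofReal_one]
      exact ENNReal.ofReal_le_ofReal (hf1 z)
    · simp [hfφ, hφU z hz]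
  calc ∫⁻ z in G, ⨆ t ∈ S, avg t ((K n).indicator 1) z
      ≤ ∫⁻ z in G, ⨆ t ∈ S, ‖sphericalMean t f z‖ₑ := by
        refine lintegral_mono fun z => iSup₂_mono fun t _ => ?_
        have hint := integrable_sphereMeasure_of_continuous
          (p := fun y : sphere (0 : EuclideanSpace ℝ (Fin d)) 1 =>
            φ (z - t • (y : EuclideanSpace ℝ (Fin d)))) (by fun_prop)
        have e : sphericalMean t f z = ((∫ y, φ (z - t • (y : EuclideanSpace ℝ (Fin d)))
            ∂(sphereMeasure d) : ℝ) : ℂ) := by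
          rw [sphericalMean, ← integral_complex_ofReal]
          simp only [hfφ]
        rw [e, ← ofReal_norm, Complex.norm_real, Real.norm_of_nonneg
          (integral_nonneg fun y => (hφ _).1), ofReal_integral_eq_lintegral_ofReal hint
          (.of_forall fun y => (hφ _).1)]
        refine lintegral_mono fun y => ?_
        by_cases hy : z - t • (y : EuclideanSpace ℝ (Fin d)) ∈ K n
        · simp [hy, hφK _ hy]
        · simp [hy]
    _ ≤ C * ((∫⁻ z, ‖f z‖ₑ) ^ x * volume G ^ w) := h S hS f hf1 G hG hGfin
    _ ≤ _ := by gcongr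

/-- A countable dense set of radii gives the full supremum by lower semicontinuity, and it is
exhausted by finite sets, for which the constant is uniform. -/
lemma SchwartzRestricted.restricted {E : Set ℝ} {x w : ℝ} (hx : 0 ≤ x)
    (h : SchwartzRestricted d E x w) : Restricted d E x w := by
  obtain ⟨C, hC⟩ := h
  refine ⟨C, fun U hU _ G hG hGfin => ?_⟩
  obtain ⟨E₀, h1, h2, h3⟩ := exists_countable_iSup_eq E
  have hmax : ∀ z, maxAvg E (U.indicator 1) z = ⨆ t ∈ E₀, avg t (U.indicator 1) z :=
    fun z => h3 _ fun s t hs => le_liminf_avg_indicator hU z hs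
  simp only [hmax]
  rcases E₀.eq_empty_or_nonempty with rfl | hne
  · simp
  obtain ⟨s, rfl⟩ := h2.exists_eq_range hne
  have hsup : ∀ z, ⨆ t ∈ range s, avg t (U.indicator 1) z =
      ⨆ n : ℕ, ⨆ t ∈ (Finset.range n).image s, avg t (U.indicator 1) z := fun z => by
    refine le_antisymm (iSup₂_le fun t ht => ?_) (iSup_le fun n => iSup₂_le fun t ht => ?_)
    · obtain ⟨k, rfl⟩ := ht
      exact le_iSup_of_le (k + 1) (le_iSup₂_of_le (f := fun t
        (_ : t ∈ (Finset.range (k + 1)).image s) => avg t (U.indicator 1) z) (s k)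
        (Finset.mem_image_of_mem _ (Finset.self_mem_range_succ k)) le_rfl)
    · obtain ⟨k, _, rfl⟩ := Finset.mem_image.1 ht
      exact le_iSup₂_of_le (f := fun t (_ : t ∈ range s) => avg t (U.indicator 1) z) (s k)
        (mem_range_self k) le_rfl
  simp only [hsup]
  have hmeas : ∀ n : ℕ, Measurable fun z =>
      ⨆ t ∈ (Finset.range n).image s, avg t (U.indicator 1) z := fun n =>
    .biSup _ (Finset.countable_toSet _) fun t _ =>
      measurable_avg (measurable_one.indicator hU.measurableSet)
  rw [lintegral_iSup hmeas fun m n hmn z =>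
      biSup_mono fun t ht => Finset.image_subset_image (Finset.range_mono hmn) ht]
  refine iSup_le fun n => SchwartzRestricted.lintegral_iSup_avg_le hx hC ?_ hU hG hGfin
  intro t ht
  obtain ⟨k, _, rfl⟩ := Finset.mem_image.1 (Finset.mem_coe.1 ht)
  exact h1 (mem_range_self k)

/-- The left side is the same quantity in both estimates, so their weighted geometric mean suffices.
-/
lemma Restricted.convex {E : Set ℝ} {x₀ w₀ x₁ w₁ : ℝ} (h₀ : Restricted d E x₀ w₀)
    (h₁ : Restricted d E x₁ w₁) (hx₀ : 0 ≤ x₀) (hx₁ : 0 ≤ x₁) (hw₀ : 0 ≤ w₀) (hw₁ : 0 ≤ w₁)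
    {a b : ℝ} (ha : 0 ≤ a) (hb : 0 ≤ b) (hab : a + b = 1) :
    Restricted d E (a * x₀ + b * x₁) (a * w₀ + b * w₁) := by
  obtain ⟨C₀, h₀⟩ := h₀
  obtain ⟨C₁, h₁⟩ := h₁
  refine ⟨C₀ ^ a * C₁ ^ b, fun U hU hUfin G hG hGfin => ?_⟩
  set X := ∫⁻ z in G, maxAvg E (U.indicator 1) z
  have e : X = X ^ a * X ^ b := by
    rw [← ENNReal.rpow_add_of_nonneg _ _ ha hb, hab, ENNReal.rpow_one]
  rw [e]
  calc X ^ a * X ^ b ≤ (C₀ * (volume U ^ x₀ * volume G ^ w₀)) ^ a *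
        (C₁ * (volume U ^ x₁ * volume G ^ w₁)) ^ b := by
        gcongr
        · exact h₀ U hU hUfin G hG hGfin
        · exact h₁ U hU hUfin G hG hGfin
    _ = _ := by
        rw [ENNReal.rpow_add_of_nonneg _ _ (by positivity) (by positivity),
          ENNReal.rpow_add_of_nonneg _ _ (by positivity) (by positivity),
          mul_comm a x₀, mul_comm b x₁, mul_comm a w₀, mul_comm b w₁]
        simp only [ENNReal.rpow_mul, ENNReal.mul_rpow_of_nonneg _ _ ha,
          ENNReal.mul_rpow_of_nonneg _ _ hb, ENNReal.coe_mul, ENNReal.coe_rpow_of_nonneg _ ha,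
          ENNReal.coe_rpow_of_nonneg _ hb]
        ring

end SphericalMax

end

set_option linter.unusedSectionVars false

noncomputable section

namespace SphericalMax

open Metric Set Filter Topology

/-! ### Measurable majorants of the maximal function -/

lemma ofReal_two_zpow (k : ℤ) : ENNReal.ofReal ((2 : ℝ) ^ k) = 2 ^ k := by
  rw [← Real.rpow_intCast, ← ENNReal.ofReal_rpow_of_pos (by norm_num), ENNReal.ofReal_ofNat,
    ENNReal.rpow_intCast]

variable {d : ℕ}

lemma exists_outerOpen (F : Set (EuclideanSpace ℝ (Fin d))) (n : ℕ) :
    ∃ U ⊇ F, IsOpen U ∧ volume U ≤ volume F + ((n : ℝ≥0∞) + 1)⁻¹ :=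
  F.exists_isOpen_le_add volume (by simp)

/-- An open superset of `F` whose measure exceeds that of `F` by at most `1 / (n + 1)`. -/
def outerOpen (F : Set (EuclideanSpace ℝ (Fin d))) (n : ℕ) : Set (EuclideanSpace ℝ (Fin d)) :=
  (exists_outerOpen F n).choose

lemma subset_outerOpen (F : Set (EuclideanSpace ℝ (Fin d))) (n : ℕ) : F ⊆ outerOpen F n :=
  (exists_outerOpen F n).choose_spec.1

lemma isOpen_outerOpen (F : Set (EuclideanSpace ℝ (Fin d))) (n : ℕ) : IsOpen (outerOpen F n) :=
  (exists_outerOpen F n).choose_spec.2.1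

lemma volume_outerOpen_le (F : Set (EuclideanSpace ℝ (Fin d))) (n : ℕ) :
    volume (outerOpen F n) ≤ volume F + ((n : ℝ≥0∞) + 1)⁻¹ :=
  (exists_outerOpen F n).choose_spec.2.2

/-- A measurable majorant of the maximal function of the characteristic function of `F`. -/
def setMajorant (E : Set ℝ) (F : Set (EuclideanSpace ℝ (Fin d))) (x : EuclideanSpace ℝ (Fin d)) :
    ℝ≥0∞ :=
  ⨅ n : ℕ, maxAvg E ((outerOpen F n).indicator 1) x

lemma maxAvg_indicator_le_setMajorant (E : Set ℝ) (F : Set (EuclideanSpace ℝ (Fin d)))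
    (x : EuclideanSpace ℝ (Fin d)) : maxAvg E (F.indicator 1) x ≤ setMajorant E F x :=
  le_iInf fun n => maxAvg_mono
    (fun z => indicator_le_indicator_of_subset (subset_outerOpen F n) (fun _ => zero_le) z) x

/-- The level sets of a function, up to a null set. -/
def level (g : EuclideanSpace ℝ (Fin d) → ℝ≥0∞) (k : ℤ) : Set (EuclideanSpace ℝ (Fin d)) :=
  toMeasurable volume {z | 2 ^ k < g z ∧ g z ≤ 2 ^ (k + 1)}

lemma measurableSet_level (g : EuclideanSpace ℝ (Fin d) → ℝ≥0∞) (k : ℤ) :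
    MeasurableSet (level g k) := measurableSet_toMeasurable _ _

lemma volume_level (g : EuclideanSpace ℝ (Fin d) → ℝ≥0∞) (k : ℤ) :
    volume (level g k) = volume {z | 2 ^ k < g z ∧ g z ≤ 2 ^ (k + 1)} := measure_toMeasurable _

/-- A measurable majorant of the maximal function of `g`. -/
def majorant (E : Set ℝ) (g : EuclideanSpace ℝ (Fin d) → ℝ≥0∞) (x : EuclideanSpace ℝ (Fin d)) :
    ℝ≥0∞ :=
  ∑' k : ℤ, 2 ^ (k + 1) * setMajorant E (level g k) x

lemma le_tsum_level {g : EuclideanSpace ℝ (Fin d) → ℝ≥0∞} {z : EuclideanSpace ℝ (Fin d)}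
    (hg : g z ≠ ∞) : g z ≤ ∑' k : ℤ, 2 ^ (k + 1) * (level g k).indicator 1 z := by
  rcases eq_or_ne (g z) 0 with h0 | h0
  · simp [h0]
  obtain ⟨k, hk⟩ := ENNReal.exists_mem_Ioc_zpow h0 hg ENNReal.one_lt_two ENNReal.ofNat_ne_top
  refine le_trans ?_ (ENNReal.le_tsum k)
  have : z ∈ level g k := subset_toMeasurable _ _ hk
  rw [indicator_of_mem this, Pi.one_apply, mul_one]
  exact hk.2

lemma measurable_setMajorant [NeZero d] (E : Set ℝ) (F : Set (EuclideanSpace ℝ (Fin d))) :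
    Measurable (setMajorant E F) :=
  .iInf fun n => measurable_maxAvg_indicator E (isOpen_outerOpen F n)

lemma measurable_majorant [NeZero d] (E : Set ℝ) (g : EuclideanSpace ℝ (Fin d) → ℝ≥0∞) :
    Measurable (majorant E g) :=
  .tsum fun k => (measurable_setMajorant E (level g k)).const_mul _

lemma maxAvg_le_majorant {E : Set ℝ} {g : EuclideanSpace ℝ (Fin d) → ℝ≥0∞} (hg : ∀ z, g z ≠ ∞)
    (x : EuclideanSpace ℝ (Fin d)) : maxAvg E g x ≤ majorant E g x := by
  refine iSup₂_le fun t ht => (avg_mono (fun z => le_tsum_level (hg z)) t x).trans ?_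
  have hm : ∀ k, Measurable ((level g k).indicator (1 : EuclideanSpace ℝ (Fin d) → ℝ≥0∞)) :=
    fun k => measurable_one.indicator (measurableSet_level g k)
  have hm' : ∀ k, Measurable fun y : sphere (0 : EuclideanSpace ℝ (Fin d)) 1 =>
      (level g k).indicator (1 : EuclideanSpace ℝ (Fin d) → ℝ≥0∞)
        (x - t • (y : EuclideanSpace ℝ (Fin d))) := fun k => (hm k).comp (by fun_prop)
  unfold avg
  beta_reduce
  rw [lintegral_tsum fun k => ((hm' k).const_mul _).aemeasurable]
  refine ENNReal.tsum_le_tsum fun k => ?_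
  rw [lintegral_const_mul _ (hm' k)]
  gcongr
  exact le_trans (le_iSup₂_of_le (f := fun t (_ : t ∈ E) =>
    avg t ((level g k).indicator 1) x) t ht le_rfl) (maxAvg_indicator_le_setMajorant E _ x)

variable [NeZero d]

/-- The open supersets have measures tending to `|F|`, and the majorant lies below the maximal
function of each of them, so the estimate survives in the limit. -/
lemma Restricted.exists_lintegral_setMajorant_le {E : Set ℝ} {x w : ℝ} (hw : 0 ≤ w)
    (h : Restricted d E x w) :
    ∃ C : ℝ≥0, ∀ F : Set (EuclideanSpace ℝ (Fin d)), volume F ≠ ∞ →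
      ∀ G : Set (EuclideanSpace ℝ (Fin d)), MeasurableSet G → volume G ≠ ∞ →
      ∫⁻ z in G, setMajorant E F z ≤ C * (volume F ^ x * volume G ^ w) := by
  obtain ⟨C, hC⟩ := h
  refine ⟨C, fun F hF G hG hGfin => ?_⟩
  have hGw : volume G ^ w ≠ ∞ := ENNReal.rpow_ne_top_of_nonneg hw hGfin
  have hlim : Tendsto (fun n : ℕ => volume (outerOpen F n)) atTop (𝓝 (volume F)) := by
    refine tendsto_of_tendsto_of_tendsto_of_le_of_le tendsto_const_nhds ?_
      (fun n => measure_mono (subset_outerOpen F n)) (volume_outerOpen_le F)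
    have h1 := (tendsto_add_atTop_iff_nat 1).2 ENNReal.tendsto_inv_nat_nhds_zero
    have h2 := (tendsto_const_nhds (x := volume F)).add h1
    simpa using h2
  have hlim2 : Tendsto (fun n : ℕ => C * (volume (outerOpen F n) ^ x * volume G ^ w)) atTop
      (𝓝 (C * (volume F ^ x * volume G ^ w))) := by
    refine ENNReal.Tendsto.const_mul ?_ (Or.inr ENNReal.coe_ne_top)
    exact ENNReal.Tendsto.mul_const ((ENNReal.continuous_rpow_const.tendsto _).comp hlim)
      (Or.inr hGw)
  refine ge_of_tendsto' hlim2 fun n => ?_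
  refine (lintegral_mono fun z => iInf_le _ n).trans
    (hC _ (isOpen_outerOpen F n) (ne_top_of_le_ne_top ?_ (volume_outerOpen_le F n)) G hG hGfin)
  simp [hF]

lemma Restricted.exists_lintegral_majorant_le {E : Set ℝ} {x w : ℝ} (hw : 0 ≤ w)
    (h : Restricted d E x w) :
    ∃ C : ℝ≥0, ∀ g : EuclideanSpace ℝ (Fin d) → ℝ≥0∞, (∀ k, volume (level g k) ≠ ∞) →
      ∀ G : Set (EuclideanSpace ℝ (Fin d)), MeasurableSet G → volume G ≠ ∞ →
      ∫⁻ z in G, majorant E g z ≤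
        C * (∑' k : ℤ, 2 ^ (k + 1) * volume (level g k) ^ x) * volume G ^ w := by
  obtain ⟨C, hC⟩ := h.exists_lintegral_setMajorant_le hw
  refine ⟨C, fun g hg G hG hGfin => ?_⟩
  unfold majorant
  rw [lintegral_tsum fun k => ((measurable_setMajorant E _).const_mul _).aemeasurable,
    ← ENNReal.tsum_mul_left, ← ENNReal.tsum_mul_right]
  refine ENNReal.tsum_le_tsum fun k => ?_
  rw [lintegral_const_mul _ (measurable_setMajorant E _)]
  calc _ ≤ 2 ^ (k + 1) * (C * (volume (level g k) ^ x * volume G ^ w)) := by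
        gcongr
        exact hC _ (hg k) G hG hGfin
    _ = _ := by ring

/-- The integral of a power of the distribution function. -/
def distIntegral (x : ℝ) (f : EuclideanSpace ℝ (Fin d) → ℂ) : ℝ≥0∞ :=
  ∫⁻ s in Ioi (0 : ℝ), volume {z | s < ‖f z‖} ^ x

lemma volume_level_le (f : EuclideanSpace ℝ (Fin d) → ℂ) (k : ℤ) :
    volume (level (fun z => ‖f z‖ₑ) k) ≤ volume {z | (2 : ℝ) ^ k < ‖f z‖} := by
  rw [volume_level]
  refine measure_mono fun z hz => ?_
  have := hz.1
  rw [← ofReal_two_zpow, ← ofReal_norm, ENNReal.ofReal_lt_ofReal_iff_of_nonneg (by positivity)]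
    at this
  exact this

/-- The `k`th term is charged to the interval `2^(k-1) < s ≤ 2^k`, on which the superlevel set
contains the `k`th level. The factor `4` is the ratio of `2^(k+1)` to the length of that interval.
-/
lemma tsum_level_le {x : ℝ} (hx : 0 ≤ x) (f : EuclideanSpace ℝ (Fin d) → ℂ) :
    ∑' k : ℤ, 2 ^ (k + 1) * volume (level (fun z => ‖f z‖ₑ) k) ^ x ≤ 4 * distIntegral x f := by
  set a : ℤ → ℝ := fun k => 2 ^ (k - 1)
  have ha : Monotone a := fun k l hkl => zpow_le_zpow_right₀ (by norm_num) (by omega)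
  have hsucc : ∀ k, a (Order.succ k) = 2 ^ k := fun k => by simp [a, Order.succ_eq_add_one]
  calc _ ≤ ∑' k : ℤ, 4 * ∫⁻ s in Ioc (a k) (a (Order.succ k)), volume {z | s < ‖f z‖} ^ x := by
        refine ENNReal.tsum_le_tsum fun k => ?_
        have h1 : ∫⁻ _ in Ioc (a k) (a (Order.succ k)), volume (level (fun z => ‖f z‖ₑ) k) ^ x ≤
            ∫⁻ s in Ioc (a k) (a (Order.succ k)), volume {z | s < ‖f z‖} ^ x := by
          refine setLIntegral_mono' measurableSet_Ioc fun s hs => ?_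
          refine ENNReal.rpow_le_rpow ?_ hx
          refine (volume_level_le f k).trans (measure_mono fun z hz => ?_)
          rw [hsucc] at hs
          exact hs.2.trans_lt hz
        refine le_trans (le_of_eq ?_) (mul_le_mul_right h1 4)
        have h2 : a (Order.succ k) - a k = 2 ^ (k - 1) := by
          rw [hsucc]
          simp only [a]
          rw [zpow_sub_one₀ (by norm_num)]; ring
        rw [setLIntegral_const, Real.volume_Ioc, h2, ofReal_two_zpow,
          show (4 : ℝ≥0∞) = 2 ^ (2 : ℤ) by norm_num, mul_left_comm,
          ← ENNReal.zpow_add (by norm_num) (by norm_num), mul_comm]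
        congr 2; ring
    _ = 4 * ∫⁻ s in ⋃ k, Ioc (a k) (a (Order.succ k)), volume {z | s < ‖f z‖} ^ x := by
        rw [ENNReal.tsum_mul_left, lintegral_iUnion (fun k => measurableSet_Ioc)
          ha.pairwise_disjoint_on_Ioc_succ]
    _ ≤ _ := by
        gcongr
        refine lintegral_mono_set (iUnion_subset fun k s hs => ?_)
        exact lt_trans (by positivity : 0 < a k) hs.1

lemma volume_lt_norm_ne_top {x : ℝ} (hx : 0 < x) {f : EuclideanSpace ℝ (Fin d) → ℂ}
    (hf : distIntegral x f ≠ ∞) {s : ℝ} (hs : 0 < s) : volume {z | s < ‖f z‖} ≠ ∞ := by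
  intro h
  refine hf (top_unique ?_)
  calc (∞ : ℝ≥0∞) = ∫⁻ _ in Ioc 0 s, (∞ : ℝ≥0∞) := by
        rw [setLIntegral_const, Real.volume_Ioc, sub_zero, ENNReal.top_mul]
        simpa using hs
    _ ≤ ∫⁻ r in Ioc 0 s, volume {z | r < ‖f z‖} ^ x := by
        refine setLIntegral_mono' measurableSet_Ioc fun r hr => ?_
        rw [top_le_iff, ENNReal.rpow_eq_top_iff]
        refine Or.inr ⟨top_unique (h ▸ measure_mono fun z hz => hr.2.trans_lt hz), hx⟩
    _ ≤ _ := lintegral_mono_set Ioc_subset_Ioi_self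

lemma Restricted.exists_lintegral_majorant_norm_le {E : Set ℝ} {x w : ℝ} (hx : 0 < x)
    (hw : 0 ≤ w) (h : Restricted d E x w) :
    ∃ C : ℝ≥0, ∀ f : EuclideanSpace ℝ (Fin d) → ℂ, distIntegral x f ≠ ∞ →
      ∀ G : Set (EuclideanSpace ℝ (Fin d)), MeasurableSet G → volume G ≠ ∞ →
      ∫⁻ z in G, majorant E (fun z => ‖f z‖ₑ) z ≤ C * distIntegral x f * volume G ^ w := by
  obtain ⟨C, hC⟩ := h.exists_lintegral_majorant_le hw
  refine ⟨C * 4, fun f hf G hG hGfin => ?_⟩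
  refine (hC _ (fun k => ?_) G hG hGfin).trans ?_
  · exact ne_top_of_le_ne_top (volume_lt_norm_ne_top hx hf (by positivity)) (volume_level_le f k)
  · refine mul_le_mul' ?_ le_rfl
    rw [ENNReal.coe_mul, mul_assoc]
    exact mul_le_mul' le_rfl (tsum_level_le hx.le f)

/-- The hypothesis is tested on the superlevel set itself, cut by balls so that its measure is
finite and the factor `volume (G n) ^ w` can be cancelled. -/
lemma mul_volume_rpow_le {w y : ℝ} (hwy : w + y = 1) (hy : 0 < y) (hw : 0 ≤ w)
    {h : EuclideanSpace ℝ (Fin d) → ℝ≥0∞} (hh : Measurable h) {A : ℝ≥0∞}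
    (hA : ∀ G : Set (EuclideanSpace ℝ (Fin d)), MeasurableSet G → volume G ≠ ∞ →
      ∫⁻ z in G, h z ≤ A * volume G ^ w) (s : ℝ≥0) :
    (s : ℝ≥0∞) * volume {z | (s : ℝ≥0∞) < h z} ^ y ≤ A := by
  set G : ℕ → Set (EuclideanSpace ℝ (Fin d)) := fun n => {z | (s : ℝ≥0∞) < h z} ∩ ball 0 n
  have hGm : ∀ n, MeasurableSet (G n) := fun n =>
    (measurableSet_lt measurable_const hh).inter measurableSet_ball
  have hGfin : ∀ n, volume (G n) ≠ ∞ := fun n =>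
    measure_ne_top_of_subset inter_subset_right measure_ball_lt_top.ne
  have hmono : Monotone G := fun m n hmn => inter_subset_inter_right _
    (ball_subset_ball (by exact_mod_cast hmn))
  have hun : ⋃ n, G n = {z | (s : ℝ≥0∞) < h z} := by
    rw [← inter_iUnion, inter_eq_left]
    intro z _
    obtain ⟨n, hn⟩ := exists_nat_gt ‖z‖
    exact mem_iUnion.2 ⟨n, by simpa using hn⟩
  have hlim := tendsto_measure_iUnion_atTop (μ := volume) hmono
  rw [hun] at hlim
  have hlim2 : Tendsto (fun n => (s : ℝ≥0∞) * volume (G n) ^ y) atTop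
      (𝓝 (s * volume {z | (s : ℝ≥0∞) < h z} ^ y)) :=
    ENNReal.Tendsto.const_mul ((ENNReal.continuous_rpow_const.tendsto _).comp hlim)
      (Or.inr ENNReal.coe_ne_top)
  refine le_of_tendsto' hlim2 fun n => ?_
  rcases eq_or_ne (volume (G n)) 0 with h0 | h0
  · simp [h0, ENNReal.zero_rpow_of_pos hy]
  have h1 : s * volume (G n) ≤ A * volume (G n) ^ w := by
    refine le_trans ?_ (hA (G n) (hGm n) (hGfin n))
    rw [← setLIntegral_const]
    exact setLIntegral_mono' (hGm n) fun z hz => hz.1.le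
  have h2 : volume (G n) = volume (G n) ^ y * volume (G n) ^ w := by
    rw [← ENNReal.rpow_add _ _ h0 (hGfin n), add_comm y, hwy, ENNReal.rpow_one]
  rw [h2, ← mul_assoc, ← h2] at h1
  exact (ENNReal.mul_le_mul_iff_left (by simp [h0, hGfin n])
    (ENNReal.rpow_ne_top_of_nonneg hw (hGfin n))).1 h1

lemma Restricted.exists_weakNorm_le {E : Set ℝ} {p q w : ℝ} (hp : 0 < p) (hq : 0 < q)
    (hw : 0 ≤ w) (hwq : w + 1 / q = 1) (h : Restricted d E (1 / p) w) :
    ∃ C : ℝ≥0, ∀ f : EuclideanSpace ℝ (Fin d) → ℂ, lorentzOneNorm p f < ∞ →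
      weakNorm q (maximalFunction E f) ≤ C * lorentzOneNorm p f := by
  obtain ⟨C, hC⟩ := h.exists_lintegral_majorant_norm_le (by positivity) hw
  refine ⟨C * p.toNNReal⁻¹, fun f hf => ?_⟩
  have hp0 : ENNReal.ofReal p ≠ 0 := by simpa using hp
  have e : lorentzOneNorm p f = ENNReal.ofReal p * distIntegral (1 / p) f := rfl
  have hfin : distIntegral (1 / p) f ≠ ∞ := fun h => by
    rw [e, h, ENNReal.mul_top hp0] at hf
    exact lt_irrefl _ hf
  have e2 : ((C * p.toNNReal⁻¹ : ℝ≥0) : ℝ≥0∞) * lorentzOneNorm p f =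
      C * distIntegral (1 / p) f := by
    rw [e, ENNReal.coe_mul, ENNReal.coe_inv (by simpa using hp), mul_assoc]
    change C * ((ENNReal.ofReal p)⁻¹ * _) = _
    rw [← mul_assoc (ENNReal.ofReal p)⁻¹, ENNReal.inv_mul_cancel hp0 ENNReal.ofReal_ne_top,
      one_mul]
  rw [e2]
  refine iSup_le fun s => le_trans ?_ (mul_volume_rpow_le hwq
    (by positivity) hw (measurable_majorant E fun z => ‖f z‖ₑ) (hC f hfin) s)
  gcongr with z hz
  exact (maximalFunction_le_maxAvg E f z).trans (maxAvg_le_majorant (fun _ => enorm_ne_top) z)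

end SphericalMax

end

set_option linter.unusedSectionVars false

noncomputable section

namespace SphericalMax

open Metric Set Filter Topology

/-! ### The maximal function is well defined -/

variable {d : ℕ} [NeZero d]

lemma avg_add_le {g h : EuclideanSpace ℝ (Fin d) → ℝ≥0∞} (hg : Measurable g) (t : ℝ)
    (x : EuclideanSpace ℝ (Fin d)) : avg t (fun z => g z + h z) x = avg t g x + avg t h x :=
  lintegral_add_left (hg.comp (by fun_prop)) _

lemma maxAvg_add_le {E : Set ℝ} {g h : EuclideanSpace ℝ (Fin d) → ℝ≥0∞} (hg : Measurable g)
    (x : EuclideanSpace ℝ (Fin d)) :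
    maxAvg E (fun z => g z + h z) x ≤ maxAvg E g x + maxAvg E h x :=
  iSup₂_le fun t ht => (avg_add_le hg t x).le.trans (add_le_add
    (le_iSup₂_of_le (f := fun t (_ : t ∈ E) => avg t g x) t ht le_rfl)
    (le_iSup₂_of_le (f := fun t (_ : t ∈ E) => avg t h x) t ht le_rfl))

lemma avg_le_maxAvg {E : Set ℝ} {t : ℝ} (ht : t ∈ E) (g : EuclideanSpace ℝ (Fin d) → ℝ≥0∞)
    (x : EuclideanSpace ℝ (Fin d)) : avg t g x ≤ maxAvg E g x :=
  le_iSup₂_of_le (f := fun t (_ : t ∈ E) => avg t g x) t ht le_rfl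

/-- Approximability by continuous functions with small maximal function of the error. -/
def Approximable (E : Set ℝ) (f : EuclideanSpace ℝ (Fin d) → ℂ) : Prop :=
  ∀ (n : ℕ) (ε : ℝ≥0∞), ε ≠ 0 → ∃ (g : EuclideanSpace ℝ (Fin d) → ℂ)
    (H : EuclideanSpace ℝ (Fin d) → ℝ≥0∞), Continuous g ∧ Measurable H ∧
    (∀ x ∈ ball (0 : EuclideanSpace ℝ (Fin d)) n,
      maxAvg E (fun z => ‖f z - g z‖ₑ) x ≤ H x) ∧
    ∫⁻ x in ball 0 n, H x ≤ ε

lemma continuous_sphericalMean {g : EuclideanSpace ℝ (Fin d) → ℂ} (hg : Continuous g) :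
    Continuous fun p : ℝ × EuclideanSpace ℝ (Fin d) => sphericalMean p.1 g p.2 := by
  have := continuous_parametric_integral_of_continuous (μ := sphereMeasure d)
    (f := fun (p : ℝ × EuclideanSpace ℝ (Fin d)) (y : sphere (0 : EuclideanSpace ℝ (Fin d)) 1) =>
      g (p.2 - p.1 • (y : EuclideanSpace ℝ (Fin d)))) (by fun_prop) (isCompact_univ)
  simp only [Measure.restrict_univ] at this
  exact this

lemma measurable_maximalFunction_of_continuous (E : Set ℝ) {g : EuclideanSpace ℝ (Fin d) → ℂ}
    (hg : Continuous g) : Measurable (maximalFunction E g) := by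
  obtain ⟨E₀, _, h2, h3⟩ := exists_countable_iSup_eq E
  have hc := continuous_sphericalMean hg
  have : maximalFunction E g = fun x => ⨆ t ∈ E₀, ‖sphericalMean t g x‖ₑ := funext fun x => by
    refine h3 _ fun s t hs => ?_
    have h4 : Tendsto (fun n => ‖sphericalMean (s n) g x‖ₑ) atTop (𝓝 ‖sphericalMean t g x‖ₑ) := by
      have h5 : Continuous fun t => ‖sphericalMean t g x‖ₑ :=
        (hc.comp (by fun_prop : Continuous fun t : ℝ => (t, x))).enorm
      exact (h5.tendsto t).comp hs
    exact h4.liminf_eq.ge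
  rw [this]
  exact .biSup _ h2 fun t _ =>
    (hc.comp (by fun_prop : Continuous fun x => (t, x))).measurable.enorm

/-- Where the maximal function of the error is finite, all spherical averages of `f - g` converge,
uniformly in the choice of `t ∈ E`. Where it tends to zero, the maximal functions of the continuous
approximants converge to that of `f`, which is therefore measurable up to a null set. -/
lemma Approximable.maximalWellDefined {E : Set ℝ} {f : EuclideanSpace ℝ (Fin d) → ℂ}
    (hf : Measurable f) (h : Approximable E f) : MaximalWellDefined E f := by
  choose g H hg hH hle hint using fun n : ℕ => h n (2⁻¹ ^ n) (by simp)
  have hfin : ∀ᵐ x : EuclideanSpace ℝ (Fin d), ∀ n : ℕ, x ∈ ball 0 n → H n x < ∞ := by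
    rw [ae_all_iff]
    intro n
    rw [← ae_restrict_iff' measurableSet_ball]
    exact ae_lt_top (hH n) (ne_top_of_le_ne_top (by simp) (hint n))
  -- The errors have integrals at most `2^(-n)`, summable, so on each ball they tend to zero almost
  -- everywhere; only indices `n ≥ m` see the ball of radius `m`.
  have hconv : ∀ᵐ x : EuclideanSpace ℝ (Fin d), Tendsto (fun n => H n x) atTop (𝓝 0) := by
    have h1 : ∀ᵐ x : EuclideanSpace ℝ (Fin d), ∀ m : ℕ, x ∈ ball 0 m →
        ∑' n, H (n + m) x < ∞ := by
      rw [ae_all_iff]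
      intro m
      rw [← ae_restrict_iff' measurableSet_ball]
      refine ae_lt_top (.tsum fun n => hH _) ?_
      rw [lintegral_tsum fun n => (hH _).aemeasurable]
      refine ne_top_of_le_ne_top (b := 2) (by simp) ?_
      refine le_trans ?_ ENNReal.tsum_geometric_two.le
      refine ENNReal.tsum_le_tsum fun n => ?_
      calc _ ≤ ∫⁻ x in ball 0 ((n + m : ℕ) : ℝ), H (n + m) x :=
            lintegral_mono_set (ball_subset_ball (by push_cast; linarith [n.cast_nonneg (α := ℝ)]))
        _ ≤ 2⁻¹ ^ (n + m) := hint _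
        _ ≤ 2⁻¹ ^ n := pow_le_pow_right_of_le_one' (by simp) (by omega)
    filter_upwards [h1] with x hx
    obtain ⟨m, hm⟩ := exists_nat_gt ‖x‖
    have := ENNReal.tendsto_atTop_zero_of_tsum_ne_top (hx m (by simpa using hm)).ne
    exact (tendsto_add_atTop_iff_nat m).1 this
  have hgint : ∀ (n : ℕ) (t : ℝ) (x : EuclideanSpace ℝ (Fin d)),
      Integrable (fun y : sphere (0 : EuclideanSpace ℝ (Fin d)) 1 =>
      g n (x - t • (y : EuclideanSpace ℝ (Fin d)))) (sphereMeasure d) := fun n t x =>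
    integrable_sphereMeasure_of_continuous ((hg n).comp (by fun_prop))
  have hdm : ∀ n, Measurable fun z => ‖f z - g n z‖ₑ := fun n =>
    (hf.sub (hg n).measurable).enorm
  have hI : ∀ᵐ x : EuclideanSpace ℝ (Fin d), ∀ t ∈ E,
      Integrable (fun y : sphere (0 : EuclideanSpace ℝ (Fin d)) 1 =>
        f (x - t • (y : EuclideanSpace ℝ (Fin d)))) (sphereMeasure d) := by
    filter_upwards [hfin] with x hx t ht
    obtain ⟨m, hm⟩ := exists_nat_gt ‖x‖
    have hxm : x ∈ ball (0 : EuclideanSpace ℝ (Fin d)) m := by simpa using hm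
    have h1 : Integrable (fun y : sphere (0 : EuclideanSpace ℝ (Fin d)) 1 =>
        f (x - t • (y : EuclideanSpace ℝ (Fin d))) -
          g m (x - t • (y : EuclideanSpace ℝ (Fin d)))) (sphereMeasure d) := by
      refine ⟨((hf.sub (hg m).measurable).comp
        (by fun_prop : Measurable fun y : sphere (0 : EuclideanSpace ℝ (Fin d)) 1 =>
          x - t • (y : EuclideanSpace ℝ (Fin d)))).aestronglyMeasurable, ?_⟩
      exact ((avg_le_maxAvg ht _ x).trans (hle m x hxm)).trans_lt (hx m hxm)
    exact (h1.add (hgint m t x)).congr (.of_forall fun y => sub_add_cancel _ _)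
  refine ⟨hI, aemeasurable_of_tendsto_metrizable_ae atTop
    (fun n => (measurable_maximalFunction_of_continuous E (hg n)).aemeasurable) ?_⟩
  filter_upwards [hI, hconv] with x hx hx0
  refine ENNReal.tendsto_nhds_of_Icc fun ε hε => ?_
  obtain ⟨m, hm⟩ := exists_nat_gt ‖x‖
  filter_upwards [hx0.eventually (gt_mem_nhds hε), eventually_ge_atTop m] with n hn hmn
  have hxn : x ∈ ball (0 : EuclideanSpace ℝ (Fin d)) n := by
    simpa using hm.trans_le (by exact_mod_cast hmn)
  have hdiff : ∀ t ∈ E, ‖sphericalMean t f x - sphericalMean t (g n) x‖ₑ ≤ ε := fun t ht => by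
    unfold sphericalMean
    rw [← integral_sub (hx t ht) (hgint n t x)]
    refine (enorm_integral_le_lintegral_enorm _).trans ?_
    exact ((avg_le_maxAvg ht (fun z => ‖f z - g n z‖ₑ) x).trans (hle n x hxn)).trans hn.le
  constructor
  · refine tsub_le_iff_right.2 (iSup₂_le fun t ht => ?_)
    calc ‖sphericalMean t f x‖ₑ = ‖sphericalMean t (g n) x +
          (sphericalMean t f x - sphericalMean t (g n) x)‖ₑ := by congr 1; ring
      _ ≤ _ := (enorm_add_le _ _).trans (add_le_add
        (le_iSup₂_of_le (f := fun t (_ : t ∈ E) => ‖sphericalMean t (g n) x‖ₑ) t ht le_rfl)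
        (hdiff t ht))
  · refine iSup₂_le fun t ht => ?_
    calc ‖sphericalMean t (g n) x‖ₑ = ‖sphericalMean t f x -
          (sphericalMean t f x - sphericalMean t (g n) x)‖ₑ := by congr 1; ring
      _ ≤ _ := enorm_sub_le.trans (add_le_add
        (le_iSup₂_of_le (f := fun t (_ : t ∈ E) => ‖sphericalMean t f x‖ₑ) t ht le_rfl)
        (hdiff t ht))

lemma Approximable.add {E : Set ℝ} {f₁ f₂ : EuclideanSpace ℝ (Fin d) → ℂ} (h₁ : Approximable E f₁)
    (h₂ : Approximable E f₂) (hf₁ : Measurable f₁) : Approximable E (fun z => f₁ z + f₂ z) := by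
  intro n ε hε
  obtain ⟨g₁, H₁, a₁, b₁, c₁, e₁⟩ := h₁ n (ε / 2) (by simpa using hε)
  obtain ⟨g₂, H₂, a₂, b₂, c₂, e₂⟩ := h₂ n (ε / 2) (by simpa using hε)
  refine ⟨fun z => g₁ z + g₂ z, fun z => H₁ z + H₂ z, a₁.add a₂, b₁.add b₂, fun x hx => ?_, ?_⟩
  · calc _ ≤ maxAvg E (fun z => ‖f₁ z - g₁ z‖ₑ + ‖f₂ z - g₂ z‖ₑ) x := by
          refine maxAvg_mono (fun z => ?_) x
          rw [add_sub_add_comm]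
          exact enorm_add_le _ _
      _ ≤ _ := (maxAvg_add_le (hf₁.sub a₁.measurable).enorm x).trans
          (add_le_add (c₁ x hx) (c₂ x hx))
  · rw [lintegral_add_left b₁, ← ENNReal.add_halves ε]
    exact add_le_add e₁ e₂

/-- With `K ⊆ F ⊆ U`, `K` compact, `U` open and `U \ K` small, a Urysohn function differs from the
indicator only on `U \ K` and by at most one. The restricted estimate makes the maximal function of
`U \ K` small in the mean over a ball. -/
lemma Restricted.approximable_indicator {E : Set ℝ} {x w : ℝ} (hx : 0 < x) (hw : 0 ≤ w)
    (h : Restricted d E x w) {F : Set (EuclideanSpace ℝ (Fin d))} (hF : MeasurableSet F)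
    (hFfin : volume F ≠ ∞) (c : ℂ) : Approximable E (F.indicator fun _ => c) := by
  obtain ⟨C, hC⟩ := h.exists_lintegral_setMajorant_le hw
  intro n ε hε
  have hV : volume (ball (0 : EuclideanSpace ℝ (Fin d)) n) ≠ ∞ := measure_ball_lt_top.ne
  have hlim : Tendsto (fun r : ℝ≥0∞ => ‖c‖ₑ * (C * (r ^ x *
      volume (ball (0 : EuclideanSpace ℝ (Fin d)) n) ^ w))) (𝓝 0) (𝓝 0) := by
    have h1 : Tendsto (fun r : ℝ≥0∞ => r ^ x) (𝓝 0) (𝓝 0) := by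
      have := ENNReal.continuous_rpow_const (y := x).tendsto 0
      rwa [ENNReal.zero_rpow_of_pos hx] at this
    have h2 := ENNReal.Tendsto.mul_const (b := volume (ball (0 : EuclideanSpace ℝ (Fin d)) n) ^ w)
      h1 (Or.inr (ENNReal.rpow_ne_top_of_nonneg hw hV))
    have h3 := ENNReal.Tendsto.const_mul (a := (C : ℝ≥0∞)) h2 (Or.inr ENNReal.coe_ne_top)
    have h4 := ENNReal.Tendsto.const_mul (a := ‖c‖ₑ) h3 (Or.inr enorm_ne_top)
    simpa using h4
  obtain ⟨δ, hδ, hδε⟩ := ENNReal.nhds_zero_basis.eventually_iff.1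
    (hlim.eventually (gt_mem_nhds (pos_iff_ne_zero.2 hε)))
  have hδ2 : δ / 2 ≠ 0 := by simpa using hδ.ne'
  obtain ⟨K, hKF, hK, hFK⟩ := hF.exists_isCompact_sdiff_lt hFfin hδ2
  obtain ⟨U, hFU, hU, _, hUF⟩ := hF.exists_isOpen_sdiff_lt hFfin hδ2
  have hUK : volume (U \ K) < δ := by
    refine (measure_mono (fun z hz => ?_ : U \ K ⊆ (U \ F) ∪ (F \ K))).trans_lt
      ((measure_union_le _ _).trans_lt ?_)
    · by_cases hzF : z ∈ F
      · exact Or.inr ⟨hzF, hz.2⟩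
      · exact Or.inl ⟨hz.1, hzF⟩
    · rw [← ENNReal.add_halves δ]
      exact ENNReal.add_lt_add hUF hFK
  obtain ⟨φ, hφK, hφU, _, hφ⟩ := exists_continuous_one_zero_of_isCompact hK hU.isClosed_compl
    (disjoint_compl_right_iff_subset.2 (hKF.trans hFU))
  refine ⟨fun z => c * (φ z : ℂ), fun z => ‖c‖ₑ * setMajorant E (U \ K) z, by fun_prop,
    (measurable_setMajorant E _).const_mul _, fun z _ => ?_, ?_⟩
  · calc _ ≤ maxAvg E (fun z => ‖c‖ₑ * (U \ K).indicator 1 z) z := by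
          refine maxAvg_mono (fun z => ?_) z
          by_cases hzK : z ∈ K
          · have := hφK hzK
            simp [hKF hzK, this]
          by_cases hzU : z ∈ U
          · have hm : z ∈ U \ K := ⟨hzU, hzK⟩
            rw [indicator_of_mem hm, Pi.one_apply, mul_one, ← ofReal_norm, ← ofReal_norm]
            refine ENNReal.ofReal_le_ofReal ?_
            have e : F.indicator (fun _ => c) z = c * ((F.indicator 1 z : ℝ) : ℂ) := by
              by_cases hzF : z ∈ F <;> simp [hzF]
            rw [e, ← mul_sub, norm_mul, ← Complex.ofReal_sub, Complex.norm_real]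
            refine mul_le_of_le_one_right (norm_nonneg _) ?_
            have h1 := hφ z
            rw [Real.norm_eq_abs, abs_le]
            by_cases hzF : z ∈ F <;> simp [hzF] <;> constructor <;> linarith [h1.1, h1.2]
          · have hzF : z ∉ F := fun h => hzU (hFU h)
            have := hφU hzU
            simp [hzF, this]
      _ = ‖c‖ₑ * maxAvg E ((U \ K).indicator 1) z := by
          unfold maxAvg avg
          simp only [ENNReal.mul_iSup]
          refine iSup_congr fun t => iSup_congr fun _ => ?_
          exact lintegral_const_mul' _ _ enorm_ne_top
      _ ≤ _ := by
          exact mul_le_mul' le_rfl (maxAvg_indicator_le_setMajorant E _ z)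
  · rw [lintegral_const_mul _ (measurable_setMajorant E _)]
    refine le_trans ?_ (hδε hUK).le
    gcongr
    exact hC _ hUK.ne_top _ measurableSet_ball hV

lemma Restricted.approximable_simpleFunc {E : Set ℝ} {x w : ℝ} (hx : 0 < x) (hw : 0 ≤ w)
    (h : Restricted d E x w) (s : SimpleFunc (EuclideanSpace ℝ (Fin d)) ℂ) :
    volume (Function.support s) ≠ ∞ → Approximable E s := by
  induction s using SimpleFunc.induction with
  | const c hs =>
    classical
    rename_i F
    intro hfin
    rw [SimpleFunc.coe_piecewise, SimpleFunc.coe_const, SimpleFunc.coe_const]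
    have e : F.piecewise (Function.const _ c) (Function.const _ (0 : ℂ)) =
        F.indicator fun _ => c := by
      ext z; by_cases hz : z ∈ F <;> simp [hz]
    rw [SimpleFunc.coe_piecewise, SimpleFunc.coe_const, SimpleFunc.coe_const, e] at hfin
    rw [e]
    rcases eq_or_ne c 0 with rfl | hc
    · simpa using h.approximable_indicator hx hw MeasurableSet.empty (by simp) 0
    · refine h.approximable_indicator hx hw hs ?_ c
      have : Function.support (F.indicator fun _ => c) = F := by
        rw [support_indicator, Function.support_const hc, inter_univ]
      rwa [this] at hfin
  | add hdisj h₁ h₂ =>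
    rename_i f g
    intro hfin
    have hsub : ∀ z, f z ≠ 0 ∨ g z ≠ 0 → z ∈ Function.support (f + g) := fun z hz => by
      have hd : f z = 0 ∨ g z = 0 := by
        by_contra! hc
        exact disjoint_left.1 hdisj (Function.mem_support.2 hc.1) (Function.mem_support.2 hc.2)
      rw [Function.mem_support, SimpleFunc.coe_add, Pi.add_apply]
      rcases hd with h0 | h0 <;> rcases hz with h1 | h1 <;> simp_all
    exact (h₁ (measure_ne_top_of_subset (fun z hz => hsub z (Or.inl hz)) hfin)).add
      (h₂ (measure_ne_top_of_subset (fun z hz => hsub z (Or.inr hz)) hfin)) f.measurable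

lemma measurable_volume_lt_norm_rpow (x : ℝ)
    (f : EuclideanSpace ℝ (Fin d) → ℂ) :
    Measurable fun s : ℝ => volume {z | s < ‖f z‖} ^ x :=
  ((show Antitone fun s : ℝ => volume {z | s < ‖f z‖} from fun _ _ hst =>
    measure_mono fun _ hz => hst.trans_lt hz).measurable).pow_const x

/-- On a set of finite measure pointwise convergence gives convergence in measure, so each
superlevel measure tends to zero; the integral in `s` is then handled by dominated convergence. -/
lemma tendsto_distIntegral {x : ℝ} (hx : 0 < x) {f : EuclideanSpace ℝ (Fin d) → ℂ}
    {D : ℕ → EuclideanSpace ℝ (Fin d) → ℂ} (hf : distIntegral x f ≠ ∞)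
    (hfs : volume (Function.support f) ≠ ∞) (hD : ∀ n, Measurable (D n))
    (hle : ∀ n z, ‖D n z‖ ≤ ‖f z‖) (hlim : ∀ z, Tendsto (fun n => D n z) atTop (𝓝 0)) :
    Tendsto (fun n => distIntegral x (D n)) atTop (𝓝 0) := by
  have h0 : ∫⁻ _ in Ioi (0 : ℝ), (0 : ℝ≥0∞) = 0 := by simp
  rw [← h0]
  refine tendsto_lintegral_of_dominated_convergence (fun s => volume {z | s < ‖f z‖} ^ x)
    (fun n => measurable_volume_lt_norm_rpow x _) (fun n => .of_forall fun s => ?_) hf ?_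
  · exact ENNReal.rpow_le_rpow (measure_mono fun z hz => lt_of_lt_of_le hz (hle n z)) hx.le
  · rw [ae_restrict_iff' measurableSet_Ioi]
    refine .of_forall fun s hs => ?_
    set B := toMeasurable volume (Function.support f)
    have hB : MeasurableSet B := measurableSet_toMeasurable _ _
    have : IsFiniteMeasure (volume.restrict B) :=
      ⟨by rw [Measure.restrict_apply_univ, measure_toMeasurable]; exact hfs.lt_top⟩
    have h1 := tendstoInMeasure_iff_norm.1 (tendstoInMeasure_of_tendsto_ae
      (μ := volume.restrict B) (f := D) (g := fun _ => 0)
      (fun n => (hD n).aestronglyMeasurable) (.of_forall hlim)) s hs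
    have h2 : Tendsto (fun n => volume {z | s < ‖D n z‖}) atTop (𝓝 0) := by
      refine tendsto_of_tendsto_of_tendsto_of_le_of_le tendsto_const_nhds h1
        (fun n => zero_le) fun n => ?_
      dsimp only
      rw [Measure.restrict_apply' hB]
      refine measure_mono fun z hz => ⟨?_, subset_toMeasurable _ _ fun h0 => ?_⟩
      · simpa using (le_of_lt hz : s ≤ ‖D n z‖)
      · have h3 := hle n z
        rw [h0, norm_zero] at h3
        exact absurd (lt_of_lt_of_le hz h3) (not_lt.2 (le_of_lt hs))
    have h3 := (ENNReal.continuous_rpow_const (y := x).tendsto 0).comp h2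
    rwa [ENNReal.zero_rpow_of_pos hx] at h3

lemma Restricted.approximable {E : Set ℝ} {x w : ℝ} (hE : E ⊆ Icc 1 2) (hx : 0 < x) (hw : 0 ≤ w)
    (h : Restricted d E x w) {f : EuclideanSpace ℝ (Fin d) → ℂ} (hf : Measurable f)
    (hfin : ∀ n : ℕ, distIntegral x ((ball 0 n).indicator f) ≠ ∞) : Approximable E f := by
  obtain ⟨C, hC⟩ := h.exists_lintegral_majorant_norm_le hx hw
  intro n ε hε
  -- For centres in the ball of radius `n` and radii at most `2`, only the values of `f` in the ball
  -- of radius `n + 2` matter.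
  set B := ball (0 : EuclideanSpace ℝ (Fin d)) ((n + 2 : ℕ) : ℝ)
  set f' := B.indicator f
  have hf' : Measurable f' := hf.indicator measurableSet_ball
  have hsupp : Function.support f' ⊆ B := support_indicator_subset
  have hfs : volume (Function.support f') ≠ ∞ :=
    measure_ne_top_of_subset hsupp measure_ball_lt_top.ne
  set s : ℕ → SimpleFunc (EuclideanSpace ℝ (Fin d)) ℂ :=
    SimpleFunc.approxOn f' hf' univ 0 (mem_univ _)
  have hle : ∀ m z, ‖f' z - s m z‖ ≤ ‖f' z‖ := fun m z => by
    have := SimpleFunc.edist_approxOn_le hf' (mem_univ (0 : ℂ)) z m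
    rw [edist_dist, edist_dist, dist_zero_left, dist_comm, dist_eq_norm] at this
    exact (ENNReal.ofReal_le_ofReal_iff (norm_nonneg _)).1 this
  have hlim : ∀ z, Tendsto (fun m => f' z - s m z) atTop (𝓝 0) := fun z => by
    have h1 := SimpleFunc.tendsto_approxOn hf' (mem_univ (0 : ℂ)) (x := z) (by simp)
    simpa using (tendsto_const_nhds (x := f' z)).sub h1
  have hDlim := tendsto_distIntegral hx (hfin (n + 2)) hfs
    (D := fun m z => f' z - s m z) (fun m => hf'.sub (s m).measurable) hle hlim
  have hV : volume (ball (0 : EuclideanSpace ℝ (Fin d)) n) ≠ ∞ := measure_ball_lt_top.ne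
  have hlim2 := ENNReal.Tendsto.mul_const
    (b := volume (ball (0 : EuclideanSpace ℝ (Fin d)) n) ^ w)
    (ENNReal.Tendsto.const_mul (a := (C : ℝ≥0∞)) hDlim (Or.inr ENNReal.coe_ne_top))
    (Or.inr (ENNReal.rpow_ne_top_of_nonneg hw hV))
  rw [mul_zero, zero_mul] at hlim2
  have hε2 : ε / 2 ≠ 0 := by simpa using hε
  obtain ⟨m, hm1, hm2⟩ := ((hlim2.eventually (gt_mem_nhds (pos_iff_ne_zero.2 hε2))).and
    (hDlim.eventually (gt_mem_nhds ENNReal.zero_lt_top))).exists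
  have hss : Function.support (s m) ⊆ Function.support f' := fun z hz h0 => hz (by
    have := hle m z
    rw [h0, norm_zero, zero_sub, norm_neg] at this
    exact norm_le_zero_iff.1 this)
  obtain ⟨g, H, hg, hH, hgH, hHε⟩ := h.approximable_simpleFunc hx hw (s m)
    (measure_ne_top_of_subset hss hfs) n (ε / 2) hε2
  have hDm : Measurable fun z => ‖f' z - s m z‖ₑ := (hf'.sub (s m).measurable).enorm
  refine ⟨g, fun z => majorant E (fun z => ‖f' z - s m z‖ₑ) z + H z, hg,
    (measurable_majorant E _).add hH, fun z hz => ?_, ?_⟩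
  · calc maxAvg E (fun z => ‖f z - g z‖ₑ) z = maxAvg E (fun z => ‖f' z - g z‖ₑ) z := by
          refine iSup_congr fun t => iSup_congr fun ht => ?_
          unfold avg
          congr 1; ext y
          have hy : z - t • (y : EuclideanSpace ℝ (Fin d)) ∈ B := by
            have h1 : ‖(y : EuclideanSpace ℝ (Fin d))‖ = 1 := by simp
            have h2 := hE ht
            rw [mem_ball_zero_iff] at hz ⊢
            push_cast
            calc _ ≤ ‖z‖ + ‖t • (y : EuclideanSpace ℝ (Fin d))‖ := norm_sub_le _ _
              _ = ‖z‖ + t := by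
                rw [norm_smul, h1, mul_one, Real.norm_of_nonneg (by linarith [h2.1])]
              _ < n + 2 := by linarith [h2.2]
          simp only [f', indicator_of_mem hy]
      _ ≤ maxAvg E (fun z => ‖f' z - s m z‖ₑ + ‖s m z - g z‖ₑ) z := by
          refine maxAvg_mono (fun z => ?_) z
          rw [← sub_add_sub_cancel (f' z) (s m z) (g z)]
          exact enorm_add_le _ _
      _ ≤ _ := (maxAvg_add_le hDm z).trans (add_le_add
          (maxAvg_le_majorant (fun _ => enorm_ne_top) z) (hgH z hz))
  · rw [lintegral_add_left (measurable_majorant E _), ← ENNReal.add_halves ε]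
    exact add_le_add ((hC (fun z => f' z - s m z) hm2.ne _ measurableSet_ball hV).trans hm1.le) hHε

/-- Since `x > 0`, the estimate forces the majorant of a null set to vanish almost everywhere. Thus
a null set is invisible to all spheres of radii in `E` at once, for almost every centre, even though
`E` may be uncountable. -/
lemma Restricted.ae_maxAvg_indicator_eq_zero {E : Set ℝ} {x w : ℝ} (hx : 0 < x) (hw : 0 ≤ w)
    (h : Restricted d E x w) {N : Set (EuclideanSpace ℝ (Fin d))} (hN : volume N = 0) :
    ∀ᵐ z, maxAvg E (N.indicator 1) z = 0 := by
  obtain ⟨C, hC⟩ := h.exists_lintegral_setMajorant_le hw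
  have h1 : ∀ᵐ z : EuclideanSpace ℝ (Fin d), ∀ n : ℕ, z ∈ ball 0 n → setMajorant E N z = 0 := by
    rw [ae_all_iff]
    intro n
    rw [← ae_restrict_iff' measurableSet_ball]
    have := hC N (by simp [hN]) (ball 0 n) measurableSet_ball measure_ball_lt_top.ne
    rw [hN, ENNReal.zero_rpow_of_pos hx, zero_mul, mul_zero, nonpos_iff_eq_zero,
      lintegral_eq_zero_iff (measurable_setMajorant E N)] at this
    exact this
  filter_upwards [h1] with z hz
  obtain ⟨n, hn⟩ := exists_nat_gt ‖z‖
  exact le_antisymm ((maxAvg_indicator_le_setMajorant E N z).trans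
    (hz n (by simpa using hn)).le) zero_le

lemma Restricted.ae_forall_ae_eq {E : Set ℝ} {x w : ℝ} (hx : 0 < x) (hw : 0 ≤ w)
    (h : Restricted d E x w) {f g : EuclideanSpace ℝ (Fin d) → ℂ} (hfg : f =ᵐ[volume] g) :
    ∀ᵐ z : EuclideanSpace ℝ (Fin d), ∀ t ∈ E, (fun y : sphere (0 : EuclideanSpace ℝ (Fin d)) 1 =>
      f (z - t • (y : EuclideanSpace ℝ (Fin d)))) =ᵐ[sphereMeasure d]
      fun y => g (z - t • (y : EuclideanSpace ℝ (Fin d))) := by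
  set N := toMeasurable volume {z | f z ≠ g z}
  have hN : volume N = 0 := by rw [measure_toMeasurable]; exact hfg
  have hNm : Measurable (N.indicator (1 : EuclideanSpace ℝ (Fin d) → ℝ≥0∞)) :=
    measurable_one.indicator (measurableSet_toMeasurable _ _)
  filter_upwards [h.ae_maxAvg_indicator_eq_zero hx hw hN] with z hz t ht
  have h0 : avg t (N.indicator 1) z = 0 :=
    le_antisymm ((avg_le_maxAvg ht _ z).trans hz.le) zero_le
  have h1 := (lintegral_eq_zero_iff (hNm.comp (by fun_prop : Measurable fun
    y : sphere (0 : EuclideanSpace ℝ (Fin d)) 1 => z - t • (y : EuclideanSpace ℝ (Fin d))))).1 h0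
  filter_upwards [h1] with y hy
  by_contra hne
  have : z - t • (y : EuclideanSpace ℝ (Fin d)) ∈ N := subset_toMeasurable _ _ hne
  simp [this] at hy

lemma Restricted.maximalFunction_ae_eq {E : Set ℝ} {x w : ℝ} (hx : 0 < x) (hw : 0 ≤ w)
    (h : Restricted d E x w) {f g : EuclideanSpace ℝ (Fin d) → ℂ} (hfg : f =ᵐ[volume] g) :
    maximalFunction E f =ᵐ[volume] maximalFunction E g := by
  filter_upwards [h.ae_forall_ae_eq hx hw hfg] with z hz
  refine iSup_congr fun t => iSup_congr fun ht => ?_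
  unfold sphericalMean
  rw [integral_congr_ae (hz t ht)]

lemma distIntegral_congr {x : ℝ} {f g : EuclideanSpace ℝ (Fin d) → ℂ} (hfg : f =ᵐ[volume] g) :
    distIntegral x f = distIntegral x g := by
  unfold distIntegral
  congr 1; ext s
  congr 1
  refine measure_congr ?_
  filter_upwards [hfg] with z hz
  exact propext (by simp only [hz] : (s < ‖f z‖) ↔ (s < ‖g z‖))

lemma Restricted.maximalWellDefined {E : Set ℝ} {x w : ℝ} (hE : E ⊆ Icc 1 2) (hx : 0 < x)
    (hw : 0 ≤ w) (h : Restricted d E x w) {f : EuclideanSpace ℝ (Fin d) → ℂ}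
    (hf : AEStronglyMeasurable f volume)
    (hfin : ∀ n : ℕ, distIntegral x ((ball 0 n).indicator f) ≠ ∞) : MaximalWellDefined E f := by
  have hae := hf.ae_eq_mk
  have hg : Measurable (hf.mk f) := hf.stronglyMeasurable_mk.measurable
  obtain ⟨h1, h2⟩ := (h.approximable hE hx hw hg fun n => by
    have h1 : (ball 0 (n : ℝ)).indicator (hf.mk f) =ᵐ[volume] (ball 0 (n : ℝ)).indicator f :=
      hae.mono fun z hz => by
        by_cases hzb : z ∈ ball (0 : EuclideanSpace ℝ (Fin d)) n <;>
          simp only [indicator, hzb, if_true, if_false, hz]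
    rw [distIntegral_congr h1]
    exact hfin n).maximalWellDefined hg
  refine ⟨?_, h2.congr (h.maximalFunction_ae_eq hx hw hae).symm⟩
  filter_upwards [h1, h.ae_forall_ae_eq hx hw hae] with z hz1 hz2 t ht
  exact (hz1 t ht).congr (hz2 t ht).symm

lemma Restricted.restrictedWeakType {E : Set ℝ} {p q w : ℝ} (hE : E ⊆ Icc 1 2) (hp : 0 < p)
    (hq : 0 < q) (hw : 0 ≤ w) (hwq : w + 1 / q = 1) (h : Restricted d E (1 / p) w) :
    RestrictedWeakType d E p q := by
  obtain ⟨C, hC⟩ := h.exists_weakNorm_le hp hq hw hwq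
  refine ⟨C, fun f hf hfin => ⟨?_, hC f hfin⟩⟩
  refine h.maximalWellDefined hE (by positivity) hw hf fun n => ?_
  have hp0 : ENNReal.ofReal p ≠ 0 := by simpa using hp
  have h1 : distIntegral (1 / p) f ≠ ∞ := fun h => by
    have e : lorentzOneNorm p f = ENNReal.ofReal p * distIntegral (1 / p) f := rfl
    rw [e, h, ENNReal.mul_top hp0] at hfin
    exact lt_irrefl _ hfin
  refine ne_top_of_le_ne_top h1 (lintegral_mono fun s => ?_)
  refine ENNReal.rpow_le_rpow (measure_mono fun z hz => ?_) (by positivity)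
  exact lt_of_lt_of_le hz (norm_indicator_le_norm_self _ _)

end SphericalMax

end

set_option linter.unusedSectionVars false

noncomputable section

namespace SphericalMax

open Metric Set Filter Topology

/-! ### Real interpolation with discrete sums -/

/-- Applied with `a = xᵢ` and `b = 1 - yᵢ`, the condition `1 ≤ a + b` says `yᵢ ≤ xᵢ`: this is where
`p ≤ q` enters the interpolation. -/
lemma rpow_mul_rpow_le_add {α γ a b : ℝ} (hα : 0 ≤ α) (hα1 : α ≤ 1) (hγ : 0 ≤ γ) (hγ1 : γ ≤ 1)
    (ha : 0 ≤ a) (hb : 0 ≤ b) (hab : 1 ≤ a + b) : α ^ a * γ ^ b ≤ α + γ := by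
  have hm : 0 ≤ max α γ := le_max_of_le_left hα
  calc α ^ a * γ ^ b ≤ max α γ ^ a * max α γ ^ b :=
        mul_le_mul (Real.rpow_le_rpow hα (le_max_left _ _) ha)
          (Real.rpow_le_rpow hγ (le_max_right _ _) hb) (by positivity) (by positivity)
    _ = max α γ ^ (a + b) := (Real.rpow_add_of_nonneg hm ha hb).symm
    _ ≤ max α γ ^ (1 : ℝ) :=
        Real.rpow_le_rpow_of_exponent_ge' hm (max_le hα1 hγ1) zero_le_one hab
    _ ≤ α + γ := by rw [Real.rpow_one]; exact max_le (by linarith) (by linarith)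

/-- Bookkeeping: the powers are redistributed so that `a` and `b` appear in normalized form and the
remaining factor measures the distance of `(k, l)` from a critical line. -/
lemma two_rpow_mul_rpow_mul_eq {x y x₀ y₀ k l ρ μ a b : ℝ} (hx : 0 < x) (hy : 0 < y)
    (ha : 0 ≤ a) (hb : 0 ≤ b) :
    (2 : ℝ) ^ (k + l * (1 / y - 1)) * (a ^ x₀ * b ^ (1 - y₀)) =
      2 ^ (ρ * x + μ * (1 - y)) * 2 ^ ((k - ρ * x) * (1 - x₀ / x) - (l - μ * y) * (1 - y₀ / y)) *
        ((2 ^ (k / x - ρ) * a) ^ x₀ * (2 ^ (l / y - μ) * b) ^ (1 - y₀)) := by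
  rw [Real.mul_rpow (by positivity) ha, Real.mul_rpow (by positivity) hb,
    ← Real.rpow_mul (by norm_num), ← Real.rpow_mul (by norm_num)]
  have : (2 : ℝ) ^ (k + l * (1 / y - 1)) = 2 ^ (ρ * x + μ * (1 - y)) *
      2 ^ ((k - ρ * x) * (1 - x₀ / x) - (l - μ * y) * (1 - y₀ / y)) *
      (2 ^ ((k / x - ρ) * x₀) * 2 ^ ((l / y - μ) * (1 - y₀))) := by
    simp only [← Real.rpow_add (show (0 : ℝ) < 2 by norm_num)]
    congr 1
    field_simp
    ring
  rw [this]
  ring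

/-- For fixed `l` the weights decay geometrically away from one value of `k`, and conversely, so
each weight sum is bounded uniformly in the other index. -/
lemma exists_tsum_tsum_two_rpow_abs_le {m n η : ℝ} (hm : 0 < m) (hn : 0 < n) (hη : 0 < η) :
    ∃ C : ℝ≥0, ∀ (c : ℝ) (α γ : ℤ → ℝ≥0∞),
      ∑' k : ℤ, ∑' l : ℤ, ENNReal.ofReal ((2 : ℝ) ^ (-η * |m * k - n * l + c|)) * (α k + γ l) ≤
        C * (∑' k, α k + ∑' l, γ l) := by
  obtain ⟨C₁, hC₁⟩ := exists_tsum_two_rpow_abs_sub_le (mul_pos hη hm)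
  obtain ⟨C₂, hC₂⟩ := exists_tsum_two_rpow_abs_sub_le (mul_pos hη hn)
  refine ⟨max C₁ C₂, fun c α γ => ?_⟩
  have h1 : ∀ l : ℤ, ∑' k : ℤ, ENNReal.ofReal ((2 : ℝ) ^ (-η * |m * k - n * l + c|)) ≤
      (max C₁ C₂ : ℝ≥0) := fun l => by
    refine le_trans (le_of_eq (tsum_congr fun k => ?_)) ((hC₁ ((n * l - c) / m)).trans
      (by exact_mod_cast le_max_left _ _))
    rw [show m * (k : ℝ) - n * l + c = m * (k - (n * l - c) / m) by field_simp; ring, abs_mul,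
      abs_of_pos hm]
    congr 2; ring
  have h2 : ∀ k : ℤ, ∑' l : ℤ, ENNReal.ofReal ((2 : ℝ) ^ (-η * |m * k - n * l + c|)) ≤
      (max C₁ C₂ : ℝ≥0) := fun k => by
    refine le_trans (le_of_eq (tsum_congr fun l => ?_)) ((hC₂ ((m * k + c) / n)).trans
      (by exact_mod_cast le_max_right _ _))
    rw [show m * (k : ℝ) - n * l + c = -(n * (l - (m * k + c) / n)) by field_simp; ring, abs_neg,
      abs_mul, abs_of_pos hn]
    congr 2; ring
  simp only [mul_add, ENNReal.tsum_add]
  refine add_le_add ?_ ?_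
  · rw [← ENNReal.tsum_mul_left]
    refine ENNReal.tsum_le_tsum fun k => ?_
    rw [ENNReal.tsum_mul_right]
    exact mul_le_mul' (h2 k) le_rfl
  · rw [ENNReal.tsum_comm, ← ENNReal.tsum_mul_left]
    refine ENNReal.tsum_le_tsum fun l => ?_
    rw [ENNReal.tsum_mul_right]
    exact mul_le_mul' (h1 l) le_rfl

/-- Discrete off-diagonal Marcinkiewicz interpolation. The index `k` runs over levels of the
function, `l` over levels of its maximal function. After normalizing both sums to be at most one,
each of the two estimates gains on one side of the line `u = 0`, and using the right one on each
side leaves geometric decay in `|u|`. -/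
lemma exists_tsum_interpolation_le {x₀ x₁ y₀ y₁ a b : ℝ} (hx₀ : 0 ≤ x₀) (hy₀ : 0 ≤ y₀)
    (hx : x₀ < x₁) (hy : y₀ < y₁) (hy₁ : y₁ ≤ 1) (h₀ : y₀ ≤ x₀) (h₁ : y₁ ≤ x₁) (ha : 0 < a)
    (hb : 0 < b) (hab : a + b = 1) :
    ∃ C : ℝ≥0, ∀ (ρ μ : ℝ) (A B : ℤ → ℝ) (D : ℝ≥0∞) (T : ℤ → ℤ → ℝ≥0∞), (∀ k, 0 ≤ A k) →
      (∀ l, 0 ≤ B l) →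
      ∑' k : ℤ, ENNReal.ofReal (2 ^ (k / (a * x₀ + b * x₁)) * A k) ≤ ENNReal.ofReal (2 ^ ρ) →
      ∑' l : ℤ, ENNReal.ofReal (2 ^ (l / (a * y₀ + b * y₁)) * B l) ≤ ENNReal.ofReal (2 ^ μ) →
      (∀ k l : ℤ, T k l ≤ D * ENNReal.ofReal (2 ^ (k + l * (1 / (a * y₀ + b * y₁) - 1)) *
        (A k ^ x₀ * B l ^ (1 - y₀)))) →
      (∀ k l : ℤ, T k l ≤ D * ENNReal.ofReal (2 ^ (k + l * (1 / (a * y₀ + b * y₁) - 1)) *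
        (A k ^ x₁ * B l ^ (1 - y₁)))) →
      ∑' k, ∑' l, T k l ≤ C * D * ENNReal.ofReal
        (2 ^ (ρ * (a * x₀ + b * x₁) + μ * (1 - (a * y₀ + b * y₁)))) := by
  set x := a * x₀ + b * x₁ with hxdef
  set y := a * y₀ + b * y₁ with hydef
  have hx0 : 0 < x := by have := mul_pos hb (hx₀.trans_lt hx); have := mul_nonneg ha.le hx₀; linarith
  have hy0 : 0 < y := by have := mul_pos hb (hy₀.trans_lt hy); have := mul_nonneg ha.le hy₀; linarith
  have hη : 0 < min a b := lt_min ha hb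
  obtain ⟨C, hC⟩ := exists_tsum_tsum_two_rpow_abs_le (m := (x₁ - x₀) / x) (n := (y₁ - y₀) / y)
    (div_pos (by linarith) hx0) (div_pos (by linarith) hy0) hη
  refine ⟨C * 2, fun ρ μ A B D T hA hB hAs hBs hT₀ hT₁ => ?_⟩
  set α : ℤ → ℝ := fun k => 2 ^ (k / x - ρ) * A k
  set γ : ℤ → ℝ := fun l => 2 ^ (l / y - μ) * B l
  have key : ∀ (s z : ℝ) (S : ℤ → ℝ), ∑' k : ℤ, ENNReal.ofReal (2 ^ (k / z) * S k) ≤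
      ENNReal.ofReal (2 ^ s) → ∑' k : ℤ, ENNReal.ofReal (2 ^ (k / z - s) * S k) ≤ 1 := by
    intro s z S h
    have e : ∀ k : ℤ, ENNReal.ofReal (2 ^ (k / z - s) * S k) =
        ENNReal.ofReal (2 ^ (-s)) * ENNReal.ofReal (2 ^ (k / z) * S k) := fun k => by
      rw [← ENNReal.ofReal_mul (by positivity), ← mul_assoc, ← Real.rpow_add (by norm_num)]
      congr 3; ring
    simp only [e]
    rw [ENNReal.tsum_mul_left]
    refine (mul_le_mul' le_rfl h).trans (le_of_eq ?_)
    rw [← ENNReal.ofReal_mul (by positivity), ← Real.rpow_add (by norm_num)]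
    simp
  have hαs : ∑' k, ENNReal.ofReal (α k) ≤ 1 := key ρ x A hAs
  have hγs : ∑' k, ENNReal.ofReal (γ k) ≤ 1 := key μ y B hBs
  have hα0 : ∀ k, 0 ≤ α k := fun k => mul_nonneg (by positivity) (hA k)
  have hγ0 : ∀ k, 0 ≤ γ k := fun k => mul_nonneg (by positivity) (hB k)
  have hα1 : ∀ k, α k ≤ 1 := fun k => ENNReal.ofReal_le_one.1 ((ENNReal.le_tsum k).trans hαs)
  have hγ1 : ∀ k, γ k ≤ 1 := fun k => ENNReal.ofReal_le_one.1 ((ENNReal.le_tsum k).trans hγs)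
  set V : ℝ := 2 ^ (ρ * x + μ * (1 - y))
  have hV : 0 ≤ V := by positivity
  set c : ℝ := -ρ * (x₁ - x₀) + μ * (y₁ - y₀)
  have hterm : ∀ k l : ℤ, T k l ≤ D * ENNReal.ofReal V *
      (ENNReal.ofReal (2 ^ (-(min a b) * |(x₁ - x₀) / x * k - (y₁ - y₀) / y * l + c|)) *
        (ENNReal.ofReal (α k) + ENNReal.ofReal (γ l))) := by
    intro k l
    rw [mul_assoc, ← ENNReal.ofReal_add (hα0 k) (hγ0 l), ← ENNReal.ofReal_mul (by positivity),
      ← ENNReal.ofReal_mul hV]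
    set u := (x₁ - x₀) / x * k - (y₁ - y₀) / y * l + c with hu
    -- The exponent left over is `b * u` for the first estimate and `-a * u` for the second; the
    -- sign of `u` decides which one helps.
    rcases le_total u 0 with hu0 | hu0
    · refine (hT₀ k l).trans (mul_le_mul' le_rfl (ENNReal.ofReal_le_ofReal ?_))
      rw [two_rpow_mul_rpow_mul_eq (ρ := ρ) (μ := μ) hx0 hy0 (hA k) (hB l), mul_assoc]
      refine mul_le_mul_of_nonneg_left ?_ hV
      refine mul_le_mul ?_ (rpow_mul_rpow_le_add (hα0 k) (hα1 k) (hγ0 l) (hγ1 l) hx₀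
        (by linarith) (by linarith)) (by have := hα0 k; have := hγ0 l; positivity) (by positivity)
      refine Real.rpow_le_rpow_of_exponent_le (by norm_num) ?_
      have e : (k - ρ * x) * (1 - x₀ / x) - (l - μ * y) * (1 - y₀ / y) = b * u := by
        have e1 : 1 - x₀ / x = b * ((x₁ - x₀) / x) := by
          field_simp; rw [hxdef]; linear_combination x₀ * hab
        have e2 : 1 - y₀ / y = b * ((y₁ - y₀) / y) := by
          field_simp; rw [hydef]; linear_combination y₀ * hab
        rw [e1, e2, hu]
        simp only [c]
        field_simp
        ring
      rw [e, abs_of_nonpos hu0]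
      nlinarith [min_le_right a b]
    · refine (hT₁ k l).trans (mul_le_mul' le_rfl (ENNReal.ofReal_le_ofReal ?_))
      rw [two_rpow_mul_rpow_mul_eq (ρ := ρ) (μ := μ) hx0 hy0 (hA k) (hB l), mul_assoc]
      refine mul_le_mul_of_nonneg_left ?_ hV
      refine mul_le_mul ?_ (rpow_mul_rpow_le_add (hα0 k) (hα1 k) (hγ0 l) (hγ1 l) (by linarith)
        (by linarith) (by linarith)) (by have := hα0 k; have := hγ0 l; positivity) (by positivity)
      refine Real.rpow_le_rpow_of_exponent_le (by norm_num) ?_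
      have e : (k - ρ * x) * (1 - x₁ / x) - (l - μ * y) * (1 - y₁ / y) = -a * u := by
        have e1 : 1 - x₁ / x = -a * ((x₁ - x₀) / x) := by
          field_simp; rw [hxdef]; linear_combination x₁ * hab
        have e2 : 1 - y₁ / y = -a * ((y₁ - y₀) / y) := by
          field_simp; rw [hydef]; linear_combination y₁ * hab
        rw [e1, e2, hu]
        simp only [c]
        field_simp
        ring
      rw [e, abs_of_nonneg hu0]
      nlinarith [min_le_left a b]
  refine (ENNReal.tsum_le_tsum fun k => ENNReal.tsum_le_tsum fun l => hterm k l).trans ?_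
  simp only [ENNReal.tsum_mul_left]
  calc _ ≤ D * ENNReal.ofReal V * (C * (1 + 1)) := mul_le_mul' le_rfl
        ((hC c _ _).trans (mul_le_mul' le_rfl (add_le_add hαs hγs)))
    _ = _ := by push_cast; ring

end SphericalMax

end

set_option linter.unusedSectionVars false

noncomputable section

namespace SphericalMax

open Metric Set Filter Topology

/-! ### Strong type bounds -/

variable {d : ℕ}

lemma tsum_two_rpow_mul_volume_level_le {f : EuclideanSpace ℝ (Fin d) → ℂ}
    (hf : AEStronglyMeasurable f volume) {p : ℝ} (hp : 0 ≤ p) :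
    ∑' k : ℤ, (2 ^ k : ℝ≥0∞) ^ p * volume (level (fun z => ‖f z‖ₑ) k) ≤ ∫⁻ z, ‖f z‖ₑ ^ p := by
  set L : ℤ → Set (EuclideanSpace ℝ (Fin d)) := fun k => {z | 2 ^ k < ‖f z‖ₑ ∧ ‖f z‖ₑ ≤ 2 ^ (k + 1)}
  have hL : ∀ k, NullMeasurableSet (L k) volume := fun k =>
    (nullMeasurableSet_lt aemeasurable_const hf.enorm).inter
      (nullMeasurableSet_le hf.enorm aemeasurable_const)
  have hdisj : Pairwise (Function.onFun Disjoint L) := by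
    have hmono : Monotone fun k : ℤ => (2 : ℝ≥0∞) ^ k :=
      fun k l hkl => ENNReal.zpow_le_of_le (by norm_num) hkl
    intro k l hkl
    have := hmono.pairwise_disjoint_on_Ioc_succ hkl
    exact Disjoint.preimage (fun z => ‖f z‖ₑ) this
  calc _ ≤ ∑' k : ℤ, ∫⁻ z in L k, ‖f z‖ₑ ^ p := by
        refine ENNReal.tsum_le_tsum fun k => ?_
        rw [volume_level, ← setLIntegral_const]
        refine lintegral_mono_ae ((ae_restrict_iff'₀ (hL k)).2 (.of_forall fun z hz => ?_))
        exact ENNReal.rpow_le_rpow hz.1.le hp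
    _ = ∫⁻ z in ⋃ k, L k, ‖f z‖ₑ ^ p :=
        (lintegral_iUnion₀ hL (fun k l hkl => (hdisj hkl).aedisjoint) _).symm
    _ ≤ _ := setLIntegral_le_lintegral _ _

lemma lintegral_rpow_le_tsum {h : EuclideanSpace ℝ (Fin d) → ℝ≥0∞} (hh : Measurable h) {q : ℝ}
    (hq : 0 < q) :
    ∫⁻ z, h z ^ q ≤ 2 ^ q * ∑' l : ℤ, (2 ^ l : ℝ≥0∞) ^ q * volume {z | 2 ^ l < h z} := by
  have hm : ∀ l : ℤ, MeasurableSet {z | (2 : ℝ≥0∞) ^ l < h z} :=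
    fun l => measurableSet_lt measurable_const hh
  have e : ∀ l : ℤ, (2 ^ l : ℝ≥0∞) ^ q * volume {z | 2 ^ l < h z} =
      ∫⁻ z, {z | (2 : ℝ≥0∞) ^ l < h z}.indicator (fun _ => (2 ^ l : ℝ≥0∞) ^ q) z := fun l => by
    rw [lintegral_indicator_const (hm l)]
  simp only [e]
  rw [← lintegral_tsum fun l => (measurable_const.indicator (hm l)).aemeasurable,
    ← lintegral_const_mul _ (.tsum fun l => measurable_const.indicator (hm l))]
  refine lintegral_mono fun z => ?_
  rcases eq_or_ne (h z) 0 with h0 | h0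
  · simp [h0, hq]
  rcases eq_or_ne (h z) ∞ with h1 | h1
  · have : ∑' l : ℤ, {z | (2 : ℝ≥0∞) ^ l < h z}.indicator (fun _ => (2 ^ l : ℝ≥0∞) ^ q) z = ∞ := by
      refine top_unique ?_
      calc (∞ : ℝ≥0∞) = ∑' _ : ℕ, 1 := (ENNReal.tsum_const_eq_top_of_ne_zero one_ne_zero).symm
        _ ≤ ∑' n : ℕ, {z | (2 : ℝ≥0∞) ^ (n : ℤ) < h z}.indicator
              (fun _ => (2 ^ (n : ℤ) : ℝ≥0∞) ^ q) z := by
            refine ENNReal.tsum_le_tsum fun n => ?_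
            rw [indicator_of_mem (by simp [h1])]
            rw [zpow_natCast]
            exact ENNReal.one_le_rpow (one_le_pow₀ (by norm_num)) hq
        _ ≤ _ := ENNReal.tsum_comp_le_tsum_of_injective Nat.cast_injective _
    rw [this, ENNReal.mul_top (by simp)]
    exact le_top
  obtain ⟨k, hk⟩ := ENNReal.exists_mem_Ioc_zpow h0 h1 ENNReal.one_lt_two ENNReal.ofNat_ne_top
  refine le_trans ?_ (mul_le_mul' le_rfl (ENNReal.le_tsum k))
  rw [indicator_of_mem (show z ∈ {z | (2 : ℝ≥0∞) ^ k < h z} from hk.1),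
    ← ENNReal.mul_rpow_of_nonneg _ _ hq.le]
  refine ENNReal.rpow_le_rpow (hk.2.trans (le_of_eq ?_)) hq.le
  rw [ENNReal.zpow_add (by norm_num) (by norm_num), zpow_one, mul_comm]

lemma two_zpow_rpow (k : ℤ) (p : ℝ) :
    ((2 : ℝ≥0∞) ^ k) ^ p = ENNReal.ofReal ((2 : ℝ) ^ (k * p)) := by
  rw [← ENNReal.rpow_intCast, ← ENNReal.rpow_mul, ← ENNReal.ofReal_rpow_of_pos (by norm_num),
    ENNReal.ofReal_ofNat]

lemma rpow_eq_ofReal_toReal_rpow {v : ℝ≥0∞} (hv : v ≠ ∞) {x : ℝ} (hx : 0 ≤ x) :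
    v ^ x = ENNReal.ofReal (v.toReal ^ x) := by
  rw [← ENNReal.ofReal_rpow_of_nonneg ENNReal.toReal_nonneg hx, ENNReal.ofReal_toReal hv]

/-- It permits truncation to finitely many levels and to balls, where all quantities are finite,
before the limit is taken. -/
lemma tsum_volume_inter_ball_le {S : ℤ → Set (EuclideanSpace ℝ (Fin d))} {c : ℤ → ℝ≥0∞}
    (hc : ∀ l, c l ≠ ∞) {K : ℝ≥0∞}
    (h : ∀ (s : Finset ℤ) (n : ℕ), ∑ l ∈ s, c l * volume (S l ∩ ball 0 n) ≤ K) :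
    ∑' l, c l * volume (S l) ≤ K := by
  rw [ENNReal.tsum_eq_iSup_sum]
  refine iSup_le fun s => ?_
  have hlim : Tendsto (fun n : ℕ => ∑ l ∈ s, c l * volume (S l ∩ ball 0 n)) atTop
      (𝓝 (∑ l ∈ s, c l * volume (S l))) := by
    refine tendsto_finsetSum _ fun l _ => ENNReal.Tendsto.const_mul ?_ (Or.inr (hc l))
    have hmono : Monotone fun n : ℕ => S l ∩ ball 0 n := fun m n hmn =>
      inter_subset_inter_right _ (ball_subset_ball (by exact_mod_cast hmn))
    have hun : ⋃ n : ℕ, S l ∩ ball 0 n = S l := by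
      rw [← inter_iUnion, inter_eq_left]
      intro z _
      obtain ⟨n, hn⟩ := exists_nat_gt ‖z‖
      exact mem_iUnion.2 ⟨n, by simpa using hn⟩
    have := tendsto_measure_iUnion_atTop (μ := volume) hmono
    rwa [hun] at this
  exact le_of_tendsto' hlim fun n => h s n

variable [NeZero d]

/-- Let `W` be the truncated dyadic sum for `∫ h^(1/y)`. Bounding `|G l|` by the integral of `h`
over `G l` and splitting `h` into levels of `f` gives a double sum, and interpolation yields `W ≤ K
N^x W^(1-y)`. Dividing is legitimate because the truncated `W` is finite. -/
lemma Restricted.exists_lintegral_majorant_rpow_le {E : Set ℝ} {x₀ x₁ y₀ y₁ a b : ℝ}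
    (hx₀ : 0 ≤ x₀) (hy₀ : 0 ≤ y₀) (hx : x₀ < x₁) (hy : y₀ < y₁) (hy₁ : y₁ ≤ 1) (h₀ : y₀ ≤ x₀)
    (h₁ : y₁ ≤ x₁) (ha : 0 < a) (hb : 0 < b) (hab : a + b = 1)
    (hr₀ : Restricted d E x₀ (1 - y₀)) (hr₁ : Restricted d E x₁ (1 - y₁)) :
    ∃ C : ℝ≥0, ∀ f : EuclideanSpace ℝ (Fin d) → ℂ, AEStronglyMeasurable f volume →
      ∫⁻ z, ‖f z‖ₑ ^ (1 / (a * x₀ + b * x₁)) ≠ 0 →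
      ∫⁻ z, ‖f z‖ₑ ^ (1 / (a * x₀ + b * x₁)) ≠ ∞ →
      (∫⁻ z, majorant E (fun z => ‖f z‖ₑ) z ^ (1 / (a * y₀ + b * y₁))) ^ (a * y₀ + b * y₁) ≤
        C * (∫⁻ z, ‖f z‖ₑ ^ (1 / (a * x₀ + b * x₁))) ^ (a * x₀ + b * x₁) := by
  obtain ⟨c₀, hc₀⟩ := hr₀.exists_lintegral_setMajorant_le (by linarith)
  obtain ⟨c₁, hc₁⟩ := hr₁.exists_lintegral_setMajorant_le (by linarith)
  obtain ⟨C, hC⟩ := exists_tsum_interpolation_le hx₀ hy₀ hx hy hy₁ h₀ h₁ ha hb hab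
  set x := a * x₀ + b * x₁
  set y := a * y₀ + b * y₁
  have hx0 : 0 < x := by have := mul_pos hb (hx₀.trans_lt hx); have := mul_nonneg ha.le hx₀; linarith
  have hy0 : 0 < y := by have := mul_pos hb (hy₀.trans_lt hy); have := mul_nonneg ha.le hy₀; linarith
  set K : ℝ≥0 := C * (2 * max c₀ c₁)
  refine ⟨2 * K, fun f hf hN0 hN => ?_⟩
  set N := ∫⁻ z, ‖f z‖ₑ ^ (1 / x) with hNdef
  have hNpos : 0 < N.toReal := ENNReal.toReal_pos hN0 hN
  set ρ := Real.logb 2 N.toReal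
  have hρ : (2 : ℝ) ^ ρ = N.toReal := Real.rpow_logb (by norm_num) (by norm_num) hNpos
  set h := majorant E fun z => ‖f z‖ₑ with hhdef
  have hh : Measurable h := measurable_majorant E _
  set F := level fun z => ‖f z‖ₑ
  have hFsum := tsum_two_rpow_mul_volume_level_le hf (p := 1 / x) (by positivity)
  have hFfin : ∀ k, volume (F k) ≠ ∞ := fun k hk => by
    have h1 := (ENNReal.le_tsum k).trans hFsum
    rw [two_zpow_rpow] at h1
    change _ * volume (F k) ≤ _ at h1
    rw [hk, ENNReal.mul_top (by simpa using by positivity)] at h1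
    exact hN (top_unique h1)
  set A : ℤ → ℝ := fun k => (volume (F k)).toReal
  have hAs : ∑' k : ℤ, ENNReal.ofReal (2 ^ (k / x) * A k) ≤ ENNReal.ofReal (2 ^ ρ) := by
    rw [hρ, ENNReal.ofReal_toReal hN]
    refine le_trans (le_of_eq (tsum_congr fun k => ?_)) hFsum
    rw [two_zpow_rpow, ENNReal.ofReal_mul (by positivity), ENNReal.ofReal_toReal (hFfin k),
      mul_one_div]
  have key : ∀ (s : Finset ℤ) (n : ℕ),
      ∑ l ∈ s, (2 ^ l : ℝ≥0∞) ^ (1 / y) * volume ({z | 2 ^ l < h z} ∩ ball 0 n) ≤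
        (K * N ^ x) ^ (1 / y) := by
    intro s n
    classical
    -- Superlevel sets of the majorant, truncated to a ball and to finitely many `l`, so that `W` is
    -- finite.
    set G : ℤ → Set (EuclideanSpace ℝ (Fin d)) := fun l =>
      if l ∈ s then {z | 2 ^ l < h z} ∩ ball 0 n else ∅ with hGdef
    have hGm : ∀ l, MeasurableSet (G l) := fun l => by
      simp only [G]
      split_ifs
      · exact (measurableSet_lt measurable_const hh).inter measurableSet_ball
      · exact .empty
    have hGh : ∀ l, ∀ z ∈ G l, 2 ^ l < h z := fun l z hz => by
      simp only [G] at hz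
      split_ifs at hz
      · exact hz.1
      · exact absurd hz (notMem_empty z)
    have hGfin : ∀ l, volume (G l) ≠ ∞ := fun l => by
      simp only [G]
      split_ifs
      · exact measure_ne_top_of_subset inter_subset_right measure_ball_lt_top.ne
      · simp
    set B : ℤ → ℝ := fun l => (volume (G l)).toReal
    have hBeq : ∀ l : ℤ, ENNReal.ofReal (2 ^ (l / y) * B l) =
        (2 ^ l : ℝ≥0∞) ^ (1 / y) * volume (G l) := fun l => by
      rw [two_zpow_rpow, ENNReal.ofReal_mul (by positivity), ENNReal.ofReal_toReal (hGfin l),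
        mul_one_div]
    set W := ∑' l : ℤ, ENNReal.ofReal (2 ^ (l / y) * B l) with hWdef
    have hW : ∑ l ∈ s, (2 ^ l : ℝ≥0∞) ^ (1 / y) * volume ({z | 2 ^ l < h z} ∩ ball 0 n) = W := by
      rw [hWdef, tsum_eq_sum (s := s) fun l hl => by rw [hBeq]; simp [G, hl]]
      refine Finset.sum_congr rfl fun l hl => ?_
      rw [hBeq]
      simp only [G, hl, if_true]
    rw [hW]
    have hWtop : W ≠ ∞ := by
      rw [hWdef, tsum_eq_sum (s := s) fun l hl => by rw [hBeq]; simp [G, hl]]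
      exact (ENNReal.sum_lt_top.2 fun l _ => ENNReal.ofReal_lt_top).ne
    rcases eq_or_ne W 0 with hW0 | hW0
    · rw [hW0]; exact zero_le
    have hWpos : 0 < W.toReal := ENNReal.toReal_pos hW0 hWtop
    set μ := Real.logb 2 W.toReal
    have hμ : (2 : ℝ) ^ μ = W.toReal := Real.rpow_logb (by norm_num) (by norm_num) hWpos
    set T : ℤ → ℤ → ℝ≥0∞ := fun k l => ENNReal.ofReal (2 ^ (l * (1 / y - 1))) *
      ∫⁻ z in G l, 2 ^ (k + 1) * setMajorant E (F k) z
    have hT : ∀ {c : ℝ≥0} {x' y' : ℝ}, c ≤ max c₀ c₁ → 0 ≤ x' → y' ≤ 1 →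
        (∀ F : Set (EuclideanSpace ℝ (Fin d)), volume F ≠ ∞ →
        ∀ G : Set (EuclideanSpace ℝ (Fin d)), MeasurableSet G → volume G ≠ ∞ →
        ∫⁻ z in G, setMajorant E F z ≤ c * (volume F ^ x' * volume G ^ (1 - y'))) →
        ∀ k l : ℤ, T k l ≤ ((2 * max c₀ c₁ : ℝ≥0) : ℝ≥0∞) *
          ENNReal.ofReal (2 ^ (k + l * (1 / y - 1)) * (A k ^ x' * B l ^ (1 - y'))) := by
      intro c x' y' hc hx' hy' hcF k l
      have h1 := hcF (F k) (hFfin k) (G l) (hGm l) (hGfin l)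
      rw [rpow_eq_ofReal_toReal_rpow (hFfin k) hx',
        rpow_eq_ofReal_toReal_rpow (hGfin l) (by linarith),
        ← ENNReal.ofReal_mul (by positivity)] at h1
      have e : (2 : ℝ≥0∞) ^ (k + 1) = 2 * ENNReal.ofReal (2 ^ (k : ℝ)) := by
        rw [Real.rpow_intCast, ofReal_two_zpow, ENNReal.zpow_add (by norm_num) (by norm_num),
          zpow_one, mul_comm]
      simp only [T]
      rw [lintegral_const_mul _ (measurable_setMajorant E _), e, Real.rpow_add (by norm_num),
        ENNReal.ofReal_mul (by positivity), ENNReal.ofReal_mul (by positivity)]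
      calc _ ≤ ENNReal.ofReal (2 ^ (l * (1 / y - 1))) * (2 * ENNReal.ofReal (2 ^ (k : ℝ)) *
            ((max c₀ c₁ : ℝ≥0) * ENNReal.ofReal (A k ^ x' * B l ^ (1 - y')))) := by
            refine mul_le_mul' le_rfl (mul_le_mul' le_rfl (h1.trans (mul_le_mul' ?_ le_rfl)))
            exact_mod_cast hc
        _ = _ := by push_cast; ring
    have hmain := hC ρ μ A B _ T (fun k => ENNReal.toReal_nonneg) (fun l => ENNReal.toReal_nonneg)
      hAs (by rw [hμ, ENNReal.ofReal_toReal hWtop]) (hT (le_max_left _ _) hx₀ (by linarith) hc₀)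
      (hT (le_max_right _ _) (by linarith) hy₁ hc₁)
    -- Chebyshev on each `G l`: one power of `2^l` is traded for the majorant, and the remaining
    -- power `1/y - 1` is already contained in `T`.
    have hlow : W ≤ ∑' k, ∑' l, T k l := by
      rw [ENNReal.tsum_comm]
      refine ENNReal.tsum_le_tsum fun l => ?_
      simp only [T]
      rw [ENNReal.tsum_mul_left, ← lintegral_tsum fun k =>
        ((measurable_setMajorant E (F k)).const_mul _).aemeasurable]
      change _ ≤ _ * ∫⁻ z in G l, h z
      have h1 : (2 : ℝ≥0∞) ^ l * volume (G l) ≤ ∫⁻ z in G l, h z := by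
        rw [← setLIntegral_const]
        exact setLIntegral_mono' (hGm l) fun z hz => (hGh l z hz).le
      refine le_trans (le_of_eq ?_) (mul_le_mul' le_rfl h1)
      rw [hBeq, ← mul_assoc]
      congr 1
      rw [two_zpow_rpow, ← ofReal_two_zpow, ← ENNReal.ofReal_mul (by positivity),
        ← Real.rpow_intCast, ← Real.rpow_add (by norm_num)]
      congr 2; ring
    have hfin := hlow.trans hmain
    have e1 : W = ENNReal.ofReal (2 ^ μ) := by rw [hμ, ENNReal.ofReal_toReal hWtop]
    have e2 : N ^ x = ENNReal.ofReal (2 ^ (ρ * x)) := by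
      rw [rpow_eq_ofReal_toReal_rpow hN hx0.le, ← hρ, ← Real.rpow_mul (by norm_num)]
    have e3 : ENNReal.ofReal ((2 : ℝ) ^ μ) =
        ENNReal.ofReal (2 ^ (μ * y)) * ENNReal.ofReal (2 ^ (μ * (1 - y))) := by
      rw [← ENNReal.ofReal_mul (by positivity), ← Real.rpow_add (by norm_num)]
      congr 2; ring
    have h2 : ENNReal.ofReal (2 ^ (μ * y)) ≤ K * N ^ x := by
      rw [e1, e3, Real.rpow_add (by norm_num), ENNReal.ofReal_mul (by positivity), ← mul_assoc,
        ← e2, ENNReal.mul_le_mul_iff_left (by simpa using by positivity) ENNReal.ofReal_ne_top]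
        at hfin
      simpa only [K, ENNReal.coe_mul] using hfin
    calc W = ENNReal.ofReal (2 ^ (μ * y)) ^ (1 / y) := by
          rw [e1, ENNReal.ofReal_rpow_of_pos (by positivity), ← Real.rpow_mul (by norm_num),
            mul_assoc, mul_one_div_cancel hy0.ne', mul_one]
      _ ≤ _ := ENNReal.rpow_le_rpow h2 (by positivity)
  have h3 := tsum_volume_inter_ball_le (c := fun l : ℤ => (2 ^ l : ℝ≥0∞) ^ (1 / y))
    (fun l => by rw [two_zpow_rpow]; exact ENNReal.ofReal_ne_top) key
  have h4 := (lintegral_rpow_le_tsum hh (q := 1 / y) (by positivity)).trans (mul_le_mul' le_rfl h3)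
  rw [← ENNReal.mul_rpow_of_nonneg _ _ (by positivity)] at h4
  calc _ ≤ ((2 * (K * N ^ x)) ^ (1 / y)) ^ y := ENNReal.rpow_le_rpow h4 hy0.le
    _ = _ := by
      rw [← ENNReal.rpow_mul, one_div_mul_cancel hy0.ne', ENNReal.rpow_one]
      push_cast; ring

/-- Locally `L^p` embeds into the Lorentz space with smaller exponent `1/x`: for `s ≤ 1` the ball
bounds the measure, and for `s > 1` Chebyshev gives `s^(-px)`, integrable because `px > 1`. -/
lemma distIntegral_indicator_ball_ne_top {f : EuclideanSpace ℝ (Fin d) → ℂ}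
    (hf : AEStronglyMeasurable f volume) {p x : ℝ} (hp : 0 < p) (hx : 1 < p * x)
    (hfin : ∫⁻ z, ‖f z‖ₑ ^ p ≠ ∞) (r : ℝ) : distIntegral x ((ball 0 r).indicator f) ≠ ∞ := by
  have hx0 : 0 < x := by
    by_contra! h0
    nlinarith
  set V := volume (ball (0 : EuclideanSpace ℝ (Fin d)) r)
  have hV : V ≠ ∞ := measure_ball_lt_top.ne
  unfold distIntegral
  rw [← Ioc_union_Ioi_eq_Ioi (zero_le_one (α := ℝ))]
  refine ne_top_of_le_ne_top ?_ (lintegral_union_le _ _ _)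
  refine ENNReal.add_ne_top.2 ⟨?_, ?_⟩
  · refine ne_top_of_le_ne_top (b := ∫⁻ _ in Ioc (0 : ℝ) 1, V ^ x) ?_
      (setLIntegral_mono' measurableSet_Ioc fun s hs => ?_)
    · rw [setLIntegral_const]
      exact ENNReal.mul_ne_top (ENNReal.rpow_ne_top_of_nonneg hx0.le hV) (by simp)
    · refine ENNReal.rpow_le_rpow (measure_mono fun z hz => ?_) hx0.le
      by_contra hzb
      rw [mem_ofPred_eq, indicator_of_notMem hzb, norm_zero] at hz
      exact absurd hz (not_lt.2 hs.1.le)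
  · set N := ∫⁻ z, ‖f z‖ₑ ^ p
    have hint := integrableOn_Ioi_rpow_of_lt (a := -(p * x)) (by linarith) zero_lt_one
    refine ne_top_of_le_ne_top (b := ∫⁻ s in Ioi (1 : ℝ), N ^ x * ENNReal.ofReal (s ^ (-(p * x))))
      ?_ (setLIntegral_mono' measurableSet_Ioi fun s hs => ?_)
    · rw [lintegral_const_mul _ (by fun_prop)]
      exact ENNReal.mul_ne_top (ENNReal.rpow_ne_top_of_nonneg hx0.le hfin)
        hint.lintegral_lt_top.ne
    · have hs0 : 0 < s := zero_lt_one.trans hs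
      have h1 := mul_meas_ge_le_lintegral₀ (hf.enorm.pow_const p) (ENNReal.ofReal (s ^ p))
      have h2 : volume {z | s < ‖(ball 0 r).indicator f z‖} ≤ N * ENNReal.ofReal (s ^ (-p)) := by
        rw [Real.rpow_neg hs0.le, ENNReal.ofReal_inv_of_pos (by positivity), ← div_eq_mul_inv,
          ENNReal.le_div_iff_mul_le (Or.inl (by simpa using by positivity))
            (Or.inl ENNReal.ofReal_ne_top), mul_comm]
        refine (mul_le_mul' le_rfl (measure_mono fun z hz => ?_)).trans h1
        have h3 : s < ‖f z‖ := lt_of_lt_of_le hz (norm_indicator_le_norm_self _ _)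
        rw [mem_ofPred_eq, ← ENNReal.ofReal_rpow_of_pos hs0, ← ofReal_norm]
        exact ENNReal.rpow_le_rpow (ENNReal.ofReal_le_ofReal h3.le) hp.le
      refine (ENNReal.rpow_le_rpow h2 hx0.le).trans (le_of_eq ?_)
      rw [ENNReal.mul_rpow_of_nonneg _ _ hx0.le, ENNReal.ofReal_rpow_of_pos (by positivity),
        ← Real.rpow_mul hs0.le, neg_mul]

lemma Restricted.strongType {E : Set ℝ} (hE : E ⊆ Icc 1 2) {x₀ x₁ y₀ y₁ a b : ℝ}
    (hx₀ : 0 ≤ x₀) (hy₀ : 0 ≤ y₀) (hx : x₀ < x₁) (hy : y₀ < y₁) (hy₁ : y₁ ≤ 1) (h₀ : y₀ ≤ x₀)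
    (h₁ : y₁ ≤ x₁) (ha : 0 < a) (hb : 0 < b) (hab : a + b = 1)
    (hr₀ : Restricted d E x₀ (1 - y₀)) (hr₁ : Restricted d E x₁ (1 - y₁)) {p q : ℝ≥0∞}
    (hp : p⁻¹.toReal = a * x₀ + b * x₁) (hq : q⁻¹.toReal = a * y₀ + b * y₁) :
    StrongType d E p q := by
  obtain ⟨C, hC⟩ := Restricted.exists_lintegral_majorant_rpow_le hx₀ hy₀ hx hy hy₁ h₀ h₁ ha hb hab
    hr₀ hr₁
  rw [← hp, ← hq] at hC
  have hx0 : 0 < p⁻¹.toReal := by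
    have := mul_pos hb (hx₀.trans_lt hx); have := mul_nonneg ha.le hx₀; linarith
  have hy0 : 0 < q⁻¹.toReal := by
    have := mul_pos hb (hy₀.trans_lt hy); have := mul_nonneg ha.le hy₀; linarith
  have hx1 : p⁻¹.toReal < x₁ := by rw [hp]; nlinarith
  obtain ⟨hp1, hp2⟩ := ENNReal.toReal_pos_iff.1 hx0
  obtain ⟨hq1, hq2⟩ := ENNReal.toReal_pos_iff.1 hy0
  have hp0 : p ≠ 0 := fun h => by simp [h] at hp2
  have hpt : p ≠ ∞ := fun h => by simp [h] at hp1
  have hq0 : q ≠ 0 := fun h => by simp [h] at hq2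
  have hqt : q ≠ ∞ := fun h => by simp [h] at hq1
  have ep : 1 / p⁻¹.toReal = p.toReal := by rw [ENNReal.toReal_inv, one_div, inv_inv]
  have eq' : 1 / q⁻¹.toReal = q.toReal := by rw [ENNReal.toReal_inv, one_div, inv_inv]
  have ep' : 1 / p.toReal = p⁻¹.toReal := by rw [ENNReal.toReal_inv, one_div]
  have eq'' : 1 / q.toReal = q⁻¹.toReal := by rw [ENNReal.toReal_inv, one_div]
  have hppos : 0 < p.toReal := ENNReal.toReal_pos hp0 hpt
  rw [ep, eq'] at hC
  refine ⟨C, fun f hf => ?_⟩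
  have hfin : ∫⁻ z, ‖f z‖ₑ ^ p.toReal ≠ ∞ :=
    (lintegral_rpow_enorm_lt_top_of_eLpNorm_lt_top hp0 hpt hf.2).ne
  have hpx : 1 < p.toReal * x₁ := by
    rw [← mul_inv_cancel₀ hppos.ne', ← ENNReal.toReal_inv]
    exact mul_lt_mul_of_pos_left hx1 hppos
  -- The endpoint with the larger `x₁` is used, since `1/p < x₁` places `f` locally in `L^{1/x₁,1}`.
  refine ⟨hr₁.maximalWellDefined hE (by linarith) (by linarith) hf.1 fun n =>
    distIntegral_indicator_ball_ne_top hf.1 hppos hpx hfin n, ?_⟩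
  -- The norm is normalized through its logarithm, so a function vanishing almost everywhere is
  -- treated apart.
  rcases eq_or_ne (∫⁻ z, ‖f z‖ₑ ^ p.toReal) 0 with h0 | h0
  · have hf0 : f =ᵐ[volume] 0 := by
      rw [← eLpNorm_eq_zero_iff hf.1 hp0, eLpNorm_eq_lintegral_rpow_enorm_toReal hp0 hpt, h0,
        ENNReal.zero_rpow_of_pos (by positivity)]
    have h1 := hr₁.maximalFunction_ae_eq (by linarith) (by linarith) hf0
    have h2 : maximalFunction E (0 : EuclideanSpace ℝ (Fin d) → ℂ) = 0 := by
      ext z; simp [maximalFunction, sphericalMean]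
    rw [eLpNorm_congr_ae h1, h2, eLpNorm_zero]
    exact zero_le
  · rw [eLpNorm_eq_lintegral_rpow_enorm_toReal hp0 hpt,
      eLpNorm_eq_lintegral_rpow_enorm_toReal hq0 hqt, ep', eq'']
    refine le_trans (ENNReal.rpow_le_rpow (lintegral_mono fun z => ?_) hy0.le) (hC f hf.1 h0 hfin)
    refine ENNReal.rpow_le_rpow ?_ ENNReal.toReal_nonneg
    rw [enorm_eq_self]
    exact (maximalFunction_le_maxAvg E f z).trans (maxAvg_le_majorant (fun _ => enorm_ne_top) z)

lemma restricted_zero_one (E : Set ℝ) : Restricted d E 0 1 := by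
  refine ⟨1, fun U _ _ G hG _ => ?_⟩
  rw [ENNReal.rpow_zero, ENNReal.rpow_one, one_mul, ENNReal.coe_one, one_mul]
  refine le_trans (setLIntegral_mono' (g := fun _ => 1) hG fun z _ => ?_) (by simp)
  refine iSup₂_le fun t _ => ?_
  refine (avg_mono (h := fun _ => 1) (fun z => indicator_le_self' (fun _ _ => zero_le) z) t z).trans ?_
  simp [avg]

/-- The bound itself is trivial. The restricted estimate guarantees that the null set where `|f|`
exceeds its essential supremum is missed by almost all points of each sphere, and that the maximal
function is well defined. -/
lemma Restricted.strongType_top {E : Set ℝ} (hE : E ⊆ Icc 1 2) {x w : ℝ} (hx : 0 < x)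
    (hw : 0 ≤ w) (h : Restricted d E x w) : StrongType d E ∞ ∞ := by
  refine ⟨1, fun f hf => ⟨h.maximalWellDefined hE hx hw hf.1 fun n => ?_, ?_⟩⟩
  · set M := (eLpNorm f ∞ volume).toReal
    have hM : ∀ᵐ z, ‖f z‖ ≤ M := by
      filter_upwards [enorm_ae_le_eLpNormEssSup f volume] with z hz
      rw [← eLpNorm_exponent_top] at hz
      rw [← toReal_enorm]
      exact ENNReal.toReal_mono hf.2.ne hz
    set V := volume (ball (0 : EuclideanSpace ℝ (Fin d)) n)
    refine ne_top_of_le_ne_top (b := ∫⁻ s in Ioc 0 M, V ^ x) ?_ ?_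
    · rw [setLIntegral_const]
      exact ENNReal.mul_ne_top (ENNReal.rpow_ne_top_of_nonneg hx.le measure_ball_lt_top.ne)
        (by simp)
    · unfold distIntegral
      rw [← lintegral_indicator measurableSet_Ioc, ← lintegral_indicator measurableSet_Ioi]
      refine lintegral_mono fun s => ?_
      by_cases hs : s ∈ Ioi (0 : ℝ)
      swap
      · rw [indicator_of_notMem hs]; exact zero_le
      rw [indicator_of_mem hs]
      by_cases hsM : s ≤ M
      · rw [indicator_of_mem (show s ∈ Ioc 0 M from ⟨hs, hsM⟩)]
        refine ENNReal.rpow_le_rpow (measure_mono fun z hz => ?_) hx.le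
        by_contra hzb
        rw [mem_ofPred_eq, indicator_of_notMem hzb, norm_zero] at hz
        exact absurd hz (not_lt.2 (le_of_lt hs))
      · have h0 : volume {z | s < ‖(ball 0 (n : ℝ)).indicator f z‖} = 0 := by
          refine measure_mono_null (fun z hz => ?_) hM
          have h3 : s < ‖f z‖ := lt_of_lt_of_le hz (norm_indicator_le_norm_self _ _)
          exact not_le.2 ((not_le.1 hsM).trans h3)
        rw [h0, ENNReal.zero_rpow_of_pos hx]
        exact zero_le
  · rw [ENNReal.coe_one, one_mul, eLpNorm_exponent_top, eLpNorm_exponent_top]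
    set M := eLpNormEssSup f volume
    set N := toMeasurable volume {z | ¬ ‖f z‖ₑ ≤ M}
    have hN : volume N = 0 := by
      rw [measure_toMeasurable]; exact enorm_ae_le_eLpNormEssSup f volume
    have hNm : Measurable (N.indicator (1 : EuclideanSpace ℝ (Fin d) → ℝ≥0∞)) :=
      measurable_one.indicator (measurableSet_toMeasurable _ _)
    refine essSup_le_of_ae_le _ ?_
    filter_upwards [h.ae_maxAvg_indicator_eq_zero hx hw hN] with z hz
    rw [enorm_eq_self]
    refine iSup₂_le fun t ht => (enorm_integral_le_lintegral_enorm _).trans ?_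
    have h0 : avg t (N.indicator 1) z = 0 :=
      le_antisymm ((avg_le_maxAvg ht _ z).trans hz.le) zero_le
    have h1 := (lintegral_eq_zero_iff (hNm.comp (by fun_prop : Measurable fun
      y : sphere (0 : EuclideanSpace ℝ (Fin d)) 1 => z - t • (y : EuclideanSpace ℝ (Fin d))))).1 h0
    calc _ ≤ ∫⁻ _, M ∂(sphereMeasure d) := by
          refine lintegral_mono_ae ?_
          filter_upwards [h1] with y hy
          by_contra hne
          have : z - t • (y : EuclideanSpace ℝ (Fin d)) ∈ N := subset_toMeasurable _ _ hne
          simp [this] at hy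
      _ = M := by simp

end SphericalMax

end

set_option linter.unusedSectionVars false

noncomputable section

namespace SphericalMax

open Metric Set Filter Topology

/-! ### The geometry of the quadrilateral -/

variable {d : ℕ} {β γ : ℝ}

/-- The part of the plane where the exponents `(1 / p, 1 / q)` of the interpolation live. -/
def admissible : Set (ℝ × ℝ) := {P | 0 < P.2 ∧ P.2 ≤ P.1 ∧ P.2 ≤ 1}

lemma admissible.combo {P R : ℝ × ℝ} (hP : P ∈ admissible) (hR : R ∈ admissible) {a b : ℝ}
    (ha : 0 ≤ a) (hb : 0 ≤ b) (hab : a + b = 1) : a • P + b • R ∈ admissible := by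
  obtain ⟨h1, h2, h3⟩ := hP
  obtain ⟨k1, k2, k3⟩ := hR
  simp only [admissible, mem_ofPred_eq, Prod.fst_add, Prod.snd_add, Prod.smul_fst, Prod.smul_snd,
    smul_eq_mul]
  refine ⟨?_, ?_, ?_⟩
  · rcases ha.eq_or_lt with rfl | ha
    · rw [zero_add] at hab; subst hab; simpa using k1
    · have := mul_pos ha h1; have := mul_nonneg hb k1.le; linarith
  · exact add_le_add (mul_le_mul_of_nonneg_left h2 ha) (mul_le_mul_of_nonneg_left k2 hb)
  · nlinarith

lemma Q₂_mem_admissible (hβ : 0 ≤ β) (hβd : β < d - 1) : Q₂ d β ∈ admissible := by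
  have h1 : 0 < (d : ℝ) - 1 + β := by linarith
  refine ⟨div_pos (by linarith) h1, le_rfl, ?_⟩
  exact (div_le_one h1).2 (by linarith)

lemma Q₃_mem_admissible (hβd : β < d - 1) : Q₃ d β ∈ admissible := by
  have h1 : 0 < (d : ℝ) - β + 1 := by linarith
  refine ⟨div_pos one_pos h1, ?_, ?_⟩
  · exact div_le_div_of_nonneg_right (by linarith) h1.le
  · exact (div_le_one h1).2 (by linarith)

lemma Q₄_mem_admissible (hd : 2 ≤ d) (hγ : 0 ≤ γ) : Q₄ d γ ∈ admissible := by
  have hd2 : (2 : ℝ) ≤ d := by exact_mod_cast hd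
  have h1 : 0 < (d : ℝ) ^ 2 + 2 * γ - 1 := by nlinarith
  refine ⟨div_pos (by linarith) h1, ?_, ?_⟩
  · exact div_le_div_of_nonneg_right (by nlinarith) h1.le
  · exact (div_le_one h1).2 (by nlinarith)

/-- The interpolation needs both coordinates strictly ordered. At `β = 1` the first coordinates of
`Q₂` and `Q₃` coincide, whence the condition `β < 1`. -/
lemma Q₃_lt_Q₂ (hβ : 0 ≤ β) (hβ1 : β < 1) (hβd : β < d - 1) :
    (Q₃ d β).1 < (Q₂ d β).1 ∧ (Q₃ d β).2 < (Q₂ d β).2 := by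
  have h1 : 0 < (d : ℝ) - 1 + β := by linarith
  have h2 : 0 < (d : ℝ) - β + 1 := by linarith
  have h3 : 0 < (1 - β) * ((d : ℝ) - 1 - β) := mul_pos (by linarith) (by linarith)
  have h4 : 0 < (d : ℝ) * ((d : ℝ) - 1 - β) := mul_pos (by linarith) (by linarith)
  constructor
  · exact (div_lt_div_iff₀ h2 h1).2 (by nlinarith)
  · exact (div_lt_div_iff₀ h2 h1).2 (by nlinarith)

lemma Q₄_lt_Q₃ (hd : 2 ≤ d) (hβ : 0 ≤ β) (hβγ : β ≤ γ) (hγ : 0 < γ) (hβd : β < d - 1)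
    (hβ1 : β ≤ 1) : (Q₄ d γ).1 < (Q₃ d β).1 ∧ (Q₄ d γ).2 < (Q₃ d β).2 := by
  have hd2 : (2 : ℝ) ≤ d := by exact_mod_cast hd
  have h1 : 0 < (d : ℝ) ^ 2 + 2 * γ - 1 := by nlinarith
  have h2 : 0 < (d : ℝ) - β + 1 := by linarith
  have h3 : 0 < γ * ((d : ℝ) + 1 - 2 * β) := mul_pos hγ (by linarith)
  have h4 : 0 ≤ (γ - β) * ((d : ℝ) - 1) := mul_nonneg (by linarith) (by linarith)
  have h5 : 0 ≤ β * ((d : ℝ) - 1) := mul_nonneg hβ (by linarith)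
  constructor
  · exact (div_lt_div_iff₀ h1 h2).2 (by nlinarith)
  · exact (div_lt_div_iff₀ h1 h2).2 (by nlinarith)

lemma Q₄_zero_eq_Q₃_zero (hd : 2 ≤ d) : Q₄ d 0 = Q₃ d 0 := by
  have hd2 : (2 : ℝ) ≤ d := by exact_mod_cast hd
  have h1 : (d : ℝ) ^ 2 + 2 * 0 - 1 ≠ 0 := by nlinarith
  have h2 : (d : ℝ) - 0 + 1 ≠ 0 := by linarith
  unfold Q₄ Q₃
  ext
  · dsimp only
    rw [div_eq_div_iff h1 h2]; ring
  · dsimp only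
    rw [div_eq_div_iff h1 h2]; ring

variable [NeZero d] {E : Set ℝ}

lemma Restricted.combo {P R : ℝ × ℝ} (hP : P ∈ admissible) (hR : R ∈ admissible)
    (h₀ : Restricted d E P.1 (1 - P.2)) (h₁ : Restricted d E R.1 (1 - R.2)) {a b : ℝ} (ha : 0 ≤ a)
    (hb : 0 ≤ b) (hab : a + b = 1) :
    Restricted d E (a • P + b • R).1 (1 - (a • P + b • R).2) := by
  have := h₀.convex h₁ (hP.1.le.trans hP.2.1) (hR.1.le.trans hR.2.1) (by linarith [hP.2.2])
    (by linarith [hR.2.2]) ha hb hab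
  have e : 1 - (a • P + b • R).2 = a * (1 - P.2) + b * (1 - R.2) := by
    simp only [Prod.snd_add, Prod.smul_snd, smul_eq_mul]
    linear_combination -hab
  rw [e]
  exact this

lemma Restricted.strongType_of_combo (hE : E ⊆ Icc 1 2) {P R : ℝ × ℝ} (hP₁ : 0 ≤ P.2)
    (hP₂ : P.2 ≤ P.1) (hR : R ∈ admissible) (h₀ : Restricted d E P.1 (1 - P.2))
    (h₁ : Restricted d E R.1 (1 - R.2)) (h1 : P.1 < R.1) (h2 : P.2 < R.2) {a b : ℝ} (ha : 0 < a)
    (hb : 0 < b) (hab : a + b = 1) {p q : ℝ≥0∞}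
    (hpq : ((p⁻¹).toReal, (q⁻¹).toReal) = a • P + b • R) : StrongType d E p q :=
  Restricted.strongType hE (hP₁.trans hP₂) hP₁ h1 h2 hR.2.2 hP₂ hR.2.1 ha hb hab h₀ h₁
    (congrArg Prod.fst hpq) (congrArg Prod.snd hpq)

lemma Restricted.restrictedWeakType_of_admissible (hE : E ⊆ Icc 1 2) {P : ℝ × ℝ}
    (hP : P ∈ admissible) (h : Restricted d E P.1 (1 - P.2)) {p q : ℝ} (hpq : (1 / p, 1 / q) = P) :
    RestrictedWeakType d E p q := by
  subst hpq
  have hq : 0 < q := one_div_pos.1 hP.1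
  have hp : 0 < p := one_div_pos.1 (hP.1.trans_le hP.2.1)
  exact h.restrictedWeakType hE hp hq (by linarith [hP.2.2]) (by ring)

/-- `toReal` sends `∞` to zero as well, so `p = 0` has to be excluded. -/
lemma eq_top_of_toReal_inv_eq_zero {p : ℝ≥0∞} (hp : 1 ≤ p) (h : (p⁻¹).toReal = 0) : p = ∞ := by
  rcases (ENNReal.toReal_eq_zero_iff _).1 h with h | h
  · simpa using h
  · rw [ENNReal.inv_eq_top] at h
    simp [h] at hp

/-- Peel the vertices off one at a time: the point lies on a segment from `Q₁` to `R`, with `R`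
between `Q₂` and `S`, and `S` between `Q₃` and `Q₄`. Restricted estimates hold at `R` and `S` by
convexity, so an interior point of any nondegenerate one of these segments has strong type; all of
them have positive slope. -/
lemma strongType_of_mem_hull (hd : 2 ≤ d) (hβ : 0 ≤ β) (hβγ : β ≤ γ) (hβ1 : β < 1)
    (hβd : β < d - 1) (hE : E ⊆ Icc 1 2) (h₂ : Restricted d E (Q₂ d β).1 (1 - (Q₂ d β).2))
    (h₃ : Restricted d E (Q₃ d β).1 (1 - (Q₃ d β).2))
    (h₄ : Restricted d E (Q₄ d γ).1 (1 - (Q₄ d γ).2)) {p q : ℝ≥0∞} (hp : 1 ≤ p) (hq : 1 ≤ q)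
    (hpq : ((p⁻¹).toReal, (q⁻¹).toReal) ∈ Q d β γ \ {Q₂ d β, Q₃ d β, Q₄ d γ}) :
    StrongType d E p q := by
  have m₂ := Q₂_mem_admissible hβ hβd
  have m₃ := Q₃_mem_admissible hβd
  have m₄ := Q₄_mem_admissible hd (hβ.trans hβγ)
  obtain ⟨hmem, hne⟩ := hpq
  simp only [mem_insert_iff, mem_singleton_iff, not_or] at hne
  obtain ⟨n₂, n₃, n₄⟩ := hne
  unfold Q at hmem
  rw [convexHull_insert (by simp), mem_convexJoin] at hmem
  obtain ⟨_, rfl, R, hR, l, k, hl, hk, hlk, hPeq⟩ := hmem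
  rw [convexHull_insert (by simp), mem_convexJoin] at hR
  obtain ⟨_, rfl, S, hS, a, b, ha, hb, hab, rfl⟩ := hR
  rw [convexHull_pair] at hS
  obtain ⟨c, e, hc, he, hce, rfl⟩ := hS
  set S := c • Q₃ d β + e • Q₄ d γ with hSdef
  have mS : S ∈ admissible := admissible.combo m₃ m₄ hc he hce
  have hS : Restricted d E S.1 (1 - S.2) := Restricted.combo m₃ m₄ h₃ h₄ hc he hce
  set R := a • Q₂ d β + b • S with hRdef
  have mR : R ∈ admissible := admissible.combo m₂ mS ha hb hab
  have hR : Restricted d E R.1 (1 - R.2) := Restricted.combo m₂ mS h₂ hS ha hb hab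
  rcases hk.eq_or_lt with rfl | hk
  · rw [zero_smul, add_zero, Q₁, Prod.smul_mk, smul_zero] at hPeq
    rw [eq_top_of_toReal_inv_eq_zero hp (congrArg Prod.fst hPeq.symm),
      eq_top_of_toReal_inv_eq_zero hq (congrArg Prod.snd hPeq.symm)]
    exact h₃.strongType_top hE (m₃.1.trans_le m₃.2.1) (by linarith [m₃.2.2])
  rcases hl.eq_or_lt with rfl | hl
  · rw [zero_add] at hlk
    subst hlk
    rw [zero_smul, zero_add, one_smul] at hPeq
    rcases hb.eq_or_lt with rfl | hb
    · rw [add_zero] at hab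
      subst hab
      exact absurd (by rw [← hPeq, hRdef, one_smul, zero_smul, add_zero]) n₂
    -- For `γ = 0` the vertices `Q₃` and `Q₄` coincide, their segment degenerates, and `S` is the
    -- excluded vertex `Q₃`.
    have hγS : ∀ hγ : γ = 0, S = Q₃ d β := by
      rintro rfl
      obtain rfl : β = 0 := le_antisymm hβγ hβ
      rw [hSdef, Q₄_zero_eq_Q₃_zero hd, ← add_smul, hce, one_smul]
    have hSle : S.1 < (Q₂ d β).1 ∧ S.2 < (Q₂ d β).2 := by
      obtain ⟨o1, o2⟩ := Q₃_lt_Q₂ hβ hβ1 hβd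
      rcases (hβ.trans hβγ).eq_or_lt with hγ | hγ
      · rw [hγS hγ.symm]; exact ⟨o1, o2⟩
      · obtain ⟨o3, o4⟩ := Q₄_lt_Q₃ hd hβ hβγ hγ hβd hβ1.le
        have e1 : S.1 = c * (Q₃ d β).1 + e * (Q₄ d γ).1 := rfl
        have e2 : S.2 = c * (Q₃ d β).2 + e * (Q₄ d γ).2 := rfl
        have f1 := mul_le_mul_of_nonneg_left o3.le he
        have f2 := mul_le_mul_of_nonneg_left o4.le he
        have g1 : c * (Q₃ d β).1 + e * (Q₃ d β).1 = (Q₃ d β).1 := by rw [← add_mul, hce, one_mul]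
        have g2 : c * (Q₃ d β).2 + e * (Q₃ d β).2 = (Q₃ d β).2 := by rw [← add_mul, hce, one_mul]
        constructor <;> linarith
    rcases ha.eq_or_lt with rfl | ha
    · rw [zero_add] at hab
      subst hab
      rw [hRdef, zero_smul, zero_add, one_smul] at hPeq
      have hγ : 0 < γ := (hβ.trans hβγ).lt_of_ne fun h => n₃ (by rw [← hPeq, hγS h.symm])
      rcases hc.eq_or_lt with rfl | hc
      · rw [zero_add] at hce
        subst hce
        exact absurd (by rw [← hPeq, hSdef, one_smul, zero_smul, zero_add]) n₄
      rcases he.eq_or_lt with rfl | he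
      · rw [add_zero] at hce
        subst hce
        exact absurd (by rw [← hPeq, hSdef, one_smul, zero_smul, add_zero]) n₃
      obtain ⟨o3, o4⟩ := Q₄_lt_Q₃ hd hβ hβγ hγ hβd hβ1.le
      exact Restricted.strongType_of_combo hE m₄.1.le m₄.2.1 m₃ h₄ h₃ o3 o4 he hc
        (by linarith) (by rw [← hPeq, hSdef, add_comm])
    · exact Restricted.strongType_of_combo hE mS.1.le mS.2.1 m₂ hS h₂ hSle.1 hSle.2 hb ha
        (by linarith) (by rw [← hPeq, hRdef, add_comm])
  · refine Restricted.strongType_of_combo (P := Q₁) hE le_rfl le_rfl mR ?_ hR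
      (mR.1.trans_le mR.2.1) mR.1 hl hk hlk hPeq.symm
    simpa [Q₁] using restricted_zero_one (d := d) E

end SphericalMax

end

/-! ### Assembly of the theorem from the estimates at the vertices. -/

theorem theorem1p3 (d : ℕ) (β γ : ℝ)
    (hd : (3 ≤ d ∧ 0 ≤ β ∧ β ≤ γ ∧ γ ≤ 1) ∨ (d = 2 ∧ 0 ≤ β ∧ β ≤ γ ∧ γ < 1 / 2))
    (E : Set ℝ) (hE : E ⊆ Set.Icc 1 2) :
    -- (i)
    (SphericalMax.MinkowskiBound E β →
      (∀ p q : ℝ,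
        ((1 / p, 1 / q) = SphericalMax.Q₂ d β ∨ (1 / p, 1 / q) = SphericalMax.Q₃ d β) →
        SphericalMax.RestrictedWeakType d E p q) ∧
      (β < 1 → ∀ p q : ℝ≥0∞, 1 ≤ p → 1 ≤ q →
        ((p⁻¹).toReal, (q⁻¹).toReal) ∈
          openSegment ℝ (SphericalMax.Q₂ d β) (SphericalMax.Q₃ d β) →
        SphericalMax.StrongType d E p q)) ∧
    -- (ii)
    (SphericalMax.AssouadBound E γ →
      ∀ p q : ℝ, (1 / p, 1 / q) = SphericalMax.Q₄ d γ →
        SphericalMax.RestrictedWeakType d E p q) ∧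
    -- (iii)
    (β < 1 → SphericalMax.MinkowskiBound E β → SphericalMax.AssouadBound E γ →
      ∀ p q : ℝ≥0∞, 1 ≤ p → 1 ≤ q →
        ((p⁻¹).toReal, (q⁻¹).toReal) ∈
          SphericalMax.Q d β γ \
            {SphericalMax.Q₂ d β, SphericalMax.Q₃ d β, SphericalMax.Q₄ d γ} →
        SphericalMax.StrongType d E p q) := by
  have hγ0 : 0 ≤ γ := by rcases hd with h | h <;> linarith [h.2.1, h.2.2.1]
  have hβ0 : 0 ≤ β := by rcases hd with h | h <;> linarith [h.2.1]
  have hβγ : β ≤ γ := by rcases hd with h | h <;> linarith [h.2.2.1]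
  have hd2 : 2 ≤ d := by rcases hd with h | h <;> linarith [h.1]
  have : NeZero d := ⟨by omega⟩
  -- The condition for the `L²` bound to decay in `j`: `β ≤ 1 < 2` for `d ≥ 3`, and `β < 1/2 < 1`
  -- for `d = 2`.
  have hβd : β < (d : ℝ) - 1 := by
    rcases hd with ⟨h1, _, h2, h3⟩ | ⟨rfl, _, h2, h3⟩
    · have : (3 : ℝ) ≤ d := by exact_mod_cast h1
      linarith
    · push_cast; linarith
  -- The condition for the `L²` improving bound to decay in `j`: automatic for `d ≥ 3`, and exactly
  -- `γ < 1/2` for `d = 2`.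
  have hγd : 2 * γ < ((d : ℝ) - 1) ^ 2 := by
    rcases hd with ⟨h1, _, h2, h3⟩ | ⟨rfl, _, h2, h3⟩
    · have : (3 : ℝ) ≤ d := by exact_mod_cast h1
      nlinarith
    · push_cast; linarith
  have m₂ := SphericalMax.Q₂_mem_admissible hβ0 hβd
  have m₃ := SphericalMax.Q₃_mem_admissible hβd
  have m₄ := SphericalMax.Q₄_mem_admissible hd2 hγ0
  have h₂ := fun h => (SphericalMax.schwartzRestricted_Q₂ hE hβ0 hβd h).restricted
    (m₂.1.le.trans m₂.2.1)
  have h₃ := fun h => (SphericalMax.schwartzRestricted_Q₃ hE hβd h).restricted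
    (m₃.1.le.trans m₃.2.1)
  have h₄ := fun h => (SphericalMax.schwartzRestricted_Q₄ hd2 hE hγ0 hγd h).restricted
    (m₄.1.le.trans m₄.2.1)
  refine ⟨fun h => ⟨fun p q hpq => ?_, fun hβ1 p q _ _ hpq => ?_⟩, fun h p q hpq => ?_,
    fun hβ1 h h' p q hp hq hpq => ?_⟩
  · rcases hpq with hpq | hpq
    · exact (h₂ h).restrictedWeakType_of_admissible hE m₂ hpq
    · exact (h₃ h).restrictedWeakType_of_admissible hE m₃ hpq
  · obtain ⟨a, b, ha, hb, hab, e⟩ := hpq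
    obtain ⟨o1, o2⟩ := SphericalMax.Q₃_lt_Q₂ hβ0 hβ1 hβd
    exact SphericalMax.Restricted.strongType_of_combo hE m₃.1.le m₃.2.1 m₂ (h₃ h) (h₂ h) o1 o2 hb ha
      (by linarith) (by rw [← e, add_comm])
  · exact (h₄ h).restrictedWeakType_of_admissible hE m₄ hpq
  · exact SphericalMax.strongType_of_mem_hull hd2 hβ0 hβγ hβ1 hβd hE (h₂ h) (h₃ h) (h₄ h') hp hq hpq
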